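/- **Setting.** Let $n\ge 1$, $d\in\mathbb Z$. For an associative $\mathbb C$-algebra $A$ let $\mathfrak{gl}^{\rm fin}_\infty(A)$ be the Lie algebra of $\mathbb N\times\mathbb N$ matrices over $A$ with finitely many nonzero entries, and for a Lie algebra $\mathfrak g$ let $C^\bullet(\mathfrak g)$ be the complex of alternating multilinear complex-valued cochains with the Chevalley–Eilenberg differential $\delta$. Let $\mathrm{Dif}_n=\mathbb C[[x_1,\dots,x_n]][\partial_1,\dots,\partial_n]$, and let $\mathrm{Dif}_{\mathcal O(d),\mathbb{CP}^n}$ be the algebra of global holomorphic differential operators in the line bundle $\mathcal O(d)$ on $\mathbb{CP}^n$. A cochain on $\mathfrak{gl}^{\rm fin}_\infty(\mathrm{Dif}_n)$ is *continuous* if for all $N,k$ its restriction to $N\times N$ matrices of operators of order $\le k$ depends on only finitely many Taylor coefficients of its arguments. Let $U_i=\{z_i\neq0\}\subset\mathbb{CP}^n$ $(1\le i\le n+1)$ and let $\sigma^n$ be the simplex with vertices $[1],\dots,[n+1]$. Let $\widetilde{\mathbb{CP}}{}^n$ be glued along faces from the pieces $U_I\times\sigma^I$, $\emptyset\ne I\subset\{1,\dots,n+1\}$,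 where $U_I=\bigcap_{i\in I}U_i$ and $\sigma^I$ is the face of $\sigma^n$ with vertex set $I$. Suppose that to every point $(z,t)\in\widetilde{\mathbb{CP}}{}^n$ there is attached a germ $\varphi_{z,t}$ at $0$ of a biholomorphism from $\mathbb C^n$ to an open subset of $\mathbb{CP}^n$ (a holomorphic coordinate system) together with a holomorphic trivialization of $\mathcal O(d)$ along it, such that on each piece $U_I\times\sigma^I$ these data (i.e. their Taylor coefficients) depend smoothly on $(z,t)$ and, for fixed $t$, holomorphically on $z\in U_I$, and such that at the vertices $\varphi_{z,[i]}$ is the inverse of the affine coordinate system $w\mapsto(w_k/w_i-z_k/z_i)_{k\ne i}$ on $U_i$. (These are conditions (1)–(4); the centre $\varphi_{z,t}(0)$ is not required to be $z$ away from the vertices.) Writing operators in the coordinate system at $\tilde z=(z,t)$ gives homomorphisms $\mathrm{Dif}_{\mathcal O(d),\mathbb{CP}^n}\to\mathrm{Dif}_n$, $D\mapsto D_{\tilde z}$; a tangent vector $v$ at $\tilde z$ to a piece gives the operator $t_v\in\mathrm{Dif}_n$ of order $\le1$ (a vector field plus a function) by which the expressions of local sections of $\mathcal O(d)$ in the coordinate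 systems change infinitesimally in the direction $v$. Let $\xi\in C^{2n+m}(\mathfrak{gl}^{\rm fin}_\infty(\mathrm{Dif}_n))$, $m\ge0$, be a continuous cocycle into whose first $2n$ arguments infinite scalar matrices $T\otimes\mathrm{Id}$, $T$ of order $\le1$, can be substituted: for all $N,k$ there is $K$ such that for all such $T_1,\dots,T_{2n}$ and all $N\times N$ matrices $A_1,\dots,A_m$ of operators of order $\le k$ the number $\xi(T_1\otimes 1_{N'},\dots,T_{2n}\otimes1_{N'},A_1,\dots,A_m)$ is the same for all $N'\ge K$ (here $1_{N'}=\mathrm{diag}(1,\dots,1,0,0,\dots)$ with $N'$ ones); this number is denoted $\xi(T_1\otimes\mathrm{Id},\dots,T_{2n}\otimes\mathrm{Id},A_1,\dots,A_m)$. Define the $2n$-form $\Theta_{2n}$ with values in $C^m(\mathfrak{gl}^{\rm fin}_\infty(\mathrm{Dif}_{\mathcal O(d),\mathbb{CP}^n}))$ by $$\Theta_{2n}(v_1,\dots,v_{2n})(A_1,\dots,A_m)=\xi\bigl(t_{v_1}\otimes\mathrm{Id},\dots,t_{v_{2n}}\otimes\mathrm{Id},(A_1)_{\tilde z},\dots,(A_m)_{\tilde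 z}\bigr),$$ and let $T^n=\{(1:z_2:\dots:z_{n+1}) : |z_2|=\dots=|z_{n+1}|=1\}$. **Theorem.** The form $\Theta_{2n}$ is well defined on $T^n\times\sigma^n$ and integrable there, and: (i) $\int_{T^n\times\sigma^n}\Theta_{2n}\in C^{m}(\mathfrak{gl}^{\rm fin}_\infty(\mathrm{Dif}_{\mathcal O(d),\mathbb{CP}^n}))$ is a cocycle; (ii) if $\xi=\delta\eta$ for a continuous cochain $\eta$ on $\mathfrak{gl}^{\rm fin}_\infty(\mathrm{Dif}_n)$, then $\int_{T^n\times\sigma^n}\Theta_{2n}$ is a coboundary (for $m=0$: it is zero). -/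

import Mathlib

open scoped ContDiff Topology

noncomputable section

namespace LieIntegral

/-! ### Lie algebra cochains with trivial complex coefficients -/

section Cochains

variable {L : Type*} [LieRing L] [LieAlgebra ℂ L]

/-- The Chevalley–Eilenberg differential:
`(δη)(x₀,…,x_k) = ∑_{i<j} (-1)^j η(x₀,…,[x_i,x_j],…,x̂_j,…,x_k)`, with the bracket in the place
of `x_i`; moving the bracket to the front gives the usual sign `(-1)^(i+j)`. -/
def ceDiff {k : ℕ} (η : L [⋀^Fin k]→ₗ[ℂ] ℂ) (x : Fin (k + 1) → L) : ℂ :=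
  ∑ j : Fin (k + 1), ∑ i ∈ Finset.Iio j,
    (-1) ^ (j : ℕ) * η (fun r => Function.update x i ⁅x i, x j⁆ (j.succAbove r))

def IsCocycle {k : ℕ} (ξ : L [⋀^Fin k]→ₗ[ℂ] ℂ) : Prop :=
  ∀ x, ceDiff ξ x = 0

/-- `ξ` is the differential of a cochain (of degree one less) that satisfies `P`. In degree `0`
the only coboundary is zero. -/
def IsCoboundaryOf (P : ∀ k : ℕ, (L [⋀^Fin k]→ₗ[ℂ] ℂ) → Prop) :
    ∀ {k : ℕ}, (L [⋀^Fin k]→ₗ[ℂ] ℂ) → Prop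
  | 0, ξ => ξ = 0
  | k + 1, ξ => ∃ η : L [⋀^Fin k]→ₗ[ℂ] ℂ, P k η ∧ ∀ x, ξ x = ceDiff η x

def IsCoboundary {k : ℕ} (ξ : L [⋀^Fin k]→ₗ[ℂ] ℂ) : Prop :=
  IsCoboundaryOf (fun _ _ => True) ξ

end Cochains

/-! ### Finite matrices over an associative algebra, as a Lie algebra -/

section GlFin

variable (A : Type*) [Ring A] [Algebra ℂ A]

/-- `ℕ × ℕ` matrices over `A` with finitely many nonzero entries. -/
def glFin : Submodule ℂ (Matrix ℕ ℕ A) where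
  carrier := {M | ∃ N, ∀ i j, (N ≤ i ∨ N ≤ j) → M i j = 0}
  zero_mem' := ⟨0, fun _ _ _ => rfl⟩
  add_mem' := by
    rintro M M' ⟨N, h⟩ ⟨N', h'⟩
    refine ⟨max N N', fun i j hij => ?_⟩
    rw [Matrix.add_apply, h i j (by omega), h' i j (by omega), add_zero]
  smul_mem' := by
    rintro c M ⟨N, h⟩
    exact ⟨N, fun i j hij => by rw [Matrix.smul_apply, h i j hij, smul_zero]⟩

variable {A}

theorem finsum_eq_sum_range {A : Type*} [Ring A] {M M' : Matrix ℕ ℕ A} {N : ℕ} (i j : ℕ)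
    (h : ∀ i j, (N ≤ i ∨ N ≤ j) → M i j = 0) :
    ∑ᶠ k, M i k * M' k j = ∑ k ∈ Finset.range N, M i k * M' k j := by
  apply finsum_eq_sum_of_support_subset
  intro k hk
  by_contra hn
  apply hk
  have : N ≤ k := by simpa using hn
  simp [h i k (Or.inr this)]

/-- The matrix product. -/
instance : Mul (glFin A) where
  mul M M' := ⟨fun i j => ∑ᶠ k, M.1 i k * M'.1 k j, by
    obtain ⟨N, h⟩ := M.2
    obtain ⟨N', h'⟩ := M'.2
    refine ⟨max N N', fun i j hij => (finsum_eq_sum_range i j h).trans ?_⟩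
    refine Finset.sum_eq_zero fun k _ => ?_
    rcases hij with hi | hj
    · rw [h i k (Or.inl (by omega)), zero_mul]
    · rw [h' k j (Or.inr (by omega)), mul_zero]⟩

theorem glFin_mul_apply {M M' : glFin A} {N : ℕ} (i j : ℕ)
    (h : ∀ i j, (N ≤ i ∨ N ≤ j) → M.1 i j = 0) :
    (M * M').1 i j = ∑ k ∈ Finset.range N, M.1 i k * M'.1 k j :=
  finsum_eq_sum_range i j h

theorem glFin_bound (M M' : glFin A) : ∃ N, (∀ i j, (N ≤ i ∨ N ≤ j) → M.1 i j = 0) ∧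
    ∀ i j, (N ≤ i ∨ N ≤ j) → M'.1 i j = 0 := by
  obtain ⟨N, h⟩ := M.2
  obtain ⟨N', h'⟩ := M'.2
  exact ⟨max N N', fun i j hij => h i j (by omega), fun i j hij => h' i j (by omega)⟩

instance : NonUnitalRing (glFin A) where
  left_distrib a b c := by
    obtain ⟨N, h⟩ := a.2
    ext i j
    simp only [Submodule.coe_add, Matrix.add_apply, glFin_mul_apply i j h, mul_add,
      Finset.sum_add_distrib]
  right_distrib a b c := by
    obtain ⟨N, h, h'⟩ := glFin_bound a b
    have h'' : ∀ i j, (N ≤ i ∨ N ≤ j) → (a + b).1 i j = 0 := fun i j hij => by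
      simp [h i j hij, h' i j hij]
    ext i j
    simp only [Submodule.coe_add, Matrix.add_apply, glFin_mul_apply i j h,
      glFin_mul_apply i j h', glFin_mul_apply i j h'', add_mul, Finset.sum_add_distrib]
  zero_mul a := by
    ext i j
    rw [glFin_mul_apply (N := 0) i j (fun _ _ _ => rfl)]
    simp
  mul_zero a := by
    obtain ⟨N, h⟩ := a.2
    ext i j
    rw [glFin_mul_apply i j h]
    simp
  mul_assoc a b c := by
    obtain ⟨N, h, h'⟩ := glFin_bound a b
    have h'' : ∀ i j, (N ≤ i ∨ N ≤ j) → (a * b).1 i j = 0 := fun i j hij => by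
      rw [glFin_mul_apply i j h]
      refine Finset.sum_eq_zero fun k _ => ?_
      rcases hij with hi | hj
      · rw [h i k (Or.inl hi), zero_mul]
      · rw [h' k j (Or.inr hj), mul_zero]
    ext i j
    rw [glFin_mul_apply i j h, glFin_mul_apply i j h'']
    simp only [glFin_mul_apply _ _ h, glFin_mul_apply _ _ h', Finset.sum_mul, Finset.mul_sum,
      mul_assoc]
    exact Finset.sum_comm

/-- The Lie bracket is the commutator of matrices. -/
instance : LieRing (glFin A) where
  add_lie _ _ _ := by simp only [Ring.lie_def, right_distrib, left_distrib]; abel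
  lie_add _ _ _ := by simp only [Ring.lie_def, right_distrib, left_distrib]; abel
  lie_self := by simp only [Ring.lie_def, forall_const, sub_self]
  leibniz_lie _ _ _ := by
    simp only [Ring.lie_def, mul_sub_left_distrib, mul_sub_right_distrib, mul_assoc]; abel

instance : LieAlgebra ℂ (glFin A) where
  lie_smul c a b := by
    obtain ⟨N, h, h'⟩ := glFin_bound a b
    have h'' : ∀ i j, (N ≤ i ∨ N ≤ j) → (c • b).1 i j = 0 := fun i j hij => by
      simp [h' i j hij]
    ext i j
    rw [Ring.lie_def, Ring.lie_def]
    simp only [Submodule.coe_sub, Submodule.coe_smul, Matrix.sub_apply, Matrix.smul_apply,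
      glFin_mul_apply i j h, glFin_mul_apply i j h', glFin_mul_apply i j h'', mul_smul_comm,
      smul_mul_assoc, smul_sub, Finset.smul_sum]

/-- The truncated scalar matrix `a ⊗ 1_N = diag(a,…,a,0,0,…)` with `N` entries `a`. -/
def truncScalar (N : ℕ) (a : A) : glFin A :=
  ⟨fun i j => if i = j ∧ i < N then a else 0, N, fun i j hij => if_neg (by omega)⟩

end GlFin

/-! ### Formal differential operators -/

section Formal

/-- The algebra `ℂ[[x₁,…,x_n]][∂₁,…,∂_n]` of formal differential operators. -/
def Dif (n : ℕ) : Subalgebra ℂ (Module.End ℂ (MvPowerSeries (Fin n) ℂ)) :=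
  Algebra.adjoin ℂ
    (Set.range (fun a : MvPowerSeries (Fin n) ℂ => LinearMap.mulLeft ℂ a) ∪
      Set.range (fun i : Fin n => (MvPowerSeries.pderiv ℂ i).toLinearMap))

/-- `P` has order at most `k`: its iterated commutators with `k + 1` functions vanish. -/
def OrderLE {n : ℕ} : ℕ → Module.End ℂ (MvPowerSeries (Fin n) ℂ) → Prop
  | 0, P => ∀ a : MvPowerSeries (Fin n) ℂ,
      P * LinearMap.mulLeft ℂ a - LinearMap.mulLeft ℂ a * P = 0
  | k + 1, P => ∀ a : MvPowerSeries (Fin n) ℂ,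
      OrderLE k (P * LinearMap.mulLeft ℂ a - LinearMap.mulLeft ℂ a * P)

/-- `M` is an `N × N` matrix of operators of order at most `k`. -/
def InLevel {n : ℕ} (N k : ℕ) (M : glFin (Dif n)) : Prop :=
  (∀ i j, (N ≤ i ∨ N ≤ j) → M.1 i j = 0) ∧
    ∀ i j, OrderLE k (M.1 i j : Module.End ℂ (MvPowerSeries (Fin n) ℂ))

/-- All the coefficients of the operators `M i j` lie in the `J`-th power of the maximal ideal
(equivalently, so do all their values). -/
def VanishesTo {n : ℕ} (J : ℕ) (M : glFin (Dif n)) : Prop :=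
  ∀ i j, ∀ f : MvPowerSeries (Fin n) ℂ, ∀ α : Fin n →₀ ℕ, α.degree < J →
    MvPowerSeries.coeff α ((M.1 i j : Module.End ℂ (MvPowerSeries (Fin n) ℂ)) f) = 0

/-- Continuity of a cochain on `gl_∞^fin(Dif_n)`: on `N × N` matrices of operators of order at most
`k` it depends on finitely many Taylor coefficients of its arguments. -/
def IsContinuousCochain {n l : ℕ} (ξ : glFin (Dif n) [⋀^Fin l]→ₗ[ℂ] ℂ) : Prop :=
  ∀ N k : ℕ, ∃ J : ℕ, ∀ A : Fin l → glFin (Dif n),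
    (∀ i, InLevel N k (A i)) → (∃ i, VanishesTo J (A i)) → ξ A = 0

/-- Infinite scalar matrices `T ⊗ Id` can be put into the first `r` arguments of `ξ`: for operators
`T` of order at most one the value of `ξ` on the truncations `T ⊗ 1_N` does not depend on `N`
once `N` is large, uniformly when the other arguments are matrices of bounded size and order. -/
def IsStable {n : ℕ} (r m : ℕ) (ξ : glFin (Dif n) [⋀^Fin (r + m)]→ₗ[ℂ] ℂ) : Prop :=
  ∀ N k : ℕ, ∃ K : ℕ, ∀ N' ≥ K, ∀ T : Fin r → Dif n,
    (∀ a, OrderLE 1 (T a : Module.End ℂ (MvPowerSeries (Fin n) ℂ))) →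
    ∀ A : Fin m → glFin (Dif n), (∀ i, InLevel N k (A i)) →
      ξ (Fin.append (fun a => truncScalar N' (T a)) A) =
        ξ (Fin.append (fun a => truncScalar K (T a)) A)

end Formal

/-! ### The line bundle `O(d)` on projective space and its differential operators

Open subsets of `ℂPⁿ` are given by their preimages in `ℂⁿ⁺¹ ∖ 0`, sections of `O(d)` by
homogeneous functions of degree `d`. -/

section Projective

/-- The preimage in `ℂⁿ⁺¹ ∖ 0` of an open subset of `ℂPⁿ`. -/
structure ConicOpen (n : ℕ) where
  carrier : Set (Fin (n + 1) → ℂ)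
  isOpen : IsOpen carrier
  zero_notMem : (0 : Fin (n + 1) → ℂ) ∉ carrier
  smul_mem : ∀ c : ℂ, c ≠ 0 → ∀ z ∈ carrier, c • z ∈ carrier

/-- Holomorphic sections of `O(d)` over `V`, extended by zero outside `V`. -/
def sections {n : ℕ} (d : ℤ) (V : ConicOpen n) : Submodule ℂ ((Fin (n + 1) → ℂ) → ℂ) where
  carrier := {f | DifferentiableOn ℂ f V.carrier ∧
    (∀ c : ℂ, c ≠ 0 → ∀ z ∈ V.carrier, f (c • z) = c ^ d * f z) ∧ ∀ z ∉ V.carrier, f z = 0}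
  zero_mem' := ⟨differentiableOn_const 0, by simp, by simp⟩
  add_mem' := by
    rintro f g ⟨h1, h2, h3⟩ ⟨h1', h2', h3'⟩
    refine ⟨h1.add h1', fun c hc z hz => ?_, fun z hz => ?_⟩
    · simp only [Pi.add_apply, h2 c hc z hz, h2' c hc z hz, mul_add]
    · simp only [Pi.add_apply, h3 z hz, h3' z hz, add_zero]
  smul_mem' := by
    rintro b f ⟨h1, h2, h3⟩
    refine ⟨h1.const_smul b, fun c hc z hz => ?_, fun z hz => ?_⟩
    · simp only [Pi.smul_apply, h2 c hc z hz, smul_eq_mul, mul_left_comm]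
    · simp only [Pi.smul_apply, h3 z hz, smul_zero]

/-- The standard chart domain `U_i = {z_i ≠ 0}`. -/
def chart (n : ℕ) (i : Fin (n + 1)) : ConicOpen n where
  carrier := {z | z i ≠ 0}
  isOpen := isOpen_ne_fun (continuous_apply i) continuous_const
  zero_notMem := by simp
  smul_mem := fun c hc z hz => by simpa using ⟨hc, hz⟩

/-- Families of linear operators on the sections of `O(d)` over all open subsets. -/
def OpFamily (n : ℕ) (d : ℤ) : Type :=
  ∀ V : ConicOpen n, Module.End ℂ (sections d V)

instance (n : ℕ) (d : ℤ) : Ring (OpFamily n d) :=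
  inferInstanceAs (Ring (∀ V : ConicOpen n, Module.End ℂ (sections d V)))

instance (n : ℕ) (d : ℤ) : Algebra ℂ (OpFamily n d) :=
  inferInstanceAs (Algebra ℂ (∀ V : ConicOpen n, Module.End ℂ (sections d V)))

/-- Families of linear operators on the sections of `O(d)` over the open subsets of `U_i`. -/
abbrev ChartOpFamily (n : ℕ) (d : ℤ) (i : Fin (n + 1)) : Type :=
  ∀ V : {V : ConicOpen n // V.carrier ⊆ (chart n i).carrier}, Module.End ℂ (sections d V.1)

/-- Holomorphic differential operators in `O(d)` over `U_i`: the algebra generated by the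
multiplications by holomorphic functions on `U_i` and the operators `z_i ∂/∂z_k`; in the affine
coordinates `u_k = z_k / z_i` and the trivialization `z_i ^ d` the latter are the `∂/∂u_k`
(for `k ≠ i`). -/
def chartOps (n : ℕ) (d : ℤ) (i : Fin (n + 1)) : Subalgebra ℂ (ChartOpFamily n d i) :=
  Algebra.adjoin ℂ
    ({D | ∃ a ∈ sections 0 (chart n i), ∀ V (f : sections d V.1), ∀ z ∈ V.1.carrier,
        (D V f).1 z = a z * f.1 z} ∪
      {D | ∃ k : Fin (n + 1), ∀ V (f : sections d V.1), ∀ z ∈ V.1.carrier,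
        (D V f).1 z = z i * fderiv ℂ f.1 z (Pi.single k 1)})

/-- The algebra `Dif_{O(d),ℂPⁿ}` of global holomorphic differential operators in `O(d)`:
endomorphisms of the sheaf of sections that are differential operators over each `U_i`. -/
def DifProj (n : ℕ) (d : ℤ) : Subalgebra ℂ (OpFamily n d) where
  carrier := {D |
    (∀ V V' : ConicOpen n, V'.carrier ⊆ V.carrier →
      ∀ (f : sections d V) (f' : sections d V'), (∀ z ∈ V'.carrier, f.1 z = f'.1 z) →
        ∀ z ∈ V'.carrier, (D V f).1 z = (D V' f').1 z) ∧
    ∀ i, (fun V => D V.1 : ChartOpFamily n d i) ∈ chartOps n d i}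
  mul_mem' := by
    rintro D D' ⟨h1, h2⟩ ⟨h1', h2'⟩
    exact ⟨fun V V' hV f f' hf => h1 V V' hV _ _ (h1' V V' hV f f' hf),
      fun i => (chartOps n d i).mul_mem (h2 i) (h2' i)⟩
  add_mem' := by
    rintro D D' ⟨h1, h2⟩ ⟨h1', h2'⟩
    refine ⟨fun V V' hV f f' hf z hz => ?_, fun i => (chartOps n d i).add_mem (h2 i) (h2' i)⟩
    exact congrArg₂ (· + ·) (h1 V V' hV f f' hf z hz) (h1' V V' hV f f' hf z hz)
  algebraMap_mem' := fun c =>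
    ⟨fun V V' hV f f' hf z hz => congrArg (c * ·) (hf z hz),
      fun i => (chartOps n d i).algebraMap_mem c⟩

end Projective

/-! ### Coordinate systems -/

section Frames

/-- Partial derivative of a function of `n` complex variables. -/
def partialDeriv {n : ℕ} (i : Fin n) (f : (Fin n → ℂ) → ℂ) : (Fin n → ℂ) → ℂ :=
  fun x => fderiv ℂ f x (Pi.single i 1)

/-- The Taylor series at the origin, with coefficients `∂^α f (0) / α!`. -/
def taylor {n : ℕ} (f : (Fin n → ℂ) → ℂ) : MvPowerSeries (Fin n) ℂ :=
  fun α => (∏ i, ((α i).factorial : ℂ))⁻¹ *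
    (List.finRange n).foldr (fun i g => (partialDeriv i)^[α i] g) f 0

/-- A holomorphic coordinate system on `ℂPⁿ`, together with a trivialization of a line bundle
`O(d)`: the coordinate system is the germ at `0` of `x ↦ [lift x]`, a biholomorphism onto a
neighbourhood of `[lift 0]` by `nondegenerate`, and in the trivialization a section `f` of `O(d)`
(a homogeneous function) becomes the function `x ↦ triv x * f (lift x)`. -/
structure Frame (n : ℕ) where
  lift : (Fin n → ℂ) → (Fin (n + 1) → ℂ)
  triv : (Fin n → ℂ) → ℂ
  analyticAt_lift : AnalyticAt ℂ lift 0
  analyticAt_triv : AnalyticAt ℂ triv 0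
  nondegenerate : Function.Injective
    (fun p : ℂ × (Fin n → ℂ) => p.1 • lift 0 + fderiv ℂ lift 0 p.2)
  triv_ne_zero : triv 0 ≠ 0

/-- The two data define the same coordinate system on `ℂPⁿ` and the same trivialization
of `O(d)`. -/
def Frame.Equiv {n : ℕ} (d : ℤ) (F F' : Frame n) : Prop :=
  ∃ c : (Fin n → ℂ) → ℂ, ∀ᶠ x in 𝓝 0,
    c x ≠ 0 ∧ F'.lift x = c x • F.lift x ∧ F.triv x = c x ^ d * F'.triv x

/-- A local section of `O(d)` written in the coordinate system and the trivialization. -/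
def Frame.expand {n : ℕ} (F : Frame n) (f : (Fin (n + 1) → ℂ) → ℂ) : MvPowerSeries (Fin n) ℂ :=
  taylor (fun x => F.triv x * f (F.lift x))

/-- `P` is the differential operator `D` written in the coordinate system and the
trivialization. -/
def Frame.IsExpression {n : ℕ} {d : ℤ} (F : Frame n) (D : DifProj n d) (P : Dif n) : Prop :=
  ∀ (V : ConicOpen n) (f : sections d V), F.lift 0 ∈ V.carrier →
    P.1 (F.expand f.1) = F.expand (D.1 V f).1

/-- The coordinate part of `F` is the inverse of the affine coordinate system
`w ↦ (w_k / w_i - z_k / z_i)_{k ≠ i}` on `U_i`, centred at `z`. -/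
def Frame.IsAffine {n : ℕ} (F : Frame n) (i : Fin (n + 1)) (z : Fin (n + 1) → ℂ) : Prop :=
  ∀ᶠ x in 𝓝 0, F.lift x = F.lift x i •
    (Fin.insertNth i (1 : ℂ) (fun k => z (i.succAbove k) / z i + x k) : Fin (n + 1) → ℂ)

/-- The piece `(⋂_{i ∈ I} U_i) × [I]` of the glued space, where `[I]` is the face with vertex set
`I` of the standard `n`-simplex. A point `(z, t)` stands for the point of `ℂPⁿ` with homogeneous
coordinates `z` and the point of the simplex with barycentric coordinates `t`. Points of
different pieces are identified in the glued space precisely when they are equal here. -/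
def piece (n : ℕ) (I : Finset (Fin (n + 1))) : Set ((Fin (n + 1) → ℂ) × (Fin (n + 1) → ℝ)) :=
  {p | (∀ i ∈ I, p.1 i ≠ 0) ∧ p.2 ∈ stdSimplex ℝ (Fin (n + 1)) ∧ ∀ i ∉ I, p.2 i = 0}

/-- A function on a part of the product is jointly smooth, and holomorphic in the first variable. -/
def SmoothHol {n : ℕ} (h : (Fin (n + 1) → ℂ) × (Fin (n + 1) → ℝ) → ℂ)
    (S : Set ((Fin (n + 1) → ℂ) × (Fin (n + 1) → ℝ))) : Prop :=
  ContDiffOn ℝ ∞ h S ∧ ∀ t, DifferentiableOn ℂ (fun z => h (z, t)) {z | (z, t) ∈ S}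

/-- The family `F` depends smoothly on the point of `S`, and holomorphically on its first
component: locally it is equivalent to a family all whose Taylor coefficients do. -/
def IsSmoothHolFamily {n : ℕ} (d : ℤ) (F : (Fin (n + 1) → ℂ) × (Fin (n + 1) → ℝ) → Frame n)
    (S : Set ((Fin (n + 1) → ℂ) × (Fin (n + 1) → ℝ))) : Prop :=
  ∀ p ∈ S, ∃ W, IsOpen W ∧ p ∈ W ∧
    ∃ G : (Fin (n + 1) → ℂ) × (Fin (n + 1) → ℝ) → Frame n,
      (∀ q ∈ W ∩ S, (F q).Equiv d (G q)) ∧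
      ∀ α : Fin n →₀ ℕ,
        (∀ j, SmoothHol (fun q => MvPowerSeries.coeff α (taylor fun x => (G q).lift x j))
          (W ∩ S)) ∧
        SmoothHol (fun q => MvPowerSeries.coeff α (taylor (G q).triv)) (W ∩ S)

/-- Families of coordinate systems on the glued space: a coordinate system (with a
trivialization of `O(d)`) for every point of the glued space, smooth and holomorphic in the point
of `ℂPⁿ` on each of the pieces, and given by the affine coordinates at the vertices. -/
structure IsAdmissible {n : ℕ} (d : ℤ)
    (F : (Fin (n + 1) → ℂ) × (Fin (n + 1) → ℝ) → Frame n) : Prop where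
  /-- `F (z, t)` depends only on the point of projective space -/
  wellDefined : ∀ I, ∀ p ∈ piece n I, ∀ c : ℂ, c ≠ 0 → (F p).Equiv d (F (c • p.1, p.2))
  /-- on the face `[I]` the family is smooth, and holomorphic on `⋂_{i ∈ I} U_i` -/
  smooth : ∀ I, IsSmoothHolFamily d F (piece n I)
  /-- at the vertices of the simplex the coordinate systems are the affine ones -/
  vertex : ∀ (i : Fin (n + 1)) (z : Fin (n + 1) → ℂ), z i ≠ 0 →
    (F (z, Pi.single i 1)).IsAffine i z

end Frames

/-! ### The canonical form and its domain of integration -/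

section Form

/-- Parametrization of `Tⁿ × σⁿ` by the angles `θ` and by `n` of the barycentric coordinates. -/
def torusSimplex {n : ℕ} (p : (Fin n → ℝ) × (Fin n → ℝ)) :
    (Fin (n + 1) → ℂ) × (Fin (n + 1) → ℝ) :=
  (Fin.cons 1 (fun k => Complex.exp (Complex.I * p.1 k)), Fin.cons (1 - ∑ k, p.2 k) p.2)

/-- The parameters of `Tⁿ` times the interior of `σⁿ`. -/
def paramDomain (n : ℕ) : Set ((Fin n → ℝ) × (Fin n → ℝ)) :=
  Set.Icc 0 (fun _ => 2 * Real.pi) ×ˢ {s | (∀ k, 0 < s k) ∧ ∑ k, s k < 1}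

/-- The coordinate directions `∂/∂θ₁,…,∂/∂θ_n,∂/∂s₁,…,∂/∂s_n`. -/
def coordDir (n : ℕ) : Fin (n + n) → (Fin n → ℝ) × (Fin n → ℝ) :=
  Fin.append (fun k => (Pi.single k 1, 0)) (fun k => (0, Pi.single k 1))

/-- `τ` is the infinitesimal automorphism `t_v` (vector field plus function on the formal disc) by
which the coordinate systems `F` change at `p` in the direction `v`: the derivative of the
expression of a local section is `τ` applied to the expression. -/
def IsVelocity {n : ℕ} (d : ℤ) (F : (Fin (n + 1) → ℂ) × (Fin (n + 1) → ℝ) → Frame n)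
    (p v : (Fin n → ℝ) × (Fin n → ℝ)) (τ : Dif n) : Prop :=
  OrderLE 1 τ.1 ∧
    ∀ (V : ConicOpen n) (f : sections d V), (F (torusSimplex p)).lift 0 ∈ V.carrier →
      ∀ α : Fin n →₀ ℕ,
        HasDerivAt
          (fun r : ℝ => MvPowerSeries.coeff α ((F (torusSimplex (p + r • v))).expand f.1))
          (MvPowerSeries.coeff α (τ.1 ((F (torusSimplex p)).expand f.1))) 0

/-- `Θ p` is the value of the canonical `2n`-form `Θ_{2n}` at the point with parameters `p`, on the
coordinate vectors:
`Θ p (A₁,…,A_m) = ξ(t_{v₁} ⊗ Id,…,t_{v_{2n}} ⊗ Id, A₁,…,A_m)`, with the `A_i` written in the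
coordinate system at `p`, and the infinite matrices `t_v ⊗ Id` replaced by large truncations. -/
def IsCanonicalForm {n m : ℕ} {d : ℤ}
    (F : (Fin (n + 1) → ℂ) × (Fin (n + 1) → ℝ) → Frame n)
    (ξ : glFin (Dif n) [⋀^Fin (n + n + m)]→ₗ[ℂ] ℂ)
    (Θ : (Fin n → ℝ) × (Fin n → ℝ) → glFin (DifProj n d) [⋀^Fin m]→ₗ[ℂ] ℂ) : Prop :=
  ∀ p ∈ paramDomain n, ∃ τ : Fin (n + n) → Dif n,
    (∀ a, IsVelocity d F p (coordDir n a) (τ a)) ∧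
    ∀ A : Fin m → glFin (DifProj n d), ∃ B : Fin m → glFin (Dif n),
      (∀ r i j, (F (torusSimplex p)).IsExpression ((A r).1 i j) ((B r).1 i j)) ∧
      ∀ᶠ N : ℕ in Filter.atTop,
        Θ p A = ξ (Fin.append (fun a => truncScalar N (τ a)) B)

end Form

end LieIntegral

end

/-! The velocities `t_v` behave like a flat connection. Differentiating the expansion of a local
section twice gives `∂_v t_u - ∂_u t_v = [t_v, t_u]` (`SmoothFamily.flat`), and differentiating the
expansion of `D f` gives `∂_v D = [t_v, D]` for a global operator `D` (`SmoothFamily.parallel`).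
Substitute velocities and global operators into a continuous cochain `η`. By these two equations the
exterior derivative of the resulting form consists, up to sign, of exactly those terms of `δη` whose
bracket contains a velocity (`sum_fderivWithin_cochain`). The other terms bracket two global
operators and form the differential of the cochain with its velocity arguments fixed
(`sum_ceDiff_append`). Hence the integral of `δη` over the torus times the simplex is the
differential of the integral of `η`, up to the integral of an exact form
(`eventually_integral_ceDiff`).

That exact form integrates to zero (`integral_ceDiff_velocity_eq_zero`). Derivatives along the torus
vanish by periodicity. Over the facet `t_j = 0` the coordinate systems exist on the whole
intersection of the `U_i` with `i ≠ j`, so the flux through the facet is an entire function of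
`z_j`. Averaging over the angle of `z_j` therefore gives its value at `z_j = 0`. At that point
rotating `z_j` moves nothing, and rotating all homogeneous coordinates together is trivial on
projective space, so the `n` angular velocities are linearly dependent and the alternating flux
vanishes (`facetForm_zero`, `integral_flux_eq_zero`).

Three tools make this rigorous. Expansions of local sections determine an adically continuous
operator, because polynomials in affine coordinates are dense in the power series
(`Frame.eq_zero_of_expand`); so expressions and velocities are unique, and identities between
operators may be tested on sections. Their existence and regularity come from explicit formulas in
the Taylor coefficients (`Frame.vectorOp`, `localVel`), treated simultaneously for smooth and for
holomorphic dependence by `RegClass`. Finally, on matrices of bounded size and order a continuous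
cochain is an alternating form in finitely many Taylor coefficients
(`IsContinuousCochain.exists_jet`), so ordinary calculus applies to it.

Infinite scalar matrices enter only through truncations of size `N`, and for fixed operator
arguments every identity holds for all large `N`. A primitive `η` of `ξ` is not assumed stable, so
its integrals may depend on `N` forever; a duality argument still produces one primitive
(`isCoboundary_of_eventually`). For `m = 0` all arguments are velocities, all of `δη` is exact, and
the integral is zero. -/

noncomputable section
namespace LieIntegral

/-! ### Orders of vanishing of power series -/

/-- Power series in `n` variables. -/
abbrev PS (n : ℕ) : Type := MvPowerSeries (Fin n) ℂ

section Vanishing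

open MvPowerSeries

variable {n : ℕ}

/-- Raising the exponent by one partial derivative at a time avoids multi-index combinatorics:
identities of Taylor series reduce to constant terms and first derivatives. -/
theorem finsupp_induction_single {p : (Fin n →₀ ℕ) → Prop} (h0 : p 0)
    (hs : ∀ β i, p β → p (β + Finsupp.single i 1)) (β : Fin n →₀ ℕ) : p β := by
  induction hd : β.degree generalizing β with
  | zero =>
    rw [Finsupp.degree_eq_zero_iff] at hd
    rwa [hd]
  | succ m ih =>
    have hne : β ≠ 0 := by
      rintro rfl
      simp at hd
    obtain ⟨i, hi⟩ := Finsupp.ne_iff.1 hne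
    have hle : Finsupp.single i 1 ≤ β := by
      rw [Finsupp.single_le_iff]
      exact Nat.one_le_iff_ne_zero.2 hi
    have hb : β - Finsupp.single i 1 + Finsupp.single i 1 = β := tsub_add_cancel_of_le hle
    rw [← hb]
    apply hs
    apply ih
    have := congrArg Finsupp.degree hb
    rw [map_add, Finsupp.degree_single, hd] at this
    omega

/-- All coefficients of `f` of degree less than `J` vanish. -/
def VanTo (J : ℕ) (f : MvPowerSeries (Fin n) ℂ) : Prop :=
  ∀ α : Fin n →₀ ℕ, α.degree < J → coeff α f = 0

namespace VanTo

variable {J K : ℕ} {f g : MvPowerSeries (Fin n) ℂ}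

theorem zero (J : ℕ) : VanTo J (0 : MvPowerSeries (Fin n) ℂ) := fun α _ => by simp

theorem of_zero (f : MvPowerSeries (Fin n) ℂ) : VanTo 0 f := fun _ h => absurd h (by omega)

theorem mono (hf : VanTo J f) (h : K ≤ J) : VanTo K f := fun α hα => hf α (by omega)

theorem add (hf : VanTo J f) (hg : VanTo J g) : VanTo J (f + g) := fun α hα => by
  rw [map_add, hf α hα, hg α hα, add_zero]

theorem sub (hf : VanTo J f) (hg : VanTo J g) : VanTo J (f - g) := fun α hα => by
  rw [map_sub, hf α hα, hg α hα, sub_zero]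

theorem smul (c : ℂ) (hf : VanTo J f) : VanTo J (c • f) := fun α hα => by
  rw [map_smul, hf α hα, smul_zero]

theorem sum {ι : Type*} {s : Finset ι} {f : ι → MvPowerSeries (Fin n) ℂ}
    (hf : ∀ i ∈ s, VanTo J (f i)) : VanTo J (∑ i ∈ s, f i) := fun α hα => by
  rw [map_sum]
  exact Finset.sum_eq_zero fun i hi => hf i hi α hα

theorem mul (hf : VanTo J f) (hg : VanTo K g) : VanTo (J + K) (f * g) := fun α hα => by
  classical
  rw [coeff_mul]
  refine Finset.sum_eq_zero fun p hp => ?_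
  have h := congrArg Finsupp.degree (Finset.HasAntidiagonal.mem_antidiagonal.1 hp)
  rw [map_add] at h
  by_cases h1 : p.1.degree < J
  · rw [hf _ h1, zero_mul]
  · rw [hg _ (by omega), mul_zero]

theorem mul_left (f : MvPowerSeries (Fin n) ℂ) (hg : VanTo K g) : VanTo K (f * g) := by
  simpa using (of_zero f).mul hg

theorem pderiv (i : Fin n) (hf : VanTo (J + 1) f) : VanTo J (pderiv ℂ i f) := fun α hα => by
  rw [coeff_pderiv, hf, zero_mul]
  rw [map_add, Finsupp.degree_single]
  omega

theorem eq_zero (hf : ∀ J, VanTo J f) : f = 0 := by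
  ext α
  rw [hf (α.degree + 1) α (by omega), map_zero]

theorem one_iff : VanTo 1 f ↔ constantCoeff f = 0 := by
  constructor
  · intro h
    exact h 0 (by simp)
  · intro h α hα
    have : α = 0 := by
      rw [← Finsupp.degree_eq_zero_iff]
      omega
    rw [this]
    exact h

theorem monomial {α : Fin n →₀ ℕ} (h : J ≤ α.degree) (c : ℂ) : VanTo J (monomial α c) := by
  classical
  intro β hβ
  rw [coeff_monomial, if_neg]
  rintro rfl
  omega

end VanTo

/-- The exponents of degree at most `J`. -/
def degLE (n J : ℕ) : Finset (Fin n →₀ ℕ) := (Finsupp.finite_of_degree_le J).toFinset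

@[simp] theorem mem_degLE {J : ℕ} {α : Fin n →₀ ℕ} : α ∈ degLE n J ↔ α.degree ≤ J := by
  simp [degLE]

/-- A power series is a polynomial up to terms of high degree. -/
theorem vanTo_sub_sum (J : ℕ) (f : MvPowerSeries (Fin n) ℂ) :
    VanTo (J + 1) (f - ∑ β ∈ degLE n J, coeff β f • monomial β 1) := by
  classical
  intro α hα
  rw [map_sub, map_sum, Finset.sum_eq_single_of_mem α (by simpa using Nat.lt_succ_iff.1 hα)]
  · simp
  · intro β _ hβ
    rw [map_smul, coeff_monomial, if_neg (Ne.symm hβ), smul_zero]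

end Vanishing

/-! ### Operators of finite order -/

section Orders

open MvPowerSeries

variable {n : ℕ}

theorem OrderLE.zero (k : ℕ) : OrderLE k (0 : Module.End ℂ (PS n)) := by
  induction k with
  | zero => intro a; simp
  | succ k ih => intro a; simpa using ih

theorem OrderLE.succ {k : ℕ} {P : Module.End ℂ (PS n)} (h : OrderLE k P) : OrderLE (k + 1) P := by
  induction k generalizing P with
  | zero =>
    intro a
    rw [h a]
    exact OrderLE.zero 0
  | succ k ih => exact fun a => ih (h a)

theorem OrderLE.mono {k l : ℕ} {P : Module.End ℂ (PS n)} (h : OrderLE k P) (hkl : k ≤ l) :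
    OrderLE l P := by
  induction hkl with
  | refl => exact h
  | step _ ih => exact ih.succ

theorem OrderLE.add {k : ℕ} {P Q : Module.End ℂ (PS n)} (hP : OrderLE k P) (hQ : OrderLE k Q) :
    OrderLE k (P + Q) := by
  induction k generalizing P Q with
  | zero =>
    intro a
    rw [add_mul, mul_add, add_sub_add_comm, hP a, hQ a, add_zero]
  | succ k ih =>
    intro a
    rw [add_mul, mul_add, add_sub_add_comm]
    exact ih (hP a) (hQ a)

theorem OrderLE.smul {k : ℕ} {P : Module.End ℂ (PS n)} (c : ℂ) (hP : OrderLE k P) :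
    OrderLE k (c • P) := by
  have key : ∀ (P : Module.End ℂ (PS n)) (a : PS n),
      c • P * LinearMap.mulLeft ℂ a - LinearMap.mulLeft ℂ a * (c • P) =
        c • (P * LinearMap.mulLeft ℂ a - LinearMap.mulLeft ℂ a * P) := by
    intro P a
    ext1 f
    simp [smul_sub]
  induction k generalizing P with
  | zero =>
    intro a
    rw [key, hP a, smul_zero]
  | succ k ih =>
    intro a
    rw [key]
    exact ih (hP a)

/-- Commutation with a function is a derivation, `[PQ, a] = P [Q, a] + [P, a] Q`, so each summand
has one of the two orders lowered; the induction is on their sum. -/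
theorem OrderLE.mul {k l : ℕ} {P Q : Module.End ℂ (PS n)} (hP : OrderLE k P) (hQ : OrderLE l Q) :
    OrderLE (k + l) (P * Q) := by
  have key : ∀ (P Q : Module.End ℂ (PS n)) (a : PS n), P * Q * LinearMap.mulLeft ℂ a - LinearMap.mulLeft ℂ a * (P * Q) =
      P * (Q * LinearMap.mulLeft ℂ a - LinearMap.mulLeft ℂ a * Q) +
        (P * LinearMap.mulLeft ℂ a - LinearMap.mulLeft ℂ a * P) * Q := by
    intro P Q a
    simp only [mul_sub, sub_mul, mul_assoc]
    abel
  induction hs : k + l generalizing k l P Q with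
  | zero =>
    obtain ⟨rfl, rfl⟩ : k = 0 ∧ l = 0 := by omega
    intro a
    rw [key, hP a, hQ a, mul_zero, zero_mul, add_zero]
  | succ s ih =>
    intro a
    rw [key]
    apply OrderLE.add
    · cases l with
      | zero => rw [hQ a, mul_zero]; exact OrderLE.zero _
      | succ l => exact ih hP (hQ a) (by omega)
    · cases k with
      | zero => rw [hP a, zero_mul]; exact OrderLE.zero _
      | succ k => exact ih (hP a) hQ (by omega)

/-- `P` lowers the order of vanishing by at most `k`. -/
def ContOrd (k : ℕ) (P : Module.End ℂ (PS n)) : Prop :=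
  ∀ J f, VanTo (J + k) f → VanTo J (P f)

theorem ContOrd.mono {k l : ℕ} {P : Module.End ℂ (PS n)} (h : ContOrd k P) (hkl : k ≤ l) :
    ContOrd l P := fun J _ hf => h J _ (hf.mono (by omega))

theorem ContOrd.add {k : ℕ} {P Q : Module.End ℂ (PS n)} (hP : ContOrd k P) (hQ : ContOrd k Q) :
    ContOrd k (P + Q) := fun J f hf => (hP J f hf).add (hQ J f hf)

theorem ContOrd.sub {k : ℕ} {P Q : Module.End ℂ (PS n)} (hP : ContOrd k P) (hQ : ContOrd k Q) :
    ContOrd k (P - Q) := fun J f hf => (hP J f hf).sub (hQ J f hf)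

theorem ContOrd.smul {k : ℕ} {P : Module.End ℂ (PS n)} (c : ℂ) (hP : ContOrd k P) :
    ContOrd k (c • P) := fun J f hf => (hP J f hf).smul c

theorem ContOrd.mul {k l : ℕ} {P Q : Module.End ℂ (PS n)} (hP : ContOrd k P) (hQ : ContOrd l Q) :
    ContOrd (k + l) (P * Q) := fun J f hf => hP J _ (hQ (J + k) f (by rwa [add_assoc]))

theorem contOrd_mulLeft (a : PS n) : ContOrd 0 (LinearMap.mulLeft ℂ a) :=
  fun _ _ hf => VanTo.mul_left a hf

/-- Operators of order at most `k` that lower the order of vanishing by at most `k`. -/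
structure HasOrd (k : ℕ) (P : Module.End ℂ (PS n)) : Prop where
  orderLE : OrderLE k P
  contOrd : ContOrd k P

namespace HasOrd

variable {k l : ℕ} {P Q : Module.End ℂ (PS n)}

theorem mono (h : HasOrd k P) (hkl : k ≤ l) : HasOrd l P :=
  ⟨h.1.mono hkl, h.2.mono hkl⟩

theorem zero (k : ℕ) : HasOrd k (0 : Module.End ℂ (PS n)) :=
  ⟨OrderLE.zero k, fun J _ _ => VanTo.zero J⟩

theorem add (hP : HasOrd k P) (hQ : HasOrd k Q) : HasOrd k (P + Q) :=
  ⟨hP.1.add hQ.1, hP.2.add hQ.2⟩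

theorem smul (c : ℂ) (hP : HasOrd k P) : HasOrd k (c • P) :=
  ⟨hP.1.smul c, hP.2.smul c⟩

theorem sub (hP : HasOrd k P) (hQ : HasOrd k Q) : HasOrd k (P - Q) := by
  have h : P - Q = P + (-1 : ℂ) • Q := by
    ext1 f
    simp [sub_eq_add_neg]
  rw [h]
  exact hP.add (hQ.smul _)

theorem sum {ι : Type*} {s : Finset ι} {P : ι → Module.End ℂ (PS n)}
    (h : ∀ i ∈ s, HasOrd k (P i)) : HasOrd k (∑ i ∈ s, P i) :=
  Finset.sum_induction _ (HasOrd k) (fun _ _ => add) (zero k) h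

theorem mul (hP : HasOrd k P) (hQ : HasOrd l Q) : HasOrd (k + l) (P * Q) :=
  ⟨hP.1.mul hQ.1, hP.2.mul hQ.2⟩

theorem mulLeft (a : PS n) : HasOrd 0 (LinearMap.mulLeft ℂ a) := by
  refine ⟨fun b => ?_, contOrd_mulLeft a⟩
  ext1 f
  simp [mul_left_comm]

theorem pderiv (i : Fin n) : HasOrd 1 (pderiv ℂ i).toLinearMap := by
  refine ⟨fun a b => ?_, fun J f hf => hf.pderiv i⟩
  ext1 f
  simp only [LinearMap.sub_apply, Module.End.mul_apply, LinearMap.mulLeft_apply,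
    Derivation.coeFn_coe, Derivation.leibniz, smul_eq_mul, LinearMap.zero_apply]
  ring

end HasOrd

/-- Both bounds pass from the generators to sums and products. The number obtained need not be the
least order; later arguments need only continuity with some finite bound. -/
theorem Dif.exists_hasOrd (P : Dif n) : ∃ k, HasOrd k P.1 := by
  refine Algebra.adjoin_induction (p := fun P _ => ∃ k, HasOrd k P) ?_ ?_ ?_ ?_ P.2
  · rintro _ (⟨a, rfl⟩ | ⟨i, rfl⟩)
    · exact ⟨0, HasOrd.mulLeft a⟩
    · exact ⟨1, HasOrd.pderiv i⟩
  · intro c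
    refine ⟨0, ?_⟩
    convert HasOrd.mulLeft (C (σ := Fin n) c) using 1
    ext1 f
    simp [Algebra.algebraMap_eq_smul_one, smul_eq_C_mul]
  · rintro _ _ _ _ ⟨k, hk⟩ ⟨l, hl⟩
    exact ⟨max k l, (hk.mono (le_max_left _ _)).add (hl.mono (le_max_right _ _))⟩
  · rintro _ _ _ _ ⟨k, hk⟩ ⟨l, hl⟩
    exact ⟨k + l, hk.mul hl⟩

/-- The matrix entries of an operator with respect to the monomials. -/
def entry (P : Module.End ℂ (PS n)) (α β : Fin n →₀ ℕ) : ℂ := coeff α (P (monomial β 1))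

theorem ContOrd.entry_eq_zero {k : ℕ} {P : Module.End ℂ (PS n)} (hP : ContOrd k P)
    {α β : Fin n →₀ ℕ} (h : α.degree + k < β.degree) : entry P α β = 0 :=
  hP (α.degree + 1) _ (VanTo.monomial (by omega) 1) α (by omega)

/-- Monomials of degree above `α.degree + k` cannot reach degree `α.degree`, so every row of the
matrix of `P` is finite. This allows differentiating `P f` coefficient by coefficient. -/
theorem ContOrd.coeff_apply {k : ℕ} {P : Module.End ℂ (PS n)} (hP : ContOrd k P)
    (f : PS n) (α : Fin n →₀ ℕ) :
    coeff α (P f) = ∑ β ∈ degLE n (α.degree + k), entry P α β * coeff β f := by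
  have h := hP (α.degree + 1) _ (by
    have := vanTo_sub_sum (α.degree + k) f
    rwa [add_right_comm] at this) α (by omega)
  rw [map_sub, map_sub, sub_eq_zero] at h
  rw [h, map_sum, map_sum]
  refine Finset.sum_congr rfl fun β _ => ?_
  rw [map_smul, map_smul, smul_eq_mul, mul_comm, entry]

theorem ContOrd.vanTo_of_monomial {k : ℕ} {P : Module.End ℂ (PS n)} (hP : ContOrd k P) {J : ℕ}
    (h : ∀ β, VanTo J (P (monomial β 1))) (f : PS n) : VanTo J (P f) := by
  intro α hα
  rw [hP.coeff_apply]
  exact Finset.sum_eq_zero fun β _ => by rw [entry, h β α hα, zero_mul]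

theorem monomial_add_single (β : Fin n →₀ ℕ) (i : Fin n) :
    (monomial (β + Finsupp.single i 1) 1 : PS n) = X i * monomial β 1 := by
  rw [X, monomial_mul_monomial, one_mul, add_comm]

/-- An operator of order at most `k` is determined modulo terms of high degree by the images
of the monomials of degree at most `k`. -/
theorem vanTo_of_entries {k J c : ℕ} {P : Module.End ℂ (PS n)} (hP : OrderLE k P) (hc : ContOrd c P)
    (h : ∀ β α : Fin n →₀ ℕ, β.degree ≤ k → α.degree < J → entry P α β = 0) (f : PS n) :
    VanTo J (P f) := by
  induction k generalizing P c f with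
  | zero =>
    have h1 : P f = f * P (monomial 0 1) := by
      have := congrArg (fun Q : Module.End ℂ (PS n) => Q 1) (hP f)
      simpa [sub_eq_zero] using this
    rw [h1]
    exact VanTo.mul_left f fun α hα => h 0 α (by simp) hα
  | succ k ih =>
    refine hc.vanTo_of_monomial (fun β => ?_) f
    induction β using finsupp_induction_single with
    | h0 => exact fun α hα => h 0 α (by simp) hα
    | hs β i hβ =>
      rw [monomial_add_single]
      -- Pulling `X i` out of `P` costs a commutator of order at most `k`, which the outer induction
      -- controls; the inner induction controls the other summand.
      have hcomm : P (X i * monomial β 1) = X i * P (monomial β 1) +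
          (P * LinearMap.mulLeft ℂ (X i) - LinearMap.mulLeft ℂ (X i) * P : Module.End ℂ (PS n))
            (monomial β 1) := by
        simp
      rw [hcomm]
      refine (VanTo.mul_left _ hβ).add (ih (c := c) (hP (X i)) ?_ ?_ _)
      · exact (hc.mul (contOrd_mulLeft _)).sub (((contOrd_mulLeft _).mul hc).mono (by omega))
      · intro γ α hγ hα
        have h1 : VanTo J (P (monomial γ 1)) := fun α' hα' => h γ α' (by omega) hα'
        have h2 := h (γ + Finsupp.single i 1) α (by simpa using hγ) hα
        rw [entry, monomial_add_single] at h2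
        simp only [entry, LinearMap.sub_apply, Module.End.mul_apply, LinearMap.mulLeft_apply,
          map_sub, h2, zero_sub, neg_eq_zero]
        exact VanTo.mul_left _ h1 α hα

end Orders

/-! ### Subalgebras that contain a coordinate system are dense -/

section Density

open MvPowerSeries

variable {n : ℕ} {A : Subalgebra ℂ (MvPowerSeries (Fin n) ℂ)}

/-- Multiply the approximate coordinates: a product of elements with the right linear parts has the
right leading monomial, and the error is of one degree more. -/
theorem exists_monomial_approx (hA : ∀ k, ∃ w ∈ A, VanTo 2 (X k - w)) (β : Fin n →₀ ℕ) :
    ∃ w ∈ A, VanTo (β.degree + 1) (monomial β 1 - w) := by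
  induction β using finsupp_induction_single with
  | h0 => exact ⟨1, A.one_mem, by simpa using VanTo.zero _⟩
  | hs β i hβ =>
    obtain ⟨w, hw, h⟩ := hβ
    obtain ⟨y, hy, h'⟩ := hA i
    refine ⟨y * w, A.mul_mem hy hw, ?_⟩
    have hX : VanTo 1 (X i : PS n) := VanTo.one_iff.2 (constantCoeff_X i)
    have hy1 : VanTo 1 y := by simpa using hX.sub (h'.mono (by omega))
    have hsplit : (monomial (β + Finsupp.single i 1) 1 : PS n) - y * w =
        (X i - y) * monomial β 1 + y * (monomial β 1 - w) := by
      rw [monomial_add_single]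
      ring
    rw [hsplit, map_add, Finsupp.degree_single]
    refine VanTo.add ?_ ?_
    · exact (h'.mul (VanTo.monomial le_rfl 1)).mono (by omega)
    · exact (hy1.mul h).mono (by omega)

/-- Successive approximation: the lowest-degree part of the remaining error is matched by an element
of `A`, divided by the constant term of `e`, which gains one order at each step. -/
theorem exists_approx {e : PS n} (he : constantCoeff e ≠ 0)
    (hA : ∀ k, ∃ w ∈ A, VanTo 2 (X k - w)) (J : ℕ) (f : PS n) :
    ∃ w ∈ A, VanTo J (f - e * w) := by
  induction J with
  | zero => exact ⟨0, A.zero_mem, VanTo.of_zero _⟩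
  | succ J ih =>
    obtain ⟨w, hw, h⟩ := ih
    choose v hv hv' using exists_monomial_approx hA
    set g := f - e * w with hg
    set c := constantCoeff e with hc
    -- Only the terms of degree exactly `J` contribute, since `g` already vanishes to order `J`.
    set r : PS n := c⁻¹ • ∑ β ∈ degLE n J, coeff β g • v β with hr
    have hrA : r ∈ A := A.smul_mem (A.sum_mem fun β _ => A.smul_mem (hv β) _) _
    refine ⟨w + r, A.add_mem hw hrA, ?_⟩
    have h1 : VanTo (J + 1) (g - c • r) := by
      have hcr : c • r = ∑ β ∈ degLE n J, coeff β g • v β := by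
        rw [hr, smul_smul, mul_inv_cancel₀ he, one_smul]
      have := (vanTo_sub_sum J g).add (g := ∑ β ∈ degLE n J, coeff β g • (monomial β 1 - v β)) (by
        refine VanTo.sum fun β hβ => ?_
        rcases (mem_degLE.1 hβ).lt_or_eq with hlt | heq
        · rw [h β hlt, zero_smul]
          exact VanTo.zero _
        · exact (heq ▸ hv' β).smul _)
      convert this using 1
      simp only [hcr, smul_sub, Finset.sum_sub_distrib]
      ring
    have h2 : VanTo J r := by
      have : c⁻¹ • (c • r) = r := by rw [smul_smul, inv_mul_cancel₀ he, one_smul]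
      rw [← this]
      refine VanTo.smul _ ?_
      simpa using h.sub (h1.mono (by omega))
    have h3 : VanTo 1 (e - C c) := VanTo.one_iff.2 (by simp [hc])
    -- Replacing `e` by its constant term costs a product of a series without constant term and one
    -- of order `J`.
    have hsplit : f - e * (w + r) = (g - c • r) - (e - C c) * r := by
      rw [hg, smul_eq_C_mul]
      ring
    rw [hsplit]
    exact h1.sub ((h3.mul h2).mono (by omega))

/-- Every series is an adic limit of elements `e * w`, and `Z` is adically continuous. -/
theorem eq_zero_of_dense {e : PS n} (he : constantCoeff e ≠ 0)
    (hA : ∀ k, ∃ w ∈ A, VanTo 2 (X k - w)) {k : ℕ} {Z : Module.End ℂ (PS n)} (hZ : ContOrd k Z)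
    (h : ∀ w ∈ A, Z (e * w) = 0) : Z = 0 := by
  ext1 f
  refine VanTo.eq_zero fun J => ?_
  obtain ⟨w, hw, h'⟩ := exists_approx he hA (J + k) f
  have := hZ J _ h'
  rwa [map_sub, h w hw, sub_zero] at this

end Density

/-! ### Holomorphic functions of several variables -/

section Holomorphic

variable {E : Type*} [NormedAddCommGroup E] [NormedSpace ℂ E]

theorem hasDerivAt_comp_line {f : E → ℂ} {z v : E} {ζ : ℂ}
    (hf : DifferentiableAt ℂ f (z + ζ • v)) :
    HasDerivAt (fun ζ : ℂ => f (z + ζ • v)) (fderiv ℂ f (z + ζ • v) v) ζ := by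
  have h1 : HasDerivAt (fun ζ : ℂ => z + ζ • v) v ζ := by
    simpa using ((hasDerivAt_id ζ).smul_const v).const_add z
  exact hf.hasFDerivAt.comp_hasDerivAt ζ h1

/-- Cauchy's estimate on the complex line through `y` in the direction `u`. The radius `R / (4 *
‖u‖)` moves `y` by at most `R / 4`, so the circle stays in the ball of radius `R`. -/
theorem norm_fderiv_le_of_bound {f : E → ℂ} {z₀ : E} {R M : ℝ} (hR : 0 < R)
    (hf : DifferentiableOn ℂ f (Metric.ball z₀ R)) (hM : ∀ z ∈ Metric.ball z₀ R, ‖f z‖ ≤ M)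
    {y : E} (hy : y ∈ Metric.ball z₀ (R / 2)) : ‖fderiv ℂ f y‖ ≤ 4 * M / R := by
  have hM0 : 0 ≤ M := (norm_nonneg _).trans (hM z₀ (Metric.mem_ball_self hR))
  refine ContinuousLinearMap.opNorm_le_bound _ (by positivity) fun u => ?_
  rcases eq_or_ne u 0 with rfl | hu
  · simp
  have hu' : 0 < ‖u‖ := norm_pos_iff.2 hu
  set ρ := R / (4 * ‖u‖) with hρ
  have hρ0 : 0 < ρ := by positivity
  have hmem : ∀ ζ ∈ Metric.closedBall (0 : ℂ) ρ, y + ζ • u ∈ Metric.ball z₀ R := by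
    intro ζ hζ
    rw [mem_closedBall_zero_iff] at hζ
    rw [Metric.mem_ball, dist_eq_norm] at hy ⊢
    have h1 : ‖ζ • u‖ ≤ R / 4 := by
      rw [norm_smul]
      calc ‖ζ‖ * ‖u‖ ≤ ρ * ‖u‖ := by gcongr
        _ = R / 4 := by rw [hρ]; field_simp
    calc ‖y + ζ • u - z₀‖ = ‖(y - z₀) + ζ • u‖ := by rw [add_sub_right_comm]
      _ ≤ ‖y - z₀‖ + ‖ζ • u‖ := norm_add_le _ _
      _ < R := by linarith
  have hd : ∀ ζ ∈ Metric.closedBall (0 : ℂ) ρ, HasDerivAt (fun ζ : ℂ => f (y + ζ • u))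
      (fderiv ℂ f (y + ζ • u) u) ζ := fun ζ hζ =>
    hasDerivAt_comp_line ((hf _ (hmem ζ hζ)).differentiableAt
      (Metric.isOpen_ball.mem_nhds (hmem ζ hζ)))
  have h0 := (hd 0 (by simp [hρ0.le])).deriv
  rw [zero_smul, add_zero] at h0
  rw [← h0]
  have := Complex.norm_deriv_le_of_forall_mem_sphere_norm_le (f := fun ζ : ℂ => f (y + ζ • u))
    (c := 0) hρ0
    (DifferentiableOn.diffContOnCl fun ζ hζ => (hd ζ (by
      rwa [closure_ball _ hρ0.ne'] at hζ)).differentiableAt.differentiableWithinAt)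
    (fun ζ hζ => hM _ (hmem ζ (Metric.sphere_subset_closedBall hζ)))
  calc _ ≤ M / ρ := this
    _ = 4 * M / R * ‖u‖ := by rw [hρ]; field_simp

/-- The directional derivatives of a holomorphic function are holomorphic. -/
theorem differentiableAt_fderiv_apply [FiniteDimensional ℂ E] {f : E → ℂ} {z₀ : E}
    (hf : ∀ᶠ z in 𝓝 z₀, DifferentiableAt ℂ f z) (v : E) :
    DifferentiableAt ℂ (fun z => fderiv ℂ f z v) z₀ := by
  obtain ⟨R, hR, hball⟩ := Metric.eventually_nhds_iff_ball.1
    (hf.and ((hf.self_of_nhds.continuousAt.norm.eventually (gt_mem_nhds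
      (lt_add_one ‖f z₀‖)))))
  set M := ‖f z₀‖ + 1
  have hdiff : DifferentiableOn ℂ f (Metric.ball z₀ R) :=
    fun z hz => (hball z hz).1.differentiableWithinAt
  set ρ := R / (4 * (‖v‖ + 1)) with hρ
  have hρ0 : 0 < ρ := by positivity
  have hmem : ∀ z ∈ Metric.ball z₀ (R / 4), ∀ ζ ∈ Metric.closedBall (0 : ℂ) ρ,
      z + ζ • v ∈ Metric.ball z₀ (R / 2) := by
    intro z hz ζ hζ
    rw [mem_closedBall_zero_iff] at hζ
    rw [Metric.mem_ball, dist_eq_norm] at hz ⊢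
    have h1 : ‖ζ • v‖ ≤ R / 4 := by
      rw [norm_smul]
      calc ‖ζ‖ * ‖v‖ ≤ ρ * (‖v‖ + 1) := by gcongr; linarith
        _ = R / 4 := by rw [hρ]; field_simp
    calc ‖z + ζ • v - z₀‖ = ‖(z - z₀) + ζ • v‖ := by rw [add_sub_right_comm]
      _ ≤ ‖z - z₀‖ + ‖ζ • v‖ := norm_add_le _ _
      _ < R / 2 := by linarith
  have hsub : Metric.ball z₀ (R / 2) ⊆ Metric.ball z₀ R := Metric.ball_subset_ball (by linarith)
  have hcirc : ∀ θ, circleMap 0 ρ θ ∈ Metric.closedBall (0 : ℂ) ρ :=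
    fun θ => circleMap_mem_closedBall 0 hρ0.le θ
  -- The integrand of Cauchy's formula for the derivative at `0` of `ζ ↦ f (z + ζ • v)`.
  -- Differentiability in `z` follows by differentiating under the integral sign, with a bound from
  -- `norm_fderiv_le_of_bound`.
  set F : E → ℝ → ℂ := fun z θ => deriv (circleMap 0 ρ) θ •
    (((circleMap 0 ρ θ - 0) ^ 2)⁻¹ • f (z + circleMap 0 ρ θ • v)) with hF
  set F' : E → ℝ → E →L[ℂ] ℂ := fun z θ => (deriv (circleMap 0 ρ) θ *
    ((circleMap 0 ρ θ - 0) ^ 2)⁻¹) • fderiv ℂ f (z + circleMap 0 ρ θ • v) with hF'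
  have hcoef : Continuous fun θ : ℝ => deriv (circleMap 0 ρ) θ *
      ((circleMap 0 ρ θ - 0) ^ 2)⁻¹ := by
    have h2 : ∀ θ, (circleMap 0 ρ θ - 0) ^ 2 ≠ 0 := fun θ => by
      rw [sub_zero]
      exact pow_ne_zero 2 (circleMap_ne_center hρ0.ne')
    simp only [deriv_circleMap]
    fun_prop (disch := assumption)
  have hcont : ∀ z ∈ Metric.ball z₀ (R / 4), Continuous (F z) := by
    intro z hz
    have h1 : Continuous fun θ : ℝ => f (z + circleMap 0 ρ θ • v) := by
      refine hdiff.continuousOn.comp_continuous (by fun_prop) fun θ => hsub (hmem z hz _ (hcirc θ))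
    convert hcoef.mul h1 using 1
    funext θ
    simp [hF, mul_assoc]
  have hint : HasFDerivAt (fun z => ∫ θ in (0 : ℝ)..2 * Real.pi, F z θ)
      (∫ θ in (0 : ℝ)..2 * Real.pi, F' z₀ θ) z₀ := by
    refine intervalIntegral.hasFDerivAt_integral_of_dominated_of_fderiv_le
      (bound := fun θ => ‖deriv (circleMap 0 ρ) θ * ((circleMap 0 ρ θ - 0) ^ 2)⁻¹‖ * (4 * M / R))
      (Metric.ball_mem_nhds z₀ (by positivity : 0 < R / 4)) ?_ ?_ ?_ ?_ ?_ ?_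
    · filter_upwards [Metric.ball_mem_nhds z₀ (by positivity : 0 < R / 4)] with z hz
      exact (hcont z hz).aestronglyMeasurable
    · exact (hcont z₀ (Metric.mem_ball_self (by positivity))).intervalIntegrable _ _
    · borelize E
      have : FiniteDimensional ℂ (E →L[ℂ] ℂ) := inferInstance
      have : ProperSpace (E →L[ℂ] ℂ) := FiniteDimensional.proper ℂ (E →L[ℂ] ℂ)
      exact hcoef.aestronglyMeasurable.smul (((measurable_fderiv ℂ f).comp
        (by fun_prop : Continuous fun θ : ℝ => z₀ + circleMap 0 ρ θ • v).measurable
          ).aestronglyMeasurable)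
    · refine Filter.Eventually.of_forall fun θ _ z hz => ?_
      rw [hF', norm_smul]
      gcongr
      exact norm_fderiv_le_of_bound hR hdiff (fun w hw => (hball w hw).2.le)
        (hmem z hz _ (hcirc θ))
    · exact (hcoef.norm.mul continuous_const).intervalIntegrable _ _
    · refine Filter.Eventually.of_forall fun θ _ z hz => ?_
      have h1 : HasFDerivAt (fun z => f (z + circleMap 0 ρ θ • v))
          (fderiv ℂ f (z + circleMap 0 ρ θ • v)) z := by
        rw [hasFDerivAt_comp_add_right]
        exact (hball _ (hsub (hmem z hz _ (hcirc θ)))).1.hasFDerivAt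
      simpa [hF, hF', mul_assoc] using h1.const_mul
        (deriv (circleMap 0 ρ) θ * ((circleMap 0 ρ θ - 0) ^ 2)⁻¹)
  refine (hint.differentiableAt.const_mul ((2 * Real.pi * Complex.I : ℂ)⁻¹)).congr_of_eventuallyEq ?_
  filter_upwards [Metric.ball_mem_nhds z₀ (by positivity : 0 < R / 4)] with z hz
  have hU : IsOpen {ζ : ℂ | z + ζ • v ∈ Metric.ball z₀ R} :=
    Metric.isOpen_ball.preimage (by fun_prop)
  have hd : ∀ ζ : ℂ, z + ζ • v ∈ Metric.ball z₀ R → HasDerivAt (fun ζ : ℂ => f (z + ζ • v))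
      (fderiv ℂ f (z + ζ • v) v) ζ := fun ζ hζ => hasDerivAt_comp_line (hball _ hζ).1
  have := Complex.two_pi_I_inv_smul_circleIntegral_sub_sq_inv_smul_of_differentiable hU
    (c := 0) (w₀ := 0) (R := ρ) (f := fun ζ : ℂ => f (z + ζ • v))
    (fun ζ hζ => hsub (hmem z hz ζ hζ))
    (fun ζ hζ => (hd ζ hζ).differentiableAt.differentiableWithinAt) (Metric.mem_ball_self hρ0)
  rw [(hd 0 (hsub (hmem z hz 0 (by simp [hρ0.le])))).deriv, zero_smul, add_zero] at this
  rw [← this, smul_eq_mul]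
  rfl

/-- Directional derivatives of a holomorphic function are holomorphic again, so the smoothness can
be raised by one indefinitely. -/
theorem DifferentiableOn.contDiffOn_of_finiteDimensional [FiniteDimensional ℂ E] {f : E → ℂ}
    {V : Set E} (hV : IsOpen V) (hf : DifferentiableOn ℂ f V) : ContDiffOn ℂ ∞ f V := by
  rw [contDiffOn_infty]
  intro m
  induction m generalizing f with
  | zero => exact contDiffOn_zero.2 hf.continuousOn
  | succ m ih =>
    rw [Nat.cast_succ, contDiffOn_succ_iff_fderiv_of_isOpen hV]
    refine ⟨hf, by simp, contDiffOn_clm_apply.2 fun v => ih fun z hz => ?_⟩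
    exact (differentiableAt_fderiv_apply (by
      filter_upwards [hV.mem_nhds hz] with w hw
      exact (hf w hw).differentiableAt (hV.mem_nhds hw)) v).differentiableWithinAt

end Holomorphic

/-! ### Taylor series of holomorphic germs -/

section Taylor

open MvPowerSeries

variable {n : ℕ} {f g : (Fin n → ℂ) → ℂ}

theorem two_le_infty : (2 : WithTop ℕ∞) ≤ ∞ := ENat.LEInfty.out

/-- `f` is holomorphic in a neighbourhood of the origin. -/
def HolAt (f : (Fin n → ℂ) → ℂ) : Prop := ∀ᶠ x in 𝓝 0, DifferentiableAt ℂ f x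

theorem HolAt.partialDeriv (hf : HolAt f) (i : Fin n) : HolAt (partialDeriv i f) := by
  filter_upwards [eventually_eventually_nhds.2 hf] with x hx
  exact differentiableAt_fderiv_apply hx _

theorem HolAt.add (hf : HolAt f) (hg : HolAt g) : HolAt (fun x => f x + g x) := by
  filter_upwards [hf, hg] with x h h' using h.add h'

theorem HolAt.mul (hf : HolAt f) (hg : HolAt g) : HolAt (fun x => f x * g x) := by
  filter_upwards [hf, hg] with x h h' using h.mul h'

theorem HolAt.const (c : ℂ) : HolAt (fun _ : Fin n → ℂ => c) :=
  Filter.Eventually.of_forall fun _ => differentiableAt_const c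

theorem HolAt.sum {ι : Type*} {s : Finset ι} {f : ι → (Fin n → ℂ) → ℂ}
    (hf : ∀ i ∈ s, HolAt (f i)) : HolAt (fun x => ∑ i ∈ s, f i x) := by
  have h : ∀ᶠ x in 𝓝 (0 : Fin n → ℂ), ∀ i ∈ s, DifferentiableAt ℂ (f i) x :=
    (Filter.eventually_all_finset s).2 hf
  filter_upwards [h] with x hx
  exact DifferentiableAt.fun_sum hx

theorem partialDeriv_congr (h : f =ᶠ[𝓝 0] g) (i : Fin n) :
    partialDeriv i f =ᶠ[𝓝 0] partialDeriv i g := by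
  filter_upwards [h.fderiv (𝕜 := ℂ)] with x hx
  simp only [partialDeriv, hx]

theorem iterate_partialDeriv_congr (h : f =ᶠ[𝓝 0] g) (i : Fin n) (k : ℕ) :
    (partialDeriv i)^[k] f =ᶠ[𝓝 0] (partialDeriv i)^[k] g := by
  induction k generalizing f g with
  | zero => exact h
  | succ k ih => exact ih (partialDeriv_congr h i)

theorem HolAt.iterate (hf : HolAt f) (i : Fin n) (k : ℕ) : HolAt ((LieIntegral.partialDeriv i)^[k] f) := by
  induction k generalizing f with
  | zero => exact hf
  | succ k ih => exact ih (hf.partialDeriv i)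

theorem partialDeriv_comm_apply {x : Fin n → ℂ} (hx : ∀ᶠ y in 𝓝 x, DifferentiableAt ℂ f y)
    (i j : Fin n) :
    partialDeriv i (partialDeriv j f) x = partialDeriv j (partialDeriv i f) x := by
  obtain ⟨V, hV, hVo, hxV⟩ := eventually_nhds_iff.1 hx
  have h : ContDiffAt ℂ ∞ f x :=
    (DifferentiableOn.contDiffOn_of_finiteDimensional hVo fun y hy =>
      (hV y hy).differentiableWithinAt).contDiffAt (hVo.mem_nhds hxV)
  have hs : IsSymmSndFDerivAt ℂ f x :=
    h.isSymmSndFDerivAt (by simpa using two_le_infty)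
  have hd : DifferentiableAt ℂ (fderiv ℂ f) x :=
    (h.fderiv_right (m := 1) (by simpa [one_add_one_eq_two] using two_le_infty)).differentiableAt
      (by simp)
  have key : ∀ u v : Fin n → ℂ,
      fderiv ℂ (fun y => fderiv ℂ f y u) x v = fderiv ℂ (fderiv ℂ f) x v u := by
    intro u v
    rw [fderiv_clm_apply hd (differentiableAt_const u)]
    simp
  exact (key _ _).trans ((hs _ _).trans (key _ _).symm)

theorem partialDeriv_comm (hf : HolAt f) (i j : Fin n) :
    partialDeriv i (partialDeriv j f) =ᶠ[𝓝 0] partialDeriv j (partialDeriv i f) :=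
  (eventually_eventually_nhds.2 hf).mono fun _ hx => partialDeriv_comm_apply hx i j

theorem partialDeriv_iterate_comm (hf : HolAt f) (i j : Fin n) (k : ℕ) :
    partialDeriv i ((partialDeriv j)^[k] f) =ᶠ[𝓝 0] (partialDeriv j)^[k] (partialDeriv i f) := by
  induction k generalizing f with
  | zero => rfl
  | succ k ih =>
    rw [Function.iterate_succ_apply, Function.iterate_succ_apply]
    exact (ih (hf.partialDeriv j)).trans (iterate_partialDeriv_congr (partialDeriv_comm hf i j) j k)

/-- Iterated partial derivatives, in the order of a list of indices. -/
def listDeriv (l : List (Fin n)) (α : Fin n →₀ ℕ) (f : (Fin n → ℂ) → ℂ) : (Fin n → ℂ) → ℂ :=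
  l.foldr (fun i g => (partialDeriv i)^[α i] g) f

theorem listDeriv_congr (l : List (Fin n)) (α : Fin n →₀ ℕ) (h : f =ᶠ[𝓝 0] g) :
    listDeriv l α f =ᶠ[𝓝 0] listDeriv l α g := by
  induction l with
  | nil => exact h
  | cons j l ih => exact iterate_partialDeriv_congr ih j _

theorem HolAt.listDeriv (hf : HolAt f) (l : List (Fin n)) (α : Fin n →₀ ℕ) :
    HolAt (listDeriv l α f) := by
  induction l with
  | nil => exact hf
  | cons j l ih => exact HolAt.iterate ih j _

theorem partialDeriv_listDeriv (hf : HolAt f) (l : List (Fin n)) (α : Fin n →₀ ℕ) (i : Fin n) :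
    partialDeriv i (listDeriv l α f) =ᶠ[𝓝 0] listDeriv l α (partialDeriv i f) := by
  induction l with
  | nil => rfl
  | cons j l ih =>
    exact (partialDeriv_iterate_comm (hf.listDeriv l α) i j _).trans
      (iterate_partialDeriv_congr ih j _)

theorem listDeriv_add_single_of_notMem {l : List (Fin n)} (α : Fin n →₀ ℕ) {i : Fin n}
    (hi : i ∉ l) : listDeriv l (α + Finsupp.single i 1) f = listDeriv l α f := by
  induction l with
  | nil => rfl
  | cons j l ih =>
    rw [List.mem_cons, not_or] at hi
    have h := ih hi.2
    simp only [listDeriv, List.foldr_cons] at h ⊢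
    rw [h, Finsupp.add_apply, Finsupp.single_eq_of_ne (Ne.symm hi.1), add_zero]

/-- Partial derivatives of a holomorphic germ commute, so the additional one can be moved to act
first. Without repetitions in `l` it occurs exactly once. -/
theorem listDeriv_add_single (hf : HolAt f) {l : List (Fin n)} (hl : l.Nodup) (α : Fin n →₀ ℕ)
    {i : Fin n} (hi : i ∈ l) :
    listDeriv l (α + Finsupp.single i 1) f =ᶠ[𝓝 0] listDeriv l α (partialDeriv i f) := by
  induction l with
  | nil => simp at hi
  | cons j l ih =>
    rw [List.nodup_cons] at hl
    by_cases hij : i = j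
    · subst hij
      have h := listDeriv_add_single_of_notMem (f := f) α hl.1
      have h2 := iterate_partialDeriv_congr (partialDeriv_listDeriv hf l α i) i (α i)
      simp only [listDeriv, List.foldr_cons] at h h2 ⊢
      rw [h, Finsupp.add_apply, Finsupp.single_eq_same, Function.iterate_succ_apply]
      exact h2
    · have h := iterate_partialDeriv_congr
        (ih hl.2 ((List.mem_cons.1 hi).resolve_left hij)) j (α j)
      simp only [listDeriv, List.foldr_cons] at h ⊢
      rw [Finsupp.add_apply, Finsupp.single_eq_of_ne (Ne.symm hij), add_zero]
      exact h

theorem coeff_taylor (f : (Fin n → ℂ) → ℂ) (α : Fin n →₀ ℕ) :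
    coeff α (taylor f) =
      (∏ i, ((α i).factorial : ℂ))⁻¹ * listDeriv (List.finRange n) α f 0 := rfl

theorem taylor_congr (h : f =ᶠ[𝓝 0] g) : taylor f = taylor g := by
  ext α
  rw [coeff_taylor, coeff_taylor, (listDeriv_congr _ α h).eq_of_nhds]

theorem constantCoeff_taylor (f : (Fin n → ℂ) → ℂ) : constantCoeff (taylor f) = f 0 := by
  have h : ∀ l : List (Fin n), listDeriv l 0 f = f := fun l => by
    induction l with
    | nil => rfl
    | cons j l ih => simp [listDeriv] at ih ⊢
  rw [← coeff_zero_eq_constantCoeff_apply, coeff_taylor, h]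
  simp

/-- The factor `α i + 1` from formal differentiation cancels against the factorials. Together with
the constant term this characterizes the Taylor series, and the later rules for `taylor` use nothing
else. -/
theorem pderiv_taylor (hf : HolAt f) (i : Fin n) :
    pderiv ℂ i (taylor f) = taylor (partialDeriv i f) := by
  ext α
  rw [coeff_pderiv, coeff_taylor, coeff_taylor,
    (listDeriv_add_single hf (List.nodup_finRange n) α (List.mem_finRange i)).eq_of_nhds]
  have hfac : ∏ j, (((α + Finsupp.single i 1 : Fin n →₀ ℕ) j).factorial : ℂ) =
      (α i + 1) * ∏ j, ((α j).factorial : ℂ) := by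
    rw [← Finset.mul_prod_erase _ _ (Finset.mem_univ i),
      ← Finset.mul_prod_erase (a := i) _ (fun j => ((α j).factorial : ℂ)) (Finset.mem_univ i),
      ← mul_assoc]
    congr 1
    · simp [Nat.factorial_succ]
    · refine Finset.prod_congr rfl fun j hj => ?_
      rw [Finsupp.add_apply, Finsupp.single_eq_of_ne (Finset.ne_of_mem_erase hj), add_zero]
  have h1 : (α i + 1 : ℂ) ≠ 0 := by exact_mod_cast Nat.succ_ne_zero (α i)
  rw [hfac]
  field_simp

/-- In characteristic zero a coefficient of positive degree is recovered from a derivative; this is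
the inductive step in comparing two series. -/
theorem coeff_add_single (f : PS n) (α : Fin n →₀ ℕ) (i : Fin n) :
    coeff (α + Finsupp.single i 1) f = (α i + 1 : ℂ)⁻¹ * coeff α (pderiv ℂ i f) := by
  have h1 : (α i + 1 : ℂ) ≠ 0 := by exact_mod_cast Nat.succ_ne_zero (α i)
  rw [coeff_pderiv]
  field_simp

theorem taylor_const (c : ℂ) : taylor (fun _ : Fin n → ℂ => c) = C c := by
  ext α
  induction α using finsupp_induction_single generalizing c with
  | h0 => simpa using constantCoeff_taylor (fun _ : Fin n → ℂ => c)
  | hs α i ih =>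
    have h : partialDeriv i (fun _ : Fin n → ℂ => c) = fun _ => 0 := by
      funext x
      simp [partialDeriv]
    rw [coeff_add_single, coeff_add_single, pderiv_taylor (HolAt.const c), h, ih 0]
    simp

theorem taylor_add (hf : HolAt f) (hg : HolAt g) :
    taylor (fun x => f x + g x) = taylor f + taylor g := by
  ext α
  induction α using finsupp_induction_single generalizing f g with
  | h0 => simp [constantCoeff_taylor]
  | hs α i ih =>
    have h : partialDeriv i (fun x => f x + g x) =ᶠ[𝓝 0]
        fun x => partialDeriv i f x + partialDeriv i g x := by
      filter_upwards [hf, hg] with x h h'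
      simp [partialDeriv, fderiv_fun_add h h']
    rw [coeff_add_single, coeff_add_single, pderiv_taylor (hf.add hg), taylor_congr h,
      ih (hf.partialDeriv i) (hg.partialDeriv i), map_add (pderiv ℂ i), pderiv_taylor hf,
      pderiv_taylor hg]

/-- Both sides obey the Leibniz rule and have the same constant term. The induction runs over all
pairs of germs, since differentiation changes the factors. -/
theorem taylor_mul (hf : HolAt f) (hg : HolAt g) :
    taylor (fun x => f x * g x) = taylor f * taylor g := by
  ext α
  induction α using finsupp_induction_single generalizing f g with
  | h0 => simp [constantCoeff_taylor]
  | hs α i ih =>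
    have h : partialDeriv i (fun x => f x * g x) =ᶠ[𝓝 0]
        fun x => f x * partialDeriv i g x + g x * partialDeriv i f x := by
      filter_upwards [hf, hg] with x h h'
      simp [partialDeriv, fderiv_fun_mul h h']
    rw [coeff_add_single, coeff_add_single, pderiv_taylor (hf.mul hg), taylor_congr h,
      taylor_add (hf.mul (hg.partialDeriv i)) (hg.mul (hf.partialDeriv i)), map_add,
      ih hf (hg.partialDeriv i), ih hg (hf.partialDeriv i), Derivation.leibniz, map_add,
      pderiv_taylor hf, pderiv_taylor hg, smul_eq_mul, smul_eq_mul]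

theorem taylor_sum {ι : Type*} {s : Finset ι} {f : ι → (Fin n → ℂ) → ℂ}
    (hf : ∀ i ∈ s, HolAt (f i)) :
    taylor (fun x => ∑ i ∈ s, f i x) = ∑ i ∈ s, taylor (f i) := by
  classical
  induction s using Finset.induction_on with
  | empty => simpa using taylor_const (n := n) 0
  | insert a s ha ih =>
    simp only [Finset.sum_insert ha]
    rw [taylor_add (hf a (Finset.mem_insert_self a s))
      (HolAt.sum fun i hi => hf i (Finset.mem_insert_of_mem hi)),
      ih fun i hi => hf i (Finset.mem_insert_of_mem hi)]

end Taylor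

/-! ### Classes of regular functions and regular families of power series -/

section Regular

open MvPowerSeries

/-- A class of complex-valued functions, regular at a base point, that is closed under composition
with holomorphic functions. -/
structure RegClass (X : Type*) where
  l : Filter X
  base : X
  Reg : (X → ℂ) → Prop
  congr : ∀ {f g : X → ℂ}, Reg f → f =ᶠ[l] g → Reg g
  const : ∀ c : ℂ, Reg fun _ => c
  add : ∀ {f g : X → ℂ}, Reg f → Reg g → Reg fun q => f q + g q
  mul : ∀ {f g : X → ℂ}, Reg f → Reg g → Reg fun q => f q * g q
  comp : ∀ {k : ℕ} {f : (Fin k → ℂ) → ℂ} {V : Set (Fin k → ℂ)}, IsOpen V →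
    DifferentiableOn ℂ f V → ∀ {w : X → Fin k → ℂ}, (∀ j, Reg fun q => w q j) → w base ∈ V →
      Reg fun q => f (w q)
  tendsto : ∀ {f : X → ℂ}, Reg f → Filter.Tendsto f l (𝓝 (f base))

namespace RegClass

variable {X : Type*} (c : RegClass X)

theorem sum {ι : Type*} {s : Finset ι} {f : ι → X → ℂ} (h : ∀ i ∈ s, c.Reg (f i)) :
    c.Reg fun q => ∑ i ∈ s, f i q := by
  classical
  induction s using Finset.induction_on with
  | empty => simpa using c.const 0
  | insert a s ha ih =>
    simp only [Finset.sum_insert ha]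
    exact c.add (h a (Finset.mem_insert_self a s))
      (ih fun i hi => h i (Finset.mem_insert_of_mem hi))

theorem inv {f : X → ℂ} (h : c.Reg f) (h0 : f c.base ≠ 0) : c.Reg fun q => (f q)⁻¹ := by
  have hV : IsOpen {x : Fin 1 → ℂ | x 0 ≠ 0} := isOpen_ne_fun (continuous_apply 0) continuous_const
  refine c.comp (k := 1) (f := fun x => (x 0)⁻¹) hV (fun x hx => ?_) (w := fun q _ => f q)
    (fun _ => h) h0
  exact DifferentiableAt.differentiableWithinAt
    (DifferentiableAt.inv (h := fun x : Fin 1 → ℂ => x 0) (by fun_prop) hx)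

end RegClass

/-- Functions that are smooth within `S` at `y`. -/
def smoothClass {E : Type*} [NormedAddCommGroup E] [NormedSpace ℝ E] (S : Set E) {y : E}
    (hy : y ∈ S) : RegClass E where
  l := 𝓝[S] y
  base := y
  Reg f := ContDiffWithinAt ℝ ∞ f S y
  congr hf h := hf.congr_of_eventuallyEq h.symm (h.self_of_nhdsWithin hy).symm
  const _ := contDiffWithinAt_const
  add := ContDiffWithinAt.add
  mul := ContDiffWithinAt.mul
  comp {k f V} hV hf {w} hw hy := by
    have h1 : ContDiffAt ℝ ∞ f (w y) :=
      ((DifferentiableOn.contDiffOn_of_finiteDimensional hV hf).contDiffAt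
        (hV.mem_nhds hy)).restrict_scalars ℝ
    exact h1.comp_contDiffWithinAt y (contDiffWithinAt_pi.2 hw)
  tendsto hf := hf.continuousWithinAt

/-- Functions of one complex variable that are holomorphic at `w₀`. -/
def holClass (w₀ : ℂ) : RegClass ℂ where
  l := 𝓝 w₀
  base := w₀
  Reg f := AnalyticAt ℂ f w₀
  congr hf h := hf.congr h
  const _ := analyticAt_const
  add := AnalyticAt.fun_add
  mul := AnalyticAt.fun_mul
  comp {k f V} hV hf {w} hw h0 := by
    have hev : ∀ᶠ q in 𝓝 w₀, ∀ j, DifferentiableAt ℂ (fun q => w q j) q :=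
      Filter.eventually_all.2 fun j => (hw j).eventually_analyticAt.mono fun q h =>
        h.differentiableAt
    have hcont : ContinuousAt w w₀ := continuousAt_pi.2 fun j => (hw j).continuousAt
    obtain ⟨U, hU, hUo, h0U⟩ := eventually_nhds_iff.1 (hev.and (hcont.eventually (hV.mem_nhds h0)))
    refine DifferentiableOn.analyticAt (s := U) (fun q hq => ?_) (hUo.mem_nhds h0U)
    exact (((hf _ (hU q hq).2).differentiableAt (hV.mem_nhds (hU q hq).2)).comp q
      (differentiableAt_pi.2 (hU q hq).1)).differentiableWithinAt
  tendsto hf := hf.continuousAt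

variable {X : Type*} {c : RegClass X} {n : ℕ}

/-- Families of power series with regular coefficients. -/
def RegPS (c : RegClass X) (f : X → PS n) : Prop := ∀ α, c.Reg fun q => coeff α (f q)

namespace RegPS

variable {f g : X → PS n}

theorem congr (hf : RegPS c f) (h : f =ᶠ[c.l] g) : RegPS c g := fun α =>
  c.congr (hf α) (h.mono fun _ hq => congrArg (coeff α) hq)

theorem const (c : RegClass X) (f : PS n) : RegPS c fun _ => f := fun _ => c.const _

theorem add (hf : RegPS c f) (hg : RegPS c g) : RegPS c fun q => f q + g q := fun α => by
  simpa using c.add (hf α) (hg α)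

theorem mul (hf : RegPS c f) (hg : RegPS c g) : RegPS c fun q => f q * g q := fun α => by
  classical
  simp only [coeff_mul]
  exact c.sum fun p _ => c.mul (hf p.1) (hg p.2)

theorem smul {a : X → ℂ} (ha : c.Reg a) (hf : RegPS c f) : RegPS c fun q => a q • f q :=
  fun α => by simpa using c.mul ha (hf α)

theorem neg (hf : RegPS c f) : RegPS c fun q => -f q := by
  simpa using smul (c.const (-1)) hf

theorem sub (hf : RegPS c f) (hg : RegPS c g) : RegPS c fun q => f q - g q := by
  simpa [sub_eq_add_neg] using hf.add hg.neg

theorem sum {ι : Type*} {s : Finset ι} {f : ι → X → PS n} (h : ∀ i ∈ s, RegPS c (f i)) :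
    RegPS c fun q => ∑ i ∈ s, f i q := fun α => by
  simpa using c.sum fun i hi => h i hi α

theorem prod {ι : Type*} {s : Finset ι} {f : ι → X → PS n} (h : ∀ i ∈ s, RegPS c (f i)) :
    RegPS c fun q => ∏ i ∈ s, f i q := by
  classical
  induction s using Finset.induction_on with
  | empty => simpa using const c (1 : PS n)
  | insert a s ha ih =>
    simp only [Finset.prod_insert ha]
    exact (h a (Finset.mem_insert_self a s)).mul
      (ih fun i hi => h i (Finset.mem_insert_of_mem hi))

theorem pderiv (hf : RegPS c f) (i : Fin n) : RegPS c fun q => pderiv ℂ i (f q) := fun α => by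
  simp only [coeff_pderiv]
  exact c.mul (hf _) (c.const _)

/-- The recursion for the coefficients of an inverse involves only coefficients of smaller degree
and the reciprocal of the constant term, which is regular because that term is nonzero at the base
point. -/
theorem inv (hf : RegPS c f) (h0 : constantCoeff (f c.base) ≠ 0) : RegPS c fun q => (f q)⁻¹ := by
  classical
  intro α
  have hc : c.Reg fun q => (constantCoeff (f q))⁻¹ := c.inv (hf 0) h0
  induction hd : α.degree using Nat.strong_induction_on generalizing α with
  | _ m ih =>
    rw [show (fun q => coeff α (f q)⁻¹) = _ from funext fun q => coeff_inv α (f q)]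
    split_ifs with h
    · exact hc
    · refine c.mul (by simpa using c.mul (c.const (-1)) hc) (c.sum fun p _ => ?_)
      split_ifs with h2
      · refine c.mul (hf p.1) (ih p.2.degree ?_ p.2 rfl)
        rw [← hd]
        obtain ⟨r, hr⟩ := exists_add_of_le h2.le
        rw [hr, map_add]
        have : r ≠ 0 := by
          rintro rfl
          rw [add_zero] at hr
          exact h2.ne hr.symm
        have := (Finsupp.degree_eq_zero_iff r).not.2 this
        omega
      · exact c.const 0

theorem det {ι : Type*} [Fintype ι] [DecidableEq ι] {M : X → Matrix ι ι (PS n)}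
    (h : ∀ i j, RegPS c fun q => M q i j) : RegPS c fun q => (M q).det := by
  simp only [Matrix.det_apply, Units.smul_def, ← Int.cast_smul_eq_zsmul ℂ]
  exact sum fun σ _ => smul (c.const _) (prod fun i _ => h _ _)

end RegPS

end Regular

/-! ### Pulling back holomorphic functions along a coordinate system -/

section Pull

open MvPowerSeries

variable {n : ℕ}

namespace Frame

variable (F : Frame n)

/-- The Taylor series of the homogeneous coordinates of a coordinate system. -/
def liftPS (j : Fin (n + 1)) : PS n := taylor fun x => F.lift x j

/-- The Taylor series of the trivialization. -/
def trivPS : PS n := taylor F.triv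

/-- The Taylor series of a function on `ℂⁿ⁺¹` along a coordinate system. -/
def pull (f : (Fin (n + 1) → ℂ) → ℂ) : PS n := taylor fun x => f (F.lift x)

theorem eventually_differentiableAt_lift : ∀ᶠ x in 𝓝 0, DifferentiableAt ℂ F.lift x :=
  F.analyticAt_lift.eventually_analyticAt.mono fun _ h => h.differentiableAt

theorem holAt_lift (j : Fin (n + 1)) : HolAt fun x => F.lift x j :=
  F.eventually_differentiableAt_lift.mono fun _ h => differentiableAt_pi.1 h j

theorem holAt_triv : HolAt F.triv :=
  F.analyticAt_triv.eventually_analyticAt.mono fun _ h => h.differentiableAt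

variable {V : Set (Fin (n + 1) → ℂ)} {f : (Fin (n + 1) → ℂ) → ℂ}

theorem eventually_lift_mem (hV : IsOpen V) (h0 : F.lift 0 ∈ V) : ∀ᶠ x in 𝓝 0, F.lift x ∈ V :=
  F.analyticAt_lift.continuousAt.eventually (hV.mem_nhds h0)

theorem holAt_comp (hV : IsOpen V) (hf : DifferentiableOn ℂ f V) (h0 : F.lift 0 ∈ V) :
    HolAt fun x => f (F.lift x) := by
  filter_upwards [F.eventually_lift_mem hV h0, F.eventually_differentiableAt_lift] with x hx hx'
  exact ((hf _ hx).differentiableAt (hV.mem_nhds hx)).comp x hx'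

theorem _root_.LieIntegral.differentiableOn_partialDeriv {k : ℕ} {V : Set (Fin k → ℂ)}
    {f : (Fin k → ℂ) → ℂ} (hV : IsOpen V) (hf : DifferentiableOn ℂ f V) (j : Fin k) :
    DifferentiableOn ℂ (partialDeriv j f) V := fun z hz =>
  (differentiableAt_fderiv_apply (by
    filter_upwards [hV.mem_nhds hz] with w hw
    exact (hf w hw).differentiableAt (hV.mem_nhds hw)) _).differentiableWithinAt

theorem _root_.LieIntegral.fderiv_eq_sum_partialDeriv {k : ℕ} (f : (Fin k → ℂ) → ℂ)
    (z v : Fin k → ℂ) : fderiv ℂ f z v = ∑ j, partialDeriv j f z * v j := by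
  conv_lhs => rw [← Finset.univ_sum_single v]
  rw [map_sum]
  refine Finset.sum_congr rfl fun j _ => ?_
  have : (Pi.single j (v j) : Fin k → ℂ) = v j • Pi.single j 1 := by
    rw [← Pi.single_smul, smul_eq_mul, mul_one]
  rw [this, map_smul, smul_eq_mul, mul_comm, partialDeriv]

/-- The chain rule for holomorphic germs, transported to Taylor series by `pderiv_taylor`. -/
theorem pderiv_pull (hV : IsOpen V) (hf : DifferentiableOn ℂ f V) (h0 : F.lift 0 ∈ V)
    (i : Fin n) :
    pderiv ℂ i (F.pull f) = ∑ j, F.pull (partialDeriv j f) * pderiv ℂ i (F.liftPS j) := by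
  have hh := fun j => F.holAt_comp hV (differentiableOn_partialDeriv hV hf j) h0
  have hl := fun j => (F.holAt_lift j).partialDeriv i
  have h : partialDeriv i (fun x => f (F.lift x)) =ᶠ[𝓝 0]
      fun x => ∑ j, partialDeriv j f (F.lift x) * partialDeriv i (fun x => F.lift x j) x := by
    filter_upwards [F.eventually_lift_mem hV h0, F.eventually_differentiableAt_lift] with x hx hx'
    have h1 := ((hf _ hx).differentiableAt (hV.mem_nhds hx)).hasFDerivAt.comp x hx'.hasFDerivAt
    have h2 : partialDeriv i (fun x => f (F.lift x)) x =
        fderiv ℂ f (F.lift x) (fderiv ℂ F.lift x (Pi.single i 1)) :=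
      congrArg (fun L => L (Pi.single i 1)) h1.fderiv
    rw [h2, fderiv_eq_sum_partialDeriv]
    refine Finset.sum_congr rfl fun j _ => ?_
    rw [partialDeriv, fderiv_pi fun j => differentiableAt_pi.1 hx' j]
    rfl
  rw [pull, pderiv_taylor (F.holAt_comp hV hf h0), taylor_congr h,
    taylor_sum fun j _ => (hh j).mul (hl j)]
  refine Finset.sum_congr rfl fun j _ => ?_
  rw [taylor_mul (hh j) (hl j), liftPS, pderiv_taylor (F.holAt_lift j)]
  rfl

theorem expand_eq (hV : IsOpen V) (hf : DifferentiableOn ℂ f V) (h0 : F.lift 0 ∈ V) :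
    F.expand f = F.trivPS * F.pull f :=
  taylor_mul F.holAt_triv (F.holAt_comp hV hf h0)

theorem constantCoeff_trivPS : constantCoeff F.trivPS ≠ 0 := by
  rw [trivPS, constantCoeff_taylor]
  exact F.triv_ne_zero

theorem constantCoeff_liftPS (j : Fin (n + 1)) : constantCoeff (F.liftPS j) = F.lift 0 j :=
  constantCoeff_taylor _

/-- The matrix formed by the homogeneous coordinates and their derivatives. -/
def jac : Matrix (Fin (n + 1)) (Fin (n + 1)) (PS n) :=
  Matrix.of fun j => Fin.cons (F.liftPS j) fun k => pderiv ℂ k (F.liftPS j)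

/-- A kernel vector of the matrix at the origin would be a linear relation between the lift and its
partial derivatives, which `nondegenerate` excludes. So these vectors span `ℂⁿ⁺¹`, and the
determinant is an invertible power series. -/
theorem constantCoeff_det_jac : constantCoeff F.jac.det ≠ 0 := by
  rw [RingHom.map_det]
  intro h
  obtain ⟨v, hv, hv0⟩ := Matrix.exists_mulVec_eq_zero_iff.2 h
  apply hv
  have h1 : v 0 • F.lift 0 + fderiv ℂ F.lift 0 (Fin.tail v) = 0 := by
    funext j
    have h2 := congrFun hv0 j
    rw [Matrix.mulVec, dotProduct, Fin.sum_univ_succ] at h2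
    simp only [RingHom.mapMatrix_apply, Matrix.map_apply, jac, Matrix.of_apply, Fin.cons_zero,
      Fin.cons_succ, Pi.zero_apply, constantCoeff_liftPS] at h2
    rw [Pi.add_apply, Pi.smul_apply, smul_eq_mul, mul_comm, Pi.zero_apply, ← h2]
    congr 1
    have hd := F.analyticAt_lift.differentiableAt
    rw [fderiv_pi fun j => differentiableAt_pi.1 hd j]
    change fderiv ℂ (fun x => F.lift x j) 0 (Fin.tail v) = _
    rw [fderiv_eq_sum_partialDeriv]
    refine Finset.sum_congr rfl fun k _ => ?_
    rw [liftPS, pderiv_taylor (F.holAt_lift j), constantCoeff_taylor]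
    rfl
  have h3 := @F.nondegenerate (v 0, Fin.tail v) (0, 0) (by simpa using h1)
  rw [Prod.mk.injEq] at h3
  rw [← Fin.cons_self_tail v, h3.1, h3.2]
  funext j
  refine Fin.cases ?_ (fun k => ?_) j <;> simp

theorem lift_zero_ne_zero : F.lift 0 ≠ 0 := by
  intro h
  have := @F.nondegenerate (1, 0) (0, 0) (by simp [h])
  simp at this

/-- The coefficients of a vector field along the coordinate system in the basis formed by the
Euler field and the coordinate fields. -/
def components (W : Fin (n + 1) → PS n) : Fin (n + 1) → PS n :=
  fun i => F.jac.det⁻¹ * ∑ j, F.jac.adjugate i j * W j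

/-- Cramer's rule for the invertible matrix `jac`. -/
theorem sum_components (W : Fin (n + 1) → PS n) (j : Fin (n + 1)) :
    F.liftPS j * F.components W 0 + ∑ k : Fin n, pderiv ℂ k (F.liftPS j) * F.components W k.succ =
      W j := by
  have h : (F.jac.mulVec (F.components W)) j = W j := by
    have h1 : F.components W = F.jac.det⁻¹ • F.jac.adjugate.mulVec W := by
      funext i
      simp [components, Matrix.mulVec, dotProduct]
    rw [h1, Matrix.mulVec_smul, Matrix.mulVec_mulVec, Matrix.mul_adjugate, Matrix.smul_mulVec,
      Matrix.one_mulVec, smul_smul, MvPowerSeries.inv_mul_cancel _ F.constantCoeff_det_jac,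
      one_smul]
  rw [← h, Matrix.mulVec, dotProduct, Fin.sum_univ_succ]
  simp [jac]

end Frame

theorem Dif.mulLeft_mem (a : PS n) : LinearMap.mulLeft ℂ a ∈ Dif n :=
  Algebra.subset_adjoin (Or.inl ⟨a, rfl⟩)

theorem Dif.pderiv_mem (i : Fin n) : (pderiv ℂ i).toLinearMap ∈ Dif n :=
  Algebra.subset_adjoin (Or.inr ⟨i, rfl⟩)

/-- Multiplication by a power series. -/
def Dif.mulOp (a : PS n) : Dif n := ⟨LinearMap.mulLeft ℂ a, Dif.mulLeft_mem a⟩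

/-- Partial derivatives. -/
def Dif.derivOp (i : Fin n) : Dif n := ⟨(pderiv ℂ i).toLinearMap, Dif.pderiv_mem i⟩

/-! ### The action of vector fields along a coordinate system on sections of `O(d)` -/

namespace Frame

variable (F : Frame n) {V : Set (Fin (n + 1) → ℂ)} {f : (Fin (n + 1) → ℂ) → ℂ}

/-- The operator by which a vector field along the coordinate system acts on sections of `O(d)`. -/
def vectorOp (d : ℤ) (W : Fin (n + 1) → PS n) : Dif n :=
  ∑ k : Fin n, Dif.mulOp (F.components W k.succ) * Dif.derivOp k +
    Dif.mulOp ((d : ℂ) • F.components W 0 -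
      ∑ k : Fin n, F.components W k.succ * (pderiv ℂ k F.trivPS * F.trivPS⁻¹))

theorem vectorOp_apply (d : ℤ) (W : Fin (n + 1) → PS n) (g : PS n) :
    (F.vectorOp d W).1 g = ∑ k : Fin n, F.components W k.succ * pderiv ℂ k g +
      ((d : ℂ) • F.components W 0 -
        ∑ k : Fin n, F.components W k.succ * (pderiv ℂ k F.trivPS * F.trivPS⁻¹)) * g := by
  simp only [vectorOp, Subalgebra.coe_add, LinearMap.add_apply,
    AddSubmonoidClass.coe_finsetSum, LinearMap.sum_apply]
  rfl

theorem hasOrd_vectorOp (d : ℤ) (W : Fin (n + 1) → PS n) : HasOrd 1 (F.vectorOp d W).1 := by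
  simp only [vectorOp, Subalgebra.coe_add, AddSubmonoidClass.coe_finsetSum]
  refine (HasOrd.sum fun k _ => ?_).add ((HasOrd.mulLeft _).mono (by omega))
  exact (HasOrd.mulLeft _).mul (HasOrd.pderiv k)

/-- The homogeneous functions of degree `d` satisfy Euler's identity. -/
theorem pull_euler {d : ℤ} (hV : IsOpen V) (hf : DifferentiableOn ℂ f V) (h0 : F.lift 0 ∈ V)
    (hh : ∀ c : ℂ, c ≠ 0 → ∀ z ∈ V, f (c • z) = c ^ d * f z) :
    ∑ j, F.pull (partialDeriv j f) * F.liftPS j = (d : ℂ) • F.pull f := by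
  have hp := fun j => F.holAt_comp hV (differentiableOn_partialDeriv hV hf j) h0
  have h1 : (fun x => ∑ j, partialDeriv j f (F.lift x) * F.lift x j) =ᶠ[𝓝 0]
      fun x => (d : ℂ) * f (F.lift x) := by
    filter_upwards [F.eventually_lift_mem hV h0] with x hx
    rw [← fderiv_eq_sum_partialDeriv]
    have hd : HasDerivAt (fun c : ℂ => f (c • F.lift x)) (fderiv ℂ f (F.lift x) (F.lift x)) 1 := by
      have h2 : HasDerivAt (fun c : ℂ => c • F.lift x) (F.lift x) 1 := by
        simpa using (hasDerivAt_id (1 : ℂ)).smul_const (F.lift x)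
      have h3 : HasFDerivAt f (fderiv ℂ f (F.lift x)) ((1 : ℂ) • F.lift x) := by
        rw [one_smul]
        exact ((hf _ hx).differentiableAt (hV.mem_nhds hx)).hasFDerivAt
      exact h3.comp_hasDerivAt 1 h2
    have hd' : HasDerivAt (fun c : ℂ => f (c • F.lift x)) (d * f (F.lift x)) 1 := by
      have h2 : HasDerivAt (fun c : ℂ => c ^ d * f (F.lift x)) (d * f (F.lift x)) 1 := by
        simpa using (hasDerivAt_zpow d (1 : ℂ) (Or.inl one_ne_zero)).mul_const (f (F.lift x))
      refine h2.congr_of_eventuallyEq ?_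
      filter_upwards [isOpen_ne.mem_nhds (one_ne_zero : (1 : ℂ) ≠ 0)] with c hc
      exact hh c hc _ hx
    exact hd.unique hd'
  have h2 := taylor_congr h1
  rw [taylor_sum fun j _ => (hp j).mul (F.holAt_lift j),
    taylor_mul (HolAt.const _) (F.holAt_comp hV hf h0), taylor_const] at h2
  rw [smul_eq_C_mul]
  refine Eq.trans (Finset.sum_congr rfl fun j _ => ?_) h2
  exact (taylor_mul (hp j) (F.holAt_lift j)).symm

/-- Decompose `W` into its Euler and coordinate components: the Euler field acts on a homogeneous
function as multiplication by `d`, the others act as the `∂_k`. The zeroth-order correction in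
`vectorOp` removes the derivatives that fall on the trivialization. -/
theorem vectorOp_expand {d : ℤ} (hV : IsOpen V) (hf : DifferentiableOn ℂ f V)
    (h0 : F.lift 0 ∈ V) (hh : ∀ c : ℂ, c ≠ 0 → ∀ z ∈ V, f (c • z) = c ^ d * f z)
    (W : Fin (n + 1) → PS n) :
    (F.vectorOp d W).1 (F.expand f) = F.trivPS * ∑ j, F.pull (partialDeriv j f) * W j := by
  have hE := F.pull_euler hV hf h0 hh
  have hu : F.trivPS⁻¹ * F.trivPS = 1 := MvPowerSeries.inv_mul_cancel _ F.constantCoeff_trivPS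
  have h1 : ∑ j, F.pull (partialDeriv j f) * W j = F.components W 0 * ((d : ℂ) • F.pull f) +
      ∑ k : Fin n, F.components W k.succ * pderiv ℂ k (F.pull f) := by
    rw [← hE]
    simp only [F.pderiv_pull hV hf h0]
    conv_lhs => enter [2, j]; rw [← F.sum_components W j]
    simp only [mul_add, Finset.sum_add_distrib, Finset.mul_sum]
    congr 1
    · exact Finset.sum_congr rfl fun j _ => by ring
    · rw [Finset.sum_comm]
      exact Finset.sum_congr rfl fun k _ => Finset.sum_congr rfl fun j _ => by ring
  rw [vectorOp_apply, F.expand_eq hV hf h0, h1]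
  simp only [Derivation.leibniz, smul_eq_mul, smul_eq_C_mul, sub_mul, mul_add, Finset.mul_sum,
    Finset.sum_mul, Finset.sum_add_distrib]
  have h2 : ∀ k : Fin n, F.components W k.succ * (pderiv ℂ k F.trivPS * F.trivPS⁻¹) *
      (F.trivPS * F.pull f) = F.components W k.succ * (F.pull f * pderiv ℂ k F.trivPS) := by
    intro k
    linear_combination F.components W k.succ * pderiv ℂ k F.trivPS * F.pull f * hu
  simp only [h2]
  have h3 : ∀ k : Fin n, F.components W k.succ * (F.trivPS * pderiv ℂ k (F.pull f)) =
      F.trivPS * (F.components W k.succ * pderiv ℂ k (F.pull f)) := fun k => by ring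
  simp only [h3]
  ring

end Frame

end Pull

/-! ### Regular families of coordinate systems -/

section RegularFrames

open MvPowerSeries

variable {n : ℕ} {X : Type} {c : RegClass X} {G : X → Frame n}

theorem exists_add_single {α : Fin n →₀ ℕ} (hα : α ≠ 0) :
    ∃ β i, α = β + Finsupp.single i 1 := by
  obtain ⟨i, hi⟩ := Finsupp.ne_iff.1 hα
  refine ⟨α - Finsupp.single i 1, i, (tsub_add_cancel_of_le ?_).symm⟩
  rw [Finsupp.single_le_iff]
  exact Nat.one_le_iff_ne_zero.2 hi

/-- Families of coordinate systems with regular Taylor coefficients. -/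
structure RegFrame (c : RegClass X) (G : X → Frame n) : Prop where
  lift : ∀ j, RegPS c fun q => (G q).liftPS j
  triv : RegPS c fun q => (G q).trivPS

theorem RegFrame.reg_lift_zero (hG : RegFrame c G) (j : Fin (n + 1)) :
    c.Reg fun q => (G q).lift 0 j := by
  refine c.congr (hG.lift j 0) (Filter.Eventually.of_forall fun q => ?_)
  simpa using (G q).constantCoeff_liftPS j

theorem RegFrame.eventually_mem (hG : RegFrame c G) {V : Set (Fin (n + 1) → ℂ)} (hV : IsOpen V)
    (h0 : (G c.base).lift 0 ∈ V) : ∀ᶠ q in c.l, (G q).lift 0 ∈ V :=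
  (tendsto_pi_nhds.2 fun j => c.tendsto (hG.reg_lift_zero j)).eventually (hV.mem_nhds h0)

/-- Constant terms are regular because the class is closed under composition with holomorphic
functions. The chain rule reduces each further coefficient to lower ones of the partial derivatives
of `f`, so the induction is over all `f` at once. -/
theorem RegFrame.pull (hG : RegFrame c G) {V : Set (Fin (n + 1) → ℂ)} (hV : IsOpen V)
    {f : (Fin (n + 1) → ℂ) → ℂ} (hf : DifferentiableOn ℂ f V) (h0 : (G c.base).lift 0 ∈ V) :
    RegPS c fun q => (G q).pull f := by
  classical
  intro α
  induction hd : α.degree using Nat.strong_induction_on generalizing α f with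
  | _ m ih =>
    by_cases hα : α = 0
    · subst hα
      refine c.congr (c.comp hV hf hG.reg_lift_zero h0) (Filter.Eventually.of_forall fun q => ?_)
      exact (constantCoeff_taylor fun x => f ((G q).lift x)).symm
    · obtain ⟨β, i, rfl⟩ := exists_add_single hα
      rw [map_add, Finsupp.degree_single] at hd
      have h1 : c.Reg fun q => (β i + 1 : ℂ)⁻¹ * coeff β (∑ j, (G q).pull (partialDeriv j f) *
          MvPowerSeries.pderiv ℂ i ((G q).liftPS j)) := by
        simp only [map_sum, coeff_mul]
        refine c.mul (c.const _) (c.sum fun j _ => c.sum fun p hp => ?_)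
        have hp' := congrArg Finsupp.degree (Finset.HasAntidiagonal.mem_antidiagonal.1 hp)
        rw [map_add] at hp'
        exact c.mul (ih p.1.degree (by omega) (differentiableOn_partialDeriv hV hf j) p.1 rfl)
          ((hG.lift j).pderiv i p.2)
      refine c.congr h1 ((hG.eventually_mem hV h0).mono fun q hq => ?_)
      beta_reduce
      rw [coeff_add_single, (G q).pderiv_pull hV hf hq]

theorem RegFrame.expand (hG : RegFrame c G) {V : Set (Fin (n + 1) → ℂ)} (hV : IsOpen V)
    {f : (Fin (n + 1) → ℂ) → ℂ} (hf : DifferentiableOn ℂ f V) (h0 : (G c.base).lift 0 ∈ V) :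
    RegPS c fun q => (G q).expand f :=
  (hG.triv.mul (hG.pull hV hf h0)).congr ((hG.eventually_mem hV h0).mono fun q hq =>
    ((G q).expand_eq hV hf hq).symm)

/-- Families of operators that preserve regularity. -/
def RegOp (c : RegClass X) (P : X → Module.End ℂ (PS n)) : Prop :=
  ∀ f : X → PS n, RegPS c f → RegPS c fun q => P q (f q)

theorem RegOp.congr {P Q : X → Module.End ℂ (PS n)} (hP : RegOp c P) (h : P =ᶠ[c.l] Q) :
    RegOp c Q := fun f hf =>
  (hP f hf).congr (h.mono fun q hq => by simp only [hq])

theorem RegOp.entry {P : X → Module.End ℂ (PS n)} (hP : RegOp c P) (α β : Fin n →₀ ℕ) :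
    c.Reg fun q => entry (P q) α β := hP _ (RegPS.const c _) α

theorem RegFrame.jac (hG : RegFrame c G) (i j : Fin (n + 1)) :
    RegPS c fun q => (G q).jac i j := by
  refine Fin.cases ?_ (fun k => ?_) j
  · exact hG.lift i
  · exact (hG.lift i).pderiv k

/-- The adjugate is polynomial in the entries, and the determinant is invertible at the base point.
-/
theorem RegFrame.components (hG : RegFrame c G) {W : X → Fin (n + 1) → PS n}
    (hW : ∀ j, RegPS c fun q => W q j) (i : Fin (n + 1)) :
    RegPS c fun q => (G q).components (W q) i := by
  have h1 : ∀ i j, RegPS c fun q => (G q).jac.adjugate i j := fun i j => by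
    simp only [Matrix.adjugate_apply]
    refine RegPS.det fun k l => ?_
    by_cases hk : k = j
    · subst hk
      simp only [Matrix.updateRow_self]
      exact RegPS.const c _
    · simp only [Matrix.updateRow_ne hk]
      exact hG.jac k l
  exact ((RegPS.det hG.jac).inv (G c.base).constantCoeff_det_jac).mul
    (RegPS.sum fun j _ => (h1 i j).mul (hW j))

theorem RegFrame.vectorOp (hG : RegFrame c G) (d : ℤ) {W : X → Fin (n + 1) → PS n}
    (hW : ∀ j, RegPS c fun q => W q j) : RegOp c fun q => ((G q).vectorOp d (W q)).1 := by
  intro f hf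
  simp only [Frame.vectorOp_apply]
  have hc := hG.components hW
  refine (RegPS.sum fun k _ => (hc _).mul (hf.pderiv k)).add (RegPS.mul ?_ hf)
  exact (RegPS.smul (c.const _) (hc 0)).sub (RegPS.sum fun k _ => (hc _).mul
    ((hG.triv.pderiv k).mul (hG.triv.inv (G c.base).constantCoeff_trivPS)))

end RegularFrames

/-! ### Expansions of sections determine operators -/

section Uniqueness

open MvPowerSeries

variable {n : ℕ}

namespace Frame

variable (F : Frame n) {V : Set (Fin (n + 1) → ℂ)} {f g : (Fin (n + 1) → ℂ) → ℂ}

theorem pull_add (hV : IsOpen V) (hf : DifferentiableOn ℂ f V) (hg : DifferentiableOn ℂ g V)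
    (h0 : F.lift 0 ∈ V) : F.pull (fun z => f z + g z) = F.pull f + F.pull g :=
  taylor_add (F.holAt_comp hV hf h0) (F.holAt_comp hV hg h0)

theorem pull_mul (hV : IsOpen V) (hf : DifferentiableOn ℂ f V) (hg : DifferentiableOn ℂ g V)
    (h0 : F.lift 0 ∈ V) : F.pull (fun z => f z * g z) = F.pull f * F.pull g :=
  taylor_mul (F.holAt_comp hV hf h0) (F.holAt_comp hV hg h0)

theorem pull_congr (hV : IsOpen V) (h0 : F.lift 0 ∈ V) (h : ∀ z ∈ V, f z = g z) :
    F.pull f = F.pull g :=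
  taylor_congr ((F.eventually_lift_mem hV h0).mono fun _ hx => h _ hx)

theorem expand_congr (hV : IsOpen V) (h0 : F.lift 0 ∈ V) (h : ∀ z ∈ V, f z = g z) :
    F.expand f = F.expand g :=
  taylor_congr ((F.eventually_lift_mem hV h0).mono fun x hx =>
    congrArg (F.triv x * ·) (h _ hx))

theorem constantCoeff_pull (f : (Fin (n + 1) → ℂ) → ℂ) : constantCoeff (F.pull f) = f (F.lift 0) :=
  constantCoeff_taylor _

/-- An affine coordinate on `U_i`, extended by zero. -/
def _root_.LieIntegral.affineCoord (i j : Fin (n + 1)) : (Fin (n + 1) → ℂ) → ℂ :=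
  fun z => z j / z i

theorem _root_.LieIntegral.affineCoord_mem (i j : Fin (n + 1)) :
    affineCoord i j ∈ sections 0 (chart n i) := by
  refine ⟨fun z hz => ?_, fun c hc z _ => ?_, fun z hz => ?_⟩
  · have h : z i ≠ 0 := hz
    unfold affineCoord
    fun_prop (disch := exact h)
  · simp [affineCoord, mul_div_mul_left _ _ hc]
  · have : z i = 0 := not_not.1 hz
    simp [affineCoord, this]

theorem _root_.LieIntegral.zpow_mul_mem (d : ℤ) {i : Fin (n + 1)} {g : (Fin (n + 1) → ℂ) → ℂ}
    (hg : g ∈ sections 0 (chart n i)) :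
    (fun z => z i ^ d * g z) ∈ sections d (chart n i) := by
  obtain ⟨h1, h2, h3⟩ := hg
  refine ⟨fun z hz => ?_, fun c hc z hz => ?_, fun z hz => ?_⟩
  · refine DifferentiableWithinAt.mul ?_ (h1 z hz)
    exact (DifferentiableAt.zpow (f := fun z : Fin (n + 1) → ℂ => z i) (by fun_prop)
      (Or.inl hz)).differentiableWithinAt
  · simp only [h2 c hc z hz, zpow_zero, one_mul, Pi.smul_apply, smul_eq_mul, mul_zpow]
    ring
  · simp only [h3 z hz, mul_zero]

theorem _root_.LieIntegral.differentiableOn_zpow (d : ℤ) (i : Fin (n + 1)) :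
    DifferentiableOn ℂ (fun z : Fin (n + 1) → ℂ => z i ^ d) (chart n i).carrier := fun z hz =>
  (DifferentiableAt.zpow (f := fun z : Fin (n + 1) → ℂ => z i) (by fun_prop)
    (Or.inl hz)).differentiableWithinAt

/-- The algebra generated by the affine coordinates, written in a coordinate system. -/
def coordAlgebra (i : Fin (n + 1)) : Subalgebra ℂ (PS n) :=
  Algebra.adjoin ℂ (Set.range fun j => F.pull (affineCoord i j))

/-- Polynomials in the affine coordinates are functions on `U_i`. Constants must be cut off outside
`U_i`, in accordance with the convention that sections are extended by zero. -/
theorem exists_section_of_mem_coordAlgebra {i : Fin (n + 1)} (hi : F.lift 0 i ≠ 0) {w : PS n}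
    (hw : w ∈ F.coordAlgebra i) : ∃ g ∈ sections 0 (chart n i), F.pull g = w := by
  have hV := (chart n i).isOpen
  have h0 : F.lift 0 ∈ (chart n i).carrier := hi
  induction hw using Algebra.adjoin_induction with
  | mem x hx =>
    obtain ⟨j, rfl⟩ := hx
    exact ⟨_, affineCoord_mem i j, rfl⟩
  | algebraMap r =>
    classical
    refine ⟨fun z => if z i ≠ 0 then r else 0, ⟨?_, fun a ha z hz => ?_, fun z hz => if_neg hz⟩, ?_⟩
    · exact (differentiableOn_const r).congr fun z hz => if_pos hz
    · have h1 : (a • z) i ≠ 0 := (chart n i).smul_mem a ha z hz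
      have h2 : z i ≠ 0 := hz
      simp only [h1, h2, ne_eq, not_false_eq_true, if_true, zpow_zero, one_mul]
    · exact (F.pull_congr hV h0 (g := fun _ => r) fun z hz => if_pos hz).trans (taylor_const r)
  | add x y _ _ hx hy =>
    obtain ⟨f, hf, rfl⟩ := hx
    obtain ⟨g, hg, rfl⟩ := hy
    exact ⟨f + g, Submodule.add_mem _ hf hg, F.pull_add hV hf.1 hg.1 h0⟩
  | mul x y _ _ hx hy =>
    obtain ⟨f, hf, rfl⟩ := hx
    obtain ⟨g, hg, rfl⟩ := hy
    refine ⟨fun z => f z * g z, ⟨hf.1.mul hg.1, fun a ha z hz => ?_, fun z hz => ?_⟩,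
      F.pull_mul hV hf.1 hg.1 h0⟩
    · simp only [hf.2.1 a ha z hz, hg.2.1 a ha z hz, zpow_zero, one_mul]
    · simp only [hf.2.2 z hz, zero_mul]

/-- The differentials of the affine coordinates span the cotangent space at the centre, so some
linear combination of them, with constants subtracted, agrees with `X k` to first order. -/
theorem exists_coordinates {i : Fin (n + 1)} (hi : F.lift 0 i ≠ 0) (k : Fin n) :
    ∃ w ∈ F.coordAlgebra i, VanTo 2 (X k - w) := by
  classical
  have hV := (chart n i).isOpen
  have h0 : F.lift 0 ∈ (chart n i).carrier := hi
  set u : Fin (n + 1) → PS n := fun j => F.pull (affineCoord i j) with hu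
  have hul : ∀ j, u j * F.liftPS i = F.liftPS j := fun j => by
    have h1 := F.pull_mul hV (affineCoord_mem i j).1
      (g := fun z => z i) (by fun_prop) h0
    refine h1.symm.trans (F.pull_congr hV h0 (g := fun z => z j) fun z hz => ?_)
    have : z i ≠ 0 := hz
    simp [affineCoord, this]
  set B : Matrix (Fin (n + 1)) (Fin n) ℂ :=
    Matrix.of fun j k => constantCoeff (MvPowerSeries.pderiv ℂ k (u j)) with hB
  have hinj : Function.Injective B.mulVecLin := by
    rw [← LinearMap.ker_eq_bot, LinearMap.ker_eq_bot']
    intro v hv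
    set s := ∑ k, constantCoeff (MvPowerSeries.pderiv ℂ k (F.liftPS i)) * v k with hs
    -- If all affine coordinates are stationary along `v`, the homogeneous ones change in proportion
    -- to the lift; the first entry of `a` compensates this change and gives a relation between the
    -- columns of `jac`.
    set a : Fin (n + 1) → ℂ := Fin.cons (-s / F.lift 0 i) v with ha
    have hmul : (constantCoeff.mapMatrix F.jac).mulVec a = 0 := by
      funext j
      have hj : ∑ k, constantCoeff (MvPowerSeries.pderiv ℂ k (u j)) * v k = 0 := by
        simpa [hB, Matrix.mulVec, dotProduct] using congrFun hv j
      have hk : ∀ k, constantCoeff (MvPowerSeries.pderiv ℂ k (F.liftPS j)) =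
          constantCoeff (u j) * constantCoeff (MvPowerSeries.pderiv ℂ k (F.liftPS i)) +
            F.lift 0 i * constantCoeff (MvPowerSeries.pderiv ℂ k (u j)) := fun k => by
        rw [← hul j, Derivation.leibniz, map_add, smul_eq_mul, smul_eq_mul, map_mul, map_mul,
          constantCoeff_liftPS]
      rw [Matrix.mulVec, dotProduct, Fin.sum_univ_succ]
      simp only [RingHom.mapMatrix_apply, Matrix.map_apply, jac, Matrix.of_apply, Fin.cons_zero,
        Fin.cons_succ, ha, constantCoeff_liftPS, Pi.zero_apply, hk, add_mul,
        Finset.sum_add_distrib, mul_assoc, ← Finset.mul_sum, hj, ← hs]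
      rw [hu, constantCoeff_pull, affineCoord]
      field_simp
      ring
    have ha0 : a = 0 := by
      by_contra hne
      have := Matrix.exists_mulVec_eq_zero_iff.1 ⟨a, hne, hmul⟩
      rw [← RingHom.map_det] at this
      exact F.constantCoeff_det_jac this
    funext k
    have := congrFun ha0 k.succ
    simpa [ha] using this
  obtain ⟨M, hM⟩ := LinearMap.exists_leftInverse_of_injective B.mulVecLin
    (LinearMap.ker_eq_bot.2 hinj)
  -- The `k`-th row of a left inverse of the Jacobian matrix supplies the coefficients of the
  -- combination.
  set m : Fin (n + 1) → ℂ := fun j => M (Pi.single j 1) k with hm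
  have hMk : ∀ v, M v k = ∑ j, m j * v j := fun v => by
    conv_lhs => rw [← Finset.univ_sum_single v]
    rw [map_sum, Finset.sum_apply]
    refine Finset.sum_congr rfl fun j _ => ?_
    have : (Pi.single j (v j) : Fin (n + 1) → ℂ) = v j • Pi.single j 1 := by
      rw [← Pi.single_smul, smul_eq_mul, mul_one]
    rw [this, map_smul, Pi.smul_apply, smul_eq_mul, mul_comm]
  refine ⟨∑ j, m j • (u j - algebraMap ℂ (PS n) (constantCoeff (u j))), ?_, ?_⟩
  · exact Subalgebra.sum_mem _ fun j _ => Subalgebra.smul_mem _ (Subalgebra.sub_mem _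
      (Algebra.subset_adjoin (Set.mem_range_self j)) (Subalgebra.algebraMap_mem _ _)) _
  · intro α hα
    rcases Nat.lt_succ_iff_lt_or_eq.1 hα with h | h
    · have : α = 0 := by
        rw [← Finsupp.degree_eq_zero_iff]
        omega
      subst this
      simp [MvPowerSeries.algebraMap_apply]
    · obtain ⟨l, rfl⟩ : ∃ l, α = Finsupp.single l 1 := by
        obtain ⟨β, l, rfl⟩ := exists_add_single (α := α) (by rintro rfl; simp at h)
        rw [map_add, Finsupp.degree_single, Nat.add_eq_right, Finsupp.degree_eq_zero_iff] at h
        exact ⟨l, by rw [h, zero_add]⟩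
      have h1 : ∀ g : PS n, coeff (Finsupp.single l 1) g =
          constantCoeff (MvPowerSeries.pderiv ℂ l g) := fun g => by
        rw [← coeff_zero_eq_constantCoeff_apply, coeff_pderiv]
        simp
      have h2 := congrFun (congrArg (fun T : (Fin n → ℂ) →ₗ[ℂ] (Fin n → ℂ) => T (Pi.single l 1)) hM) k
      simp only [LinearMap.comp_apply, hMk, LinearMap.id_apply, Matrix.mulVecLin_apply] at h2
      simp only [hB, Matrix.mulVec_single_one, Matrix.col_apply, Matrix.of_apply] at h2
      have h3 : ∀ r : ℂ, MvPowerSeries.pderiv ℂ l (algebraMap ℂ (PS n) r) = 0 :=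
        Derivation.map_algebraMap _
      have h4 : ∀ (r : ℂ) (g : PS n), constantCoeff (MvPowerSeries.pderiv ℂ l (r • g)) =
          r * constantCoeff (MvPowerSeries.pderiv ℂ l g) := fun r g => by
        rw [← h1, ← h1, map_smul, smul_eq_mul]
      simp only [map_sub, map_sum, h1, h4, h3, h2, sub_zero]
      rw [MvPowerSeries.pderiv_X, Pi.single_apply, Pi.single_apply]
      by_cases hlk : l = k
      · subst hlk
        simp
      · simp [Ne.symm hlk]

theorem exists_lift_ne_zero : ∃ i, F.lift 0 i ≠ 0 := by
  by_contra! h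
  exact F.lift_zero_ne_zero (funext h)

/-- An operator that annihilates the expansions of all local sections vanishes. -/
theorem eq_zero_of_expand (d : ℤ) {k : ℕ} {Z : Module.End ℂ (PS n)} (hZ : ContOrd k Z)
    (h : ∀ (V : ConicOpen n) (f : sections d V), F.lift 0 ∈ V.carrier → Z (F.expand f.1) = 0) :
    Z = 0 := by
  obtain ⟨i, hi⟩ := F.exists_lift_ne_zero
  have hV := (chart n i).isOpen
  have h0 : F.lift 0 ∈ (chart n i).carrier := hi
  -- With `e` the expansion of the section `z_i ^ d`, every product `e * w` is the expansion of a
  -- section of `O(d)` over `U_i`.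
  refine eq_zero_of_dense (e := F.trivPS * F.pull fun z => z i ^ d) ?_ (F.exists_coordinates hi) hZ
    fun w hw => ?_
  · rw [map_mul, constantCoeff_pull]
    exact mul_ne_zero F.constantCoeff_trivPS (zpow_ne_zero d hi)
  · obtain ⟨g, hg, rfl⟩ := F.exists_section_of_mem_coordAlgebra hi hw
    rw [mul_assoc, ← F.pull_mul hV (differentiableOn_zpow d i) hg.1 h0,
      ← F.expand_eq hV (zpow_mul_mem d hg).1 h0]
    exact h (chart n i) ⟨_, zpow_mul_mem d hg⟩ h0

/-- This gives uniqueness of expressions and of velocities, and thereby all their algebraic rules.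
-/
theorem eq_of_expand (d : ℤ) {P Q : Dif n}
    (h : ∀ (V : ConicOpen n) (f : sections d V), F.lift 0 ∈ V.carrier →
      P.1 (F.expand f.1) = Q.1 (F.expand f.1)) : P = Q := by
  obtain ⟨k, hk⟩ := Dif.exists_hasOrd (P - Q)
  have := F.eq_zero_of_expand d hk.contOrd fun V f h0 => by
    simp [h V f h0]
  exact sub_eq_zero.1 (Subtype.ext this)

end Frame

end Uniqueness

/-! ### Global differential operators in a coordinate system -/

section Expressions

open MvPowerSeries

variable {n : ℕ} {d : ℤ}

/-- `P F` is the expression of `D` in the coordinate system `F`, of order at most `k`; it depends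
regularly on `F`. -/
structure ChartExpr {i : Fin (n + 1)} (D : ChartOpFamily n d i) (k : ℕ) (P : Frame n → Dif n) :
    Prop where
  hasOrd : ∀ F, HasOrd k (P F).1
  expand : ∀ F V (f : sections d V.1), F.lift 0 ∈ V.1.carrier →
    (P F).1 (F.expand f.1) = F.expand (D V f).1
  reg : ∀ (X : Type) (c : RegClass X) (G : X → Frame n), RegFrame c G →
    (G c.base).lift 0 i ≠ 0 → RegOp c fun q => (P (G q)).1

theorem RegOp.mulLeft {X : Type} {c : RegClass X} {a : X → PS n} (ha : RegPS c a) :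
    RegOp c fun q => LinearMap.mulLeft ℂ (a q) := fun _ hf => ha.mul hf

theorem RegOp.mul {X : Type} {c : RegClass X} {P Q : X → Module.End ℂ (PS n)} (hP : RegOp c P)
    (hQ : RegOp c Q) : RegOp c fun q => P q * Q q := fun _ hf => hP _ (hQ _ hf)

theorem RegOp.add {X : Type} {c : RegClass X} {P Q : X → Module.End ℂ (PS n)} (hP : RegOp c P)
    (hQ : RegOp c Q) : RegOp c fun q => P q + Q q := fun f hf => (hP f hf).add (hQ f hf)

/-- Induction over the generators: a function expands to multiplication by its pullback, and `z_i
∂/∂z_k` to a multiple of `vectorOp` for a constant vector field. The order bound and the regularity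
are carried along because they concern all coordinate systems at once. -/
theorem exists_chartExpr {i : Fin (n + 1)} {D : ChartOpFamily n d i} (hD : D ∈ chartOps n d i) :
    ∃ k P, ChartExpr D k P := by
  induction hD using Algebra.adjoin_induction with
  | mem D hD =>
    rcases hD with ⟨a, ha, h⟩ | ⟨k, h⟩
    · refine ⟨0, fun F => Dif.mulOp (F.pull a), fun F => HasOrd.mulLeft _, fun F V f h0 => ?_,
        fun X c G hG h0 => RegOp.mulLeft (hG.pull (chart n i).isOpen ha.1 h0)⟩
      rw [F.expand_congr V.1.isOpen h0 (h V f), F.expand_eq V.1.isOpen f.2.1 h0,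
        F.expand_eq V.1.isOpen ((ha.1.mono V.2).fun_mul f.2.1) h0,
        F.pull_mul V.1.isOpen (ha.1.mono V.2) f.2.1 h0]
      exact mul_left_comm _ _ _
    · refine ⟨1, fun F => Dif.mulOp (F.liftPS i) * F.vectorOp d (Pi.single k 1), fun F => ?_,
        fun F V f h0 => ?_, fun X c G hG h0 => ?_⟩
      · have := (HasOrd.mulLeft (F.liftPS i)).mul (F.hasOrd_vectorOp d (Pi.single k 1))
        rwa [zero_add] at this
      · have hp := differentiableOn_partialDeriv V.1.isOpen f.2.1 k
        have hi : DifferentiableOn ℂ (fun z : Fin (n + 1) → ℂ => z i) V.1.carrier := by fun_prop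
        rw [F.expand_congr V.1.isOpen h0 (g := fun z => z i * partialDeriv k f.1 z) (h V f),
          F.expand_eq V.1.isOpen (hi.fun_mul hp) h0, F.pull_mul V.1.isOpen hi hp h0]
        change F.liftPS i * (F.vectorOp d (Pi.single k 1)).1 (F.expand f.1) = _
        rw [F.vectorOp_expand V.1.isOpen f.2.1 h0 f.2.2.1]
        have : ∑ j, F.pull (partialDeriv j f.1) * (Pi.single k 1 : Fin (n + 1) → PS n) j =
            F.pull (partialDeriv k f.1) := by
          rw [Finset.sum_eq_single_of_mem k (Finset.mem_univ k)]
          · simp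
          · intro j _ hj
            simp [hj]
        rw [this, mul_left_comm]
        rfl
      · exact (RegOp.mulLeft (hG.lift i)).mul (hG.vectorOp d fun j => RegPS.const c _)
  | algebraMap r =>
    refine ⟨0, fun _ => Dif.mulOp (C r), fun F => HasOrd.mulLeft _, fun F V f h0 => ?_,
      fun X c G hG h0 => RegOp.mulLeft (RegPS.const c _)⟩
    have h1 : (algebraMap ℂ (ChartOpFamily n d i) r V f).1 = fun z => r * f.1 z := rfl
    rw [h1, F.expand_eq V.1.isOpen f.2.1 h0,
      F.expand_eq V.1.isOpen ((differentiableOn_const r).fun_mul f.2.1) h0,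
      F.pull_mul V.1.isOpen (differentiableOn_const r) f.2.1 h0]
    change C r * _ = _
    rw [mul_left_comm]
    congr 2
    exact (taylor_const r).symm
  | add D D' _ _ h h' =>
    obtain ⟨k, P, hP⟩ := h
    obtain ⟨k', P', hP'⟩ := h'
    refine ⟨max k k', fun F => P F + P' F, fun F => ?_, fun F V f h0 => ?_,
      fun X c G hG h0 => (hP.reg X c G hG h0).add (hP'.reg X c G hG h0)⟩
    · exact ((hP.hasOrd F).mono (le_max_left _ _)).add ((hP'.hasOrd F).mono (le_max_right _ _))
    · have h1 : ((D + D') V f).1 = fun z => (D V f).1 z + (D' V f).1 z := rfl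
      rw [h1, F.expand_eq V.1.isOpen ((D V f).2.1.fun_add (D' V f).2.1) h0,
        F.pull_add V.1.isOpen (D V f).2.1 (D' V f).2.1 h0, mul_add,
        ← F.expand_eq V.1.isOpen (D V f).2.1 h0, ← F.expand_eq V.1.isOpen (D' V f).2.1 h0,
        ← hP.expand F V f h0, ← hP'.expand F V f h0]
      rfl
  | mul D D' _ _ h h' =>
    obtain ⟨k, P, hP⟩ := h
    obtain ⟨k', P', hP'⟩ := h'
    refine ⟨k + k', fun F => P F * P' F, fun F => (hP.hasOrd F).mul (hP'.hasOrd F),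
      fun F V f h0 => ?_, fun X c G hG h0 => (hP.reg X c G hG h0).mul (hP'.reg X c G hG h0)⟩
    change (P F).1 ((P' F).1 _) = F.expand (D V (D' V f)).1
    rw [hP'.expand F V f h0, hP.expand F V _ h0]

/-- The part of an open set in the chart `U_i`. -/
def ConicOpen.inter (V : ConicOpen n) (i : Fin (n + 1)) : ConicOpen n where
  carrier := V.carrier ∩ (chart n i).carrier
  isOpen := V.isOpen.inter (chart n i).isOpen
  zero_notMem h := V.zero_notMem h.1
  smul_mem a ha z hz := ⟨V.smul_mem a ha z hz.1, (chart n i).smul_mem a ha z hz.2⟩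

open Classical in
/-- Restriction of sections to the chart `U_i`. -/
def restrictChart {V : ConicOpen n} (f : sections d V) (i : Fin (n + 1)) :
    sections d (V.inter i) :=
  ⟨fun z => if z ∈ (V.inter i).carrier then f.1 z else 0,
    (f.2.1.mono Set.inter_subset_left).congr fun _ hz => if_pos hz,
    fun a ha z hz => by
      beta_reduce
      rw [if_pos hz, if_pos ((V.inter i).smul_mem a ha z hz), f.2.2.1 a ha z hz.1],
    fun _ hz => if_neg hz⟩

/-- Expansions see only the germ at the centre, so an arbitrary section may be restricted to `U_i`;
compatibility of `D` with restriction does the rest. -/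
theorem Frame.isExpression_of_chartExpr (F : Frame n) (D : DifProj n d) {i : Fin (n + 1)}
    (hi : F.lift 0 i ≠ 0) {k : ℕ} {P : Frame n → Dif n}
    (hP : ChartExpr (fun V => D.1 V.1 : ChartOpFamily n d i) k P) : F.IsExpression D (P F) := by
  intro V f h0
  have h0' : F.lift 0 ∈ (V.inter i).carrier := ⟨h0, hi⟩
  have hr : ∀ z ∈ (V.inter i).carrier, f.1 z = (restrictChart f i).1 z := fun z hz =>
    (if_pos hz).symm
  rw [F.expand_congr (V.inter i).isOpen h0' hr, F.expand_congr (V.inter i).isOpen h0'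
    (D.2.1 V (V.inter i) Set.inter_subset_left f (restrictChart f i) hr)]
  exact hP.expand F ⟨V.inter i, Set.inter_subset_right⟩ _ h0'

theorem Frame.exists_isExpression (F : Frame n) (D : DifProj n d) :
    ∃ P, F.IsExpression D P := by
  obtain ⟨i, hi⟩ := F.exists_lift_ne_zero
  obtain ⟨k, P, hP⟩ := exists_chartExpr (D.2.2 i)
  exact ⟨P F, F.isExpression_of_chartExpr D hi hP⟩

/-- The expression of a global differential operator in a coordinate system. -/
def Frame.exprOp (F : Frame n) (D : DifProj n d) : Dif n := (F.exists_isExpression D).choose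

theorem Frame.isExpression_exprOp (F : Frame n) (D : DifProj n d) :
    F.IsExpression D (F.exprOp D) := (F.exists_isExpression D).choose_spec

theorem Frame.IsExpression.eq {F : Frame n} {D : DifProj n d} {P : Dif n}
    (h : F.IsExpression D P) : P = F.exprOp D :=
  F.eq_of_expand d fun V f h0 => (h V f h0).trans (F.isExpression_exprOp D V f h0).symm

/-- Every centre lies in one of the finitely many charts, and the bound in each chart does not
depend on the coordinate system. The uniformity in `F` lets continuity and stability be used along
whole families. -/
theorem exists_hasOrd_exprOp (D : DifProj n d) : ∃ k, ∀ F : Frame n, HasOrd k (F.exprOp D).1 := by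
  choose k P hP using fun i => exists_chartExpr (D.2.2 i)
  refine ⟨Finset.univ.sup k, fun F => ?_⟩
  obtain ⟨i, hi⟩ := F.exists_lift_ne_zero
  rw [← (F.isExpression_of_chartExpr D hi (hP i)).eq]
  exact ((hP i).hasOrd F).mono (Finset.le_sup (Finset.mem_univ i))

/-- The chart of the base point serves for all nearby parameters, and by uniqueness the chosen
expression coincides with the explicit regular one there. -/
theorem RegFrame.exprOp {X : Type} {c : RegClass X} {G : X → Frame n} (hG : RegFrame c G)
    (D : DifProj n d) : RegOp c fun q => ((G q).exprOp D).1 := by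
  obtain ⟨i, hi⟩ := (G c.base).exists_lift_ne_zero
  obtain ⟨k, P, hP⟩ := exists_chartExpr (D.2.2 i)
  refine (hP.reg X c G hG hi).congr ((hG.eventually_mem (chart n i).isOpen hi).mono fun q hq => ?_)
  exact congrArg Subtype.val ((G q).isExpression_of_chartExpr D hq hP).eq

namespace Frame

variable (F : Frame n)

theorem exprOp_add (D D' : DifProj n d) : F.exprOp (D + D') = F.exprOp D + F.exprOp D' := by
  refine (IsExpression.eq fun V f h0 => ?_).symm
  have h1 : ((D + D').1 V f).1 = fun z => (D.1 V f).1 z + (D'.1 V f).1 z := rfl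
  rw [h1, F.expand_eq V.isOpen ((D.1 V f).2.1.fun_add (D'.1 V f).2.1) h0,
    F.pull_add V.isOpen (D.1 V f).2.1 (D'.1 V f).2.1 h0, mul_add,
    ← F.expand_eq V.isOpen (D.1 V f).2.1 h0, ← F.expand_eq V.isOpen (D'.1 V f).2.1 h0,
    ← F.isExpression_exprOp D V f h0, ← F.isExpression_exprOp D' V f h0]
  rfl

theorem exprOp_smul (r : ℂ) (D : DifProj n d) : F.exprOp (r • D) = r • F.exprOp D := by
  refine (IsExpression.eq fun V f h0 => ?_).symm
  have h1 : ((r • D).1 V f).1 = fun z => r * (D.1 V f).1 z := rfl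
  have h2 := F.pull_mul V.isOpen (differentiableOn_const r) (D.1 V f).2.1 h0
  have h3 : F.pull (fun _ => r) = C r := taylor_const r
  rw [h1, F.expand_eq V.isOpen ((differentiableOn_const r).fun_mul (D.1 V f).2.1) h0, h2, h3,
    mul_left_comm, ← F.expand_eq V.isOpen (D.1 V f).2.1 h0, ← F.isExpression_exprOp D V f h0,
    ← smul_eq_C_mul]
  rfl

theorem exprOp_mul (D D' : DifProj n d) : F.exprOp (D * D') = F.exprOp D * F.exprOp D' := by
  refine (IsExpression.eq fun V f h0 => ?_).symm
  change (F.exprOp D).1 ((F.exprOp D').1 _) = F.expand (D.1 V (D'.1 V f)).1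
  rw [F.isExpression_exprOp D' V f h0, F.isExpression_exprOp D V _ h0]

theorem exprOp_zero : F.exprOp (0 : DifProj n d) = 0 := by
  have := F.exprOp_smul (d := d) 0 0
  simpa using this

/-- The expression of operators as a linear map. -/
def exprLin (d : ℤ) : DifProj n d →ₗ[ℂ] Dif n where
  toFun := F.exprOp
  map_add' := F.exprOp_add
  map_smul' := F.exprOp_smul

end Frame

theorem Frame.Equiv.lift_mem {F F' : Frame n} (h : F.Equiv d F') {V : ConicOpen n}
    (h0 : F.lift 0 ∈ V.carrier) : F'.lift 0 ∈ V.carrier := by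
  obtain ⟨a, ha⟩ := h
  obtain ⟨h1, h2, -⟩ := ha.self_of_nhds
  rw [h2]
  exact V.smul_mem _ h1 _ h0

/-- Rescaling the lift by `c` multiplies a section by `c ^ d`, which the change of trivialization
undoes. -/
theorem Frame.Equiv.expand_eq {F F' : Frame n} (h : F.Equiv d F') {V : ConicOpen n}
    (h0 : F.lift 0 ∈ V.carrier) {f : (Fin (n + 1) → ℂ) → ℂ} (hf : f ∈ sections d V) :
    F.expand f = F'.expand f := by
  obtain ⟨a, ha⟩ := h
  refine taylor_congr ?_
  filter_upwards [ha, F.eventually_lift_mem V.isOpen h0] with x hx hV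
  rw [hx.2.1, hx.2.2, hf.2.1 _ hx.1 _ hV]
  ring

theorem Frame.Equiv.symm {F F' : Frame n} (h : F.Equiv d F') : F'.Equiv d F := by
  obtain ⟨a, ha⟩ := h
  refine ⟨fun x => (a x)⁻¹, ?_⟩
  filter_upwards [ha] with x hx
  refine ⟨inv_ne_zero hx.1, ?_, ?_⟩
  · rw [hx.2.1, smul_smul, inv_mul_cancel₀ hx.1, one_smul]
  · rw [hx.2.2, ← mul_assoc, ← mul_zpow, inv_mul_cancel₀ hx.1, one_zpow, one_mul]

theorem Frame.Equiv.lift_mem_iff {F F' : Frame n} (h : F.Equiv d F') {V : ConicOpen n} :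
    F.lift 0 ∈ V.carrier ↔ F'.lift 0 ∈ V.carrier := ⟨h.lift_mem, h.symm.lift_mem⟩

theorem Frame.Equiv.exprOp_eq {F F' : Frame n} (h : F.Equiv d F') (D : DifProj n d) :
    F.exprOp D = F'.exprOp D := by
  refine Frame.IsExpression.eq fun V f h0 => ?_
  have h0' := h.symm.lift_mem h0
  rw [← h.expand_eq h0' f.2, ← h.expand_eq h0' (D.1 V f).2]
  exact F.isExpression_exprOp D V f h0'

end Expressions

/-! ### Derivatives of families of power series -/

section Derivatives

open MvPowerSeries

variable {n : ℕ} {E : Type} [NormedAddCommGroup E] [NormedSpace ℝ E] {S : Set E} {y v : E}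

/-- The coefficientwise derivative of a family of power series. -/
def dPS (S : Set E) (y v : E) (h : E → PS n) : PS n :=
  fun α => fderivWithin ℝ (fun q => coeff α (h q)) S y v

theorem coeff_dPS (h : E → PS n) (α : Fin n →₀ ℕ) :
    coeff α (dPS S y v h) = fderivWithin ℝ (fun q => coeff α (h q)) S y v := rfl

theorem dPS_congr {h h' : E → PS n} (hy : y ∈ S) (hh : h =ᶠ[𝓝[S] y] h') :
    dPS S y v h = dPS S y v h' := by
  ext α
  rw [coeff_dPS, coeff_dPS]
  have : (fun q => coeff α (h q)) =ᶠ[𝓝[S] y] fun q => coeff α (h' q) :=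
    hh.mono fun _ hq => congrArg (coeff α) hq
  rw [this.fderivWithin_eq (this.self_of_nhdsWithin hy)]

theorem RegPS.differentiableWithinAt {hy : y ∈ S} {h : E → PS n}
    (hh : RegPS (smoothClass S hy) h) (α : Fin n →₀ ℕ) :
    DifferentiableWithinAt ℝ (fun q => coeff α (h q)) S y :=
  ContDiffWithinAt.differentiableWithinAt (n := ∞) (hh α) (by simp)

variable {hy : y ∈ S} {h g : E → PS n}

theorem dPS_pderiv (hu : UniqueDiffWithinAt ℝ S y) (hh : RegPS (smoothClass S hy) h)
    (i : Fin n) : dPS S y v (fun q => pderiv ℂ i (h q)) = pderiv ℂ i (dPS S y v h) := by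
  ext α
  simp only [coeff_dPS, coeff_pderiv]
  rw [fderivWithin_mul_const hu (hh.differentiableWithinAt _)]
  simp [mul_comm]

theorem dPS_mul (hu : UniqueDiffWithinAt ℝ S y) (hh : RegPS (smoothClass S hy) h)
    (hg : RegPS (smoothClass S hy) g) :
    dPS S y v (fun q => h q * g q) = dPS S y v h * g y + h y * dPS S y v g := by
  classical
  ext α
  simp only [coeff_dPS, map_add, coeff_mul]
  rw [fderivWithin_fun_sum hu fun p _ =>
    (hh.differentiableWithinAt p.1).fun_mul (hg.differentiableWithinAt p.2),
    sum_apply, ← Finset.sum_add_distrib]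
  refine Finset.sum_congr rfl fun p _ => ?_
  rw [fderivWithin_fun_mul hu (hh.differentiableWithinAt p.1) (hg.differentiableWithinAt p.2)]
  simp only [add_apply, smul_apply, smul_eq_mul]
  ring

theorem dPS_sum {ι : Type*} {s : Finset ι} (hu : UniqueDiffWithinAt ℝ S y) {h : ι → E → PS n}
    (hh : ∀ i ∈ s, RegPS (smoothClass S hy) (h i)) :
    dPS S y v (fun q => ∑ i ∈ s, h i q) = ∑ i ∈ s, dPS S y v (h i) := by
  ext α
  simp only [coeff_dPS, map_sum]
  rw [fderivWithin_fun_sum hu fun i hi => (hh i hi).differentiableWithinAt α,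
    sum_apply]

theorem vanTo_succ {J : ℕ} {f : PS n} (h0 : constantCoeff f = 0)
    (h : ∀ i, VanTo J (pderiv ℂ i f)) : VanTo (J + 1) f := by
  intro α hα
  by_cases hz : α = 0
  · rw [hz]
    exact h0
  · obtain ⟨β, i, rfl⟩ := exists_add_single hz
    rw [map_add, Finsupp.degree_single] at hα
    rw [coeff_add_single, h i β (by omega), mul_zero]

/-- The chain rule in the parameter. The difference of the two sides has zero constant term by the
ordinary chain rule, and its formal partial derivatives are combinations of the analogous
differences for the `∂_j f`; so it vanishes to every order. -/
theorem dPS_pull {G : E → Frame n} (hu : UniqueDiffWithinAt ℝ S y)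
    (hG : RegFrame (smoothClass S hy) G) {V : Set (Fin (n + 1) → ℂ)} (hV : IsOpen V)
    {f : (Fin (n + 1) → ℂ) → ℂ} (hf : DifferentiableOn ℂ f V) (h0 : (G y).lift 0 ∈ V) :
    dPS S y v (fun q => (G q).pull f) =
      ∑ j, (G y).pull (partialDeriv j f) * dPS S y v (fun q => (G q).liftPS j) := by
  have hev : ∀ᶠ q in 𝓝[S] y, (G q).lift 0 ∈ V := hG.eventually_mem hV h0
  set L : Fin (n + 1) → PS n := fun j => dPS S y v (fun q => (G q).liftPS j) with hL
  suffices ∀ J, VanTo J (dPS S y v (fun q => (G q).pull f) -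
      ∑ j, (G y).pull (partialDeriv j f) * L j) from sub_eq_zero.1 (VanTo.eq_zero this)
  intro J
  induction J generalizing f with
  | zero => exact VanTo.of_zero _
  | succ J ih =>
    refine vanTo_succ ?_ fun i => ?_
    · have hl : ∀ (q : E) j, coeff 0 ((G q).liftPS j) = (G q).lift 0 j := fun q j =>
        (G q).constantCoeff_liftPS j
      have hp : ∀ (q : E) g, coeff 0 ((G q).pull g) = g ((G q).lift 0) := fun q g =>
        (G q).constantCoeff_pull g
      have hd : ∀ j, HasFDerivWithinAt (fun q => (G q).lift 0 j)
          (fderivWithin ℝ (fun q => (G q).lift 0 j) S y) S y := fun j =>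
        (DifferentiableWithinAt.hasFDerivWithinAt (by
          simpa only [hl] using (hG.lift j).differentiableWithinAt 0))
      have hd' := hasFDerivWithinAt_pi.2 hd
      have hf' : HasFDerivAt f ((fderiv ℂ f ((G y).lift 0)).restrictScalars ℝ) ((G y).lift 0) :=
        ((hf _ h0).differentiableAt (hV.mem_nhds h0)).hasFDerivAt.restrictScalars ℝ
      have hc := (hf'.comp_hasFDerivWithinAt y hd').fderivWithin hu
      rw [map_sub, sub_eq_zero, map_sum]
      simp only [map_mul]
      simp only [← coeff_zero_eq_constantCoeff, hL, coeff_dPS, hl, hp]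
      have hc' := congrArg (fun L => L v) hc
      refine Eq.trans hc' ?_
      exact fderiv_eq_sum_partialDeriv f _ _
    · have hpd := fun j => hG.pull hV (differentiableOn_partialDeriv hV hf j) h0
      have h1 : ∀ j, dPS S y v (fun q => (G q).pull (partialDeriv j f) *
            pderiv ℂ i ((G q).liftPS j)) =
          dPS S y v (fun q => (G q).pull (partialDeriv j f)) * pderiv ℂ i ((G y).liftPS j) +
            (G y).pull (partialDeriv j f) * pderiv ℂ i (L j) := by
        intro j
        rw [dPS_mul hu (hpd j) ((hG.lift j).pderiv i), dPS_pderiv hu (hG.lift j)]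
      have h2 : ∀ j k, (G y).pull (partialDeriv k (partialDeriv j f)) =
          (G y).pull (partialDeriv j (partialDeriv k f)) := fun j k =>
        (G y).pull_congr hV h0 fun z hz => partialDeriv_comm_apply (by
          filter_upwards [hV.mem_nhds hz] with w hw
          exact (hf w hw).differentiableAt (hV.mem_nhds hw)) _ _
      have h3 : ∀ j, pderiv ℂ i ((G y).pull (partialDeriv j f)) =
          ∑ k, (G y).pull (partialDeriv k (partialDeriv j f)) * pderiv ℂ i ((G y).liftPS k) :=
        fun j => (G y).pderiv_pull hV (differentiableOn_partialDeriv hV hf j) h0 i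
      have key : pderiv ℂ i (dPS S y v (fun q => (G q).pull f) -
            ∑ j, (G y).pull (partialDeriv j f) * L j) =
          ∑ j, pderiv ℂ i ((G y).liftPS j) * (dPS S y v (fun q => (G q).pull (partialDeriv j f)) -
            ∑ k, (G y).pull (partialDeriv k (partialDeriv j f)) * L k) := by
        rw [map_sub, ← dPS_pderiv hu (hG.pull hV hf h0),
          dPS_congr hy (hev.mono fun q hq => (G q).pderiv_pull hV hf hq i),
          dPS_sum hu fun j _ => (hpd j).mul ((hG.lift j).pderiv i), map_sum]
        simp only [h1, Derivation.leibniz, smul_eq_mul, Finset.sum_add_distrib, h3, mul_sub,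
          Finset.mul_sum, Finset.sum_sub_distrib]
        have h4 : ∑ j, ∑ k, L j * ((G y).pull (partialDeriv k (partialDeriv j f)) *
              pderiv ℂ i ((G y).liftPS k)) =
            ∑ j, ∑ k, pderiv ℂ i ((G y).liftPS j) *
              ((G y).pull (partialDeriv k (partialDeriv j f)) * L k) := by
          rw [Finset.sum_comm]
          refine Finset.sum_congr rfl fun j _ => Finset.sum_congr rfl fun k _ => ?_
          rw [h2]
          ring
        rw [h4]
        have h5 : ∀ j, dPS S y v (fun q => (G q).pull (partialDeriv j f)) *
            pderiv ℂ i ((G y).liftPS j) = pderiv ℂ i ((G y).liftPS j) *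
              dPS S y v (fun q => (G q).pull (partialDeriv j f)) := fun j => mul_comm _ _
        simp only [h5]
        ring
      rw [key]
      exact VanTo.sum fun j _ => VanTo.mul_left _ (ih (differentiableOn_partialDeriv hV hf j))

end Derivatives

/-! ### Velocities of smooth families of coordinate systems -/

section Velocity

open MvPowerSeries

variable {n : ℕ} {d : ℤ} {E : Type} [NormedAddCommGroup E] [NormedSpace ℝ E] {S : Set E}
  {Φ : E → Frame n} {y v : E}

/-- `τ` describes the infinitesimal change of the coordinate systems `Φ` at `y` in the direction
`v`. -/
structure IsVel (d : ℤ) (Φ : E → Frame n) (S : Set E) (y v : E) (τ : Dif n) : Prop where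
  hasOrd : HasOrd 1 τ.1
  apply_expand : ∀ (V : ConicOpen n) (f : sections d V), (Φ y).lift 0 ∈ V.carrier →
    τ.1 ((Φ y).expand f.1) = dPS S y v fun q => (Φ q).expand f.1

theorem IsVel.unique {τ τ' : Dif n} (h : IsVel d Φ S y v τ) (h' : IsVel d Φ S y v τ') : τ = τ' :=
  (Φ y).eq_of_expand d fun V f h0 => (h.apply_expand V f h0).trans (h'.apply_expand V f h0).symm

open Classical in
/-- The velocity of a family of coordinate systems. -/
def velOp (d : ℤ) (Φ : E → Frame n) (S : Set E) (y v : E) : Dif n :=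
  if h : ∃ τ, IsVel d Φ S y v τ then h.choose else 0

theorem IsVel.velOp_eq {τ : Dif n} (h : IsVel d Φ S y v τ) : velOp d Φ S y v = τ := by
  have hex : ∃ τ, IsVel d Φ S y v τ := ⟨τ, h⟩
  rw [velOp, dif_pos hex]
  exact hex.choose_spec.unique h

/-- The velocity computed from the Taylor coefficients. -/
def localVel (d : ℤ) (G : E → Frame n) (S : Set E) (y v : E) : Dif n :=
  (G y).vectorOp d (fun j => dPS S y v fun q => (G q).liftPS j) +
    Dif.mulOp (dPS S y v (fun q => (G q).trivPS) * (G y).trivPS⁻¹)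

/-- An expansion is the trivialization times a pullback. Its derivative has one term from the
variation of the lift, which is `vectorOp`, and one from the logarithmic derivative of the
trivialization. Equivalent families share their expansions, so the formula may be computed for `G`.
-/
theorem isVel_localVel {G : E → Frame n} {hy : y ∈ S} (hG : RegFrame (smoothClass S hy) G)
    (hE : ∀ᶠ q in 𝓝[S] y, (Φ q).Equiv d (G q)) (hu : UniqueDiffWithinAt ℝ S y) :
    IsVel d Φ S y v (localVel d G S y v) := by
  refine ⟨((G y).hasOrd_vectorOp d _).add ((HasOrd.mulLeft _).mono (by omega)),
    fun V f h0 => ?_⟩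
  have hEy := hE.self_of_nhdsWithin hy
  have h0' := hEy.lift_mem h0
  have hev : ∀ᶠ q in 𝓝[S] y, (G q).lift 0 ∈ V.carrier := hG.eventually_mem V.isOpen h0'
  have h1 : dPS S y v (fun q => (Φ q).expand f.1) =
      dPS S y v (fun q => (G q).trivPS * (G q).pull f.1) := by
    refine dPS_congr hy ?_
    filter_upwards [hE, hev] with q hq hq'
    rw [hq.expand_eq (hq.symm.lift_mem hq') f.2, (G q).expand_eq V.isOpen f.2.1 hq']
  rw [h1, dPS_mul hu hG.triv (hG.pull V.isOpen f.2.1 h0'), dPS_pull hu hG V.isOpen f.2.1 h0',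
    hEy.expand_eq h0 f.2]
  change ((G y).vectorOp d _).1 ((G y).expand f.1) + _ * _ * (G y).expand f.1 = _
  rw [(G y).vectorOp_expand V.isOpen f.2.1 h0' f.2.2.1, (G y).expand_eq V.isOpen f.2.1 h0']
  have hinv : (G y).trivPS⁻¹ * (G y).trivPS = 1 :=
    MvPowerSeries.inv_mul_cancel _ (G y).constantCoeff_trivPS
  linear_combination dPS S y v (fun q => (G q).trivPS) * (G y).pull f.1 * hinv

/-- Families of coordinate systems that locally are equivalent to families with smooth Taylor
coefficients. -/
def SmoothFamily (d : ℤ) (Φ : E → Frame n) (S : Set E) : Prop :=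
  ∀ y ∈ S, ∃ W, IsOpen W ∧ y ∈ W ∧ ∃ G : E → Frame n, (∀ q ∈ W ∩ S, (Φ q).Equiv d (G q)) ∧
    ∀ α, (∀ j, ContDiffOn ℝ ∞ (fun q => coeff α ((G q).liftPS j)) (W ∩ S)) ∧
      ContDiffOn ℝ ∞ (fun q => coeff α (G q).trivPS) (W ∩ S)

/-- A family is regular near `y` when it is equivalent to a regular family at all nearby points. -/
theorem SmoothFamily.exists_local (hΦ : SmoothFamily d Φ S) (hy : y ∈ S) :
    ∃ G : E → Frame n, ∀ᶠ q in 𝓝[S] y, (∀ᶠ q' in 𝓝[S] q, (Φ q').Equiv d (G q')) ∧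
      ∀ hq : q ∈ S, RegFrame (smoothClass S hq) G := by
  obtain ⟨W, hW, hyW, G, hE, hG⟩ := hΦ y hy
  refine ⟨G, ?_⟩
  filter_upwards [mem_nhdsWithin_of_mem_nhds (hW.mem_nhds hyW)] with q hqW
  have hnear : W ∩ S ∈ 𝓝[S] q := Filter.inter_mem (mem_nhdsWithin_of_mem_nhds (hW.mem_nhds hqW))
    self_mem_nhdsWithin
  refine ⟨Filter.mem_of_superset hnear hE, fun hq => ⟨fun j α => ?_, fun α => ?_⟩⟩
  · have := (hG α).1 j q ⟨hqW, hq⟩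
    rw [Set.inter_comm, contDiffWithinAt_inter (hW.mem_nhds hqW)] at this
    exact this
  · have := (hG α).2 q ⟨hqW, hq⟩
    rw [Set.inter_comm, contDiffWithinAt_inter (hW.mem_nhds hqW)] at this
    exact this

theorem SmoothFamily.isVel (hΦ : SmoothFamily d Φ S) (hS : UniqueDiffOn ℝ S) (hy : y ∈ S)
    (v : E) : IsVel d Φ S y v (velOp d Φ S y v) := by
  obtain ⟨G, hG⟩ := hΦ.exists_local hy
  obtain ⟨h1, h2⟩ := hG.self_of_nhdsWithin hy
  have := isVel_localVel (v := v) (h2 hy) h1 (hS y hy)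
  rwa [this.velOp_eq]

theorem RegPS.dPS {hy : y ∈ S} (hS : UniqueDiffOn ℝ S) {h : E → PS n}
    (hh : RegPS (smoothClass S hy) h) (v : E) :
    RegPS (smoothClass S hy) fun q => dPS S q v h := fun α => by
  have h1 : ContDiffWithinAt ℝ ∞ (fun q => coeff α (h q)) S y := hh α
  have h2 := h1.fderivWithin_right (m := ∞) hS (by simp) hy
  exact h2.clm_apply contDiffWithinAt_const

/-- `velOp` is a choice made separately at each point; by uniqueness it equals `localVel` of one
local representative near `y`, whose smoothness is visible. -/
theorem SmoothFamily.regOp_velOp (hΦ : SmoothFamily d Φ S) (hS : UniqueDiffOn ℝ S) (hy : y ∈ S)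
    (v : E) : RegOp (smoothClass S hy) fun q => (velOp d Φ S q v).1 := by
  obtain ⟨G, hG⟩ := hΦ.exists_local hy
  have hGy := (hG.self_of_nhdsWithin hy).2 hy
  have h1 : RegOp (smoothClass S hy) fun q => (localVel d G S q v).1 := by
    refine (hGy.vectorOp d fun j => (hGy.lift j).dPS hS v).add (RegOp.mulLeft ?_)
    exact (hGy.triv.dPS hS v).mul (hGy.triv.inv (G y).constantCoeff_trivPS)
  refine h1.congr ?_
  have h2 : ∀ᶠ q in 𝓝[S] y, localVel d G S q v = velOp d Φ S q v := by
    filter_upwards [hG, self_mem_nhdsWithin] with q hq hqS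
    exact (isVel_localVel (hq.2 hqS) hq.1 (hS q hqS)).velOp_eq.symm
  exact h2.mono fun q hq => congrArg Subtype.val hq

theorem SmoothFamily.regOp_exprOp (hΦ : SmoothFamily d Φ S) (hy : y ∈ S) (D : DifProj n d) :
    RegOp (smoothClass S hy) fun q => ((Φ q).exprOp D).1 := by
  obtain ⟨G, hG⟩ := hΦ.exists_local hy
  obtain ⟨h1, h2⟩ := hG.self_of_nhdsWithin hy
  refine ((h2 hy).exprOp D).congr ?_
  have h3 : ∀ᶠ q in 𝓝[S] y, (G q).exprOp D = (Φ q).exprOp D := h1.mono fun q hq =>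
    (hq.exprOp_eq D).symm
  exact h3.mono fun q hq => congrArg Subtype.val hq

theorem SmoothFamily.eventually_mem (hΦ : SmoothFamily d Φ S) (hy : y ∈ S) {V : ConicOpen n}
    (h0 : (Φ y).lift 0 ∈ V.carrier) : ∀ᶠ q in 𝓝[S] y, (Φ q).lift 0 ∈ V.carrier := by
  obtain ⟨G, hG⟩ := hΦ.exists_local hy
  obtain ⟨h1, h2⟩ := hG.self_of_nhdsWithin hy
  have h3 : ∀ᶠ q in 𝓝[S] y, (G q).lift 0 ∈ V.carrier := (h2 hy).eventually_mem V.isOpen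
    ((h1.self_of_nhdsWithin hy).lift_mem h0)
  filter_upwards [h1, h3] with q hq hq' using hq.symm.lift_mem hq'

theorem SmoothFamily.regPS_expand (hΦ : SmoothFamily d Φ S) (hy : y ∈ S) {V : ConicOpen n}
    (f : sections d V) (h0 : (Φ y).lift 0 ∈ V.carrier) :
    RegPS (smoothClass S hy) fun q => (Φ q).expand f.1 := by
  obtain ⟨G, hG⟩ := hΦ.exists_local hy
  obtain ⟨h1, h2⟩ := hG.self_of_nhdsWithin hy
  refine ((h2 hy).expand V.isOpen f.2.1 ((h1.self_of_nhdsWithin hy).lift_mem h0)).congr ?_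
  have h3 : ∀ᶠ q in 𝓝[S] y, (G q).expand f.1 = (Φ q).expand f.1 := by
    filter_upwards [h1, hΦ.eventually_mem hy h0] with q hq hq'
    exact (hq.expand_eq hq' f.2).symm
  exact h3

/-! #### The structure equations -/

/-- The derivative of a family of operators. -/
def dOp (k : ℕ) (S : Set E) (y v : E) (P : E → Module.End ℂ (PS n)) : Module.End ℂ (PS n) where
  -- The range of summation makes the formula finite; for families with `ContOrd k` all entries
  -- outside it are identically zero.
  toFun f := fun α => ∑ β ∈ degLE n (α.degree + k),
    fderivWithin ℝ (fun q => entry (P q) α β) S y v * coeff β f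
  map_add' f g := by
    ext α
    simp only [map_add, mul_add, Finset.sum_add_distrib]
    rfl
  map_smul' r f := by
    ext α
    simp only [map_smul, smul_eq_mul, RingHom.id_apply, mul_left_comm _ r, ← Finset.mul_sum]
    rfl

theorem coeff_dOp (k : ℕ) (P : E → Module.End ℂ (PS n)) (f : PS n) (α : Fin n →₀ ℕ) :
    coeff α (dOp k S y v P f) = ∑ β ∈ degLE n (α.degree + k),
      fderivWithin ℝ (fun q => entry (P q) α β) S y v * coeff β f := rfl

theorem contOrd_dOp (k : ℕ) (P : E → Module.End ℂ (PS n)) : ContOrd k (dOp k S y v P) := by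
  intro J f hf α hα
  rw [coeff_dOp]
  refine Finset.sum_eq_zero fun β hβ => ?_
  rw [hf β (by have := mem_degLE.1 hβ; omega), mul_zero]

theorem entry_dOp {k : ℕ} {P : E → Module.End ℂ (PS n)} (hy : y ∈ S)
    (hP : ∀ q ∈ S, ContOrd k (P q)) (α β : Fin n →₀ ℕ) :
    entry (dOp k S y v P) α β = fderivWithin ℝ (fun q => entry (P q) α β) S y v := by
  classical
  rw [entry, coeff_dOp]
  by_cases h : β ∈ degLE n (α.degree + k)
  · rw [Finset.sum_eq_single_of_mem β h]
    · simp
    · intro γ _ hγ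
      rw [coeff_monomial, if_neg hγ, mul_zero]
  · rw [Finset.sum_eq_zero]
    · have h0 : ∀ q ∈ S, entry (P q) α β = 0 := fun q hq => (hP q hq).entry_eq_zero (by
        rw [mem_degLE] at h
        omega)
      rw [fderivWithin_congr (f := fun _ => (0 : ℂ)) h0 (h0 y hy)]
      simp
    · intro γ hγ
      rw [coeff_monomial, if_neg (fun e : γ = β => h (e ▸ hγ)), mul_zero]

/-- The Leibniz rule, applied to the finite sums that compute the coefficients of `P q (h q)`. -/
theorem dPS_apply {k : ℕ} {P : E → Module.End ℂ (PS n)} {hy : y ∈ S}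
    (hu : UniqueDiffWithinAt ℝ S y) (hP : ∀ q ∈ S, ContOrd k (P q))
    (hreg : RegOp (smoothClass S hy) P) {h : E → PS n} (hh : RegPS (smoothClass S hy) h) :
    dPS S y v (fun q => P q (h q)) = dOp k S y v P (h y) + P y (dPS S y v h) := by
  ext α
  rw [map_add, coeff_dPS, coeff_dOp, (hP y hy).coeff_apply]
  have h1 : ∀ q ∈ S, coeff α (P q (h q)) =
      ∑ β ∈ degLE n (α.degree + k), entry (P q) α β * coeff β (h q) := fun q hq =>
    (hP q hq).coeff_apply _ _
  have hd : ∀ β, DifferentiableWithinAt ℝ (fun q => entry (P q) α β) S y := fun β =>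
    ContDiffWithinAt.differentiableWithinAt (n := ∞) (hreg.entry α β) (by simp)
  rw [fderivWithin_congr h1 (h1 y hy), fderivWithin_fun_sum hu fun β _ =>
    (hd β).fun_mul (hh.differentiableWithinAt β), sum_apply, ← Finset.sum_add_distrib]
  refine Finset.sum_congr rfl fun β _ => ?_
  rw [fderivWithin_fun_mul hu (hd β) (hh.differentiableWithinAt β)]
  simp only [add_apply, smul_apply, smul_eq_mul, coeff_dPS]
  ring

/-- Symmetry of second derivatives, here at an interior point, where derivatives within `S` are
ordinary ones. -/
theorem dPS_comm {hy : y ∈ S} (hS : S ∈ 𝓝 y) {h : E → PS n} (hh : RegPS (smoothClass S hy) h)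
    (u v : E) : dPS S y v (fun q => dPS S q u h) = dPS S y u (fun q => dPS S q v h) := by
  ext α
  have hc : ContDiffAt ℝ ∞ (fun q => coeff α (h q)) y := ContDiffWithinAt.contDiffAt (hh α) hS
  set g := fun q => coeff α (h q) with hg
  have hs : IsSymmSndFDerivAt ℝ g y := hc.isSymmSndFDerivAt (by simpa using two_le_infty)
  have hd : DifferentiableAt ℝ (fderiv ℝ g) y :=
    (hc.fderiv_right (m := 1) (by simpa [one_add_one_eq_two] using two_le_infty)).differentiableAt
      (by simp)
  have key : ∀ u v : E, fderivWithin ℝ (fun q => fderivWithin ℝ g S q u) S y v =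
      fderiv ℝ (fderiv ℝ g) y v u := by
    intro u v
    have he : (fun q => fderivWithin ℝ g S q u) =ᶠ[𝓝 y] fun q => fderiv ℝ g q u := by
      filter_upwards [eventually_mem_nhds_iff.2 hS] with q hq
      rw [fderivWithin_of_mem_nhds hq]
    rw [fderivWithin_of_mem_nhds hS, he.fderiv_eq, fderiv_clm_apply hd (differentiableAt_const u)]
    simp
  exact (key u v).trans ((hs _ _).trans (key v u).symm)

/-- The flatness of the velocities. -/
theorem SmoothFamily.flat (hΦ : SmoothFamily d Φ S) (hS : UniqueDiffOn ℝ S) (hy : y ∈ S)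
    (hSy : S ∈ 𝓝 y) (u v : E) (α β : Fin n →₀ ℕ) :
    fderivWithin ℝ (fun q => entry (velOp d Φ S q u).1 α β) S y v -
        fderivWithin ℝ (fun q => entry (velOp d Φ S q v).1 α β) S y u =
      entry (velOp d Φ S y v * velOp d Φ S y u - velOp d Φ S y u * velOp d Φ S y v).1 α β := by
  have hord : ∀ u, ∀ q ∈ S, ContOrd 1 (velOp d Φ S q u).1 := fun u q hq =>
    (hΦ.isVel hS hq u).hasOrd.contOrd
  set A : E → Module.End ℂ (PS n) := fun u => (velOp d Φ S y u).1 with hA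
  set T : E → E → Module.End ℂ (PS n) := fun v u =>
    dOp 1 S y v fun q => (velOp d Φ S q u).1 with hT
  -- The second derivative of an expansion, computed by applying the velocity equation twice. Its
  -- symmetry in `u` and `v` is the flatness, tested on expansions of sections.
  have hexp : ∀ (u v : E) (V : ConicOpen n) (f : sections d V), (Φ y).lift 0 ∈ V.carrier →
      dPS S y v (fun q => dPS S q u fun q' => (Φ q').expand f.1) =
        T v u ((Φ y).expand f.1) + A u (A v ((Φ y).expand f.1)) := by
    intro u v V f h0
    rw [hA, hT]
    beta_reduce
    rw [(hΦ.isVel hS hy v).apply_expand V f h0, ← dPS_apply (hS y hy) (hord u)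
      (hΦ.regOp_velOp hS hy u) (hΦ.regPS_expand hy f h0)]
    refine dPS_congr hy ?_
    filter_upwards [hΦ.eventually_mem hy h0, self_mem_nhdsWithin] with q hq hqS
    exact ((hΦ.isVel hS hqS u).apply_expand V f hq).symm
  have hZ : ContOrd 2 (T v u - T u v - (A v * A u - A u * A v)) :=
    (((contOrd_dOp 1 _).sub (contOrd_dOp 1 _)).mono (by omega)).sub
      (((hord v y hy).mul (hord u y hy)).sub ((hord u y hy).mul (hord v y hy)))
  have h0 := (Φ y).eq_zero_of_expand d hZ fun V f hV => by
    have h1 := hexp u v V f hV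
    have h2 := hexp v u V f hV
    rw [dPS_comm hSy (hΦ.regPS_expand hy f hV)] at h1
    simp only [LinearMap.sub_apply, Module.End.mul_apply]
    linear_combination h2 - h1
  have h1 := congrArg (fun Z => entry Z α β) (sub_eq_zero.1 h0)
  have h2 : entry (T v u - T u v) α β = entry (T v u) α β - entry (T u v) α β := by
    simp [entry]
  have h3 : entry (T v u) α β - entry (T u v) α β = entry (A v * A u - A u * A v) α β :=
    h2.symm.trans h1
  simp only [hT, entry_dOp hy (hord u), entry_dOp hy (hord v)] at h3
  exact h3

/-- Global operators are parallel. -/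
theorem SmoothFamily.parallel (hΦ : SmoothFamily d Φ S) (hS : UniqueDiffOn ℝ S) (hy : y ∈ S)
    (v : E) (D : DifProj n d) (α β : Fin n →₀ ℕ) :
    fderivWithin ℝ (fun q => entry ((Φ q).exprOp D).1 α β) S y v =
      entry (velOp d Φ S y v * (Φ y).exprOp D - (Φ y).exprOp D * velOp d Φ S y v).1 α β := by
  obtain ⟨k, hk⟩ := exists_hasOrd_exprOp D
  have hordv := (hΦ.isVel hS hy v).hasOrd.contOrd
  set A := (velOp d Φ S y v).1 with hA
  set B := ((Φ y).exprOp D).1 with hB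
  set T := dOp k S y v fun q => ((Φ q).exprOp D).1 with hT
  have hZ : ContOrd (k + 1) (T - (A * B - B * A)) :=
    ((contOrd_dOp k _).mono (by omega)).sub
      (((hordv.mul (hk (Φ y)).contOrd).mono (by omega)).sub ((hk (Φ y)).contOrd.mul hordv))
  have h0 := (Φ y).eq_zero_of_expand d hZ fun V f hV => by
    have h1 := dPS_apply (v := v) (hS y hy) (fun q _ => (hk (Φ q)).contOrd)
      (hΦ.regOp_exprOp hy D) (hΦ.regPS_expand hy f hV)
    -- The family `D_q f_q` is itself the expansion of the fixed section `D f`, so its derivative is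
    -- again given by the velocity.
    have h2 : dPS S y v (fun q => ((Φ q).exprOp D).1 ((Φ q).expand f.1)) =
        dPS S y v (fun q => (Φ q).expand (D.1 V f).1) := by
      refine dPS_congr hy ?_
      filter_upwards [hΦ.eventually_mem hy hV] with q hq
      exact (Φ q).isExpression_exprOp D V f hq
    rw [h2, ← (hΦ.isVel hS hy v).apply_expand V _ hV, ← (hΦ.isVel hS hy v).apply_expand V f hV,
      ← (Φ y).isExpression_exprOp D V f hV] at h1
    simp only [LinearMap.sub_apply, Module.End.mul_apply]
    rw [sub_eq_zero, eq_sub_iff_add_eq]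
    exact h1.symm
  have h1 := congrArg (fun Z => entry Z α β) (sub_eq_zero.1 h0)
  simp only [hT, entry_dOp hy fun q _ => (hk (Φ q)).contOrd] at h1
  exact h1

end Velocity

/-! ### Linearity, chain rule and vanishing of velocities -/

section VelocityRules

open MvPowerSeries

variable {n : ℕ} {d : ℤ} {E E' : Type} [NormedAddCommGroup E] [NormedSpace ℝ E]
  [NormedAddCommGroup E'] [NormedSpace ℝ E'] {S : Set E} {S' : Set E'}
  {Φ : E → Frame n} {y v v' : E}

theorem dPS_add_dir (h : E → PS n) : dPS S y (v + v') h = dPS S y v h + dPS S y v' h := by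
  ext α
  simp [coeff_dPS]

theorem dPS_sub_dir (h : E → PS n) : dPS S y (v - v') h = dPS S y v h - dPS S y v' h := by
  ext α
  simp [coeff_dPS]

theorem SmoothFamily.velOp_add (hΦ : SmoothFamily d Φ S) (hS : UniqueDiffOn ℝ S) (hy : y ∈ S)
    (v v' : E) : velOp d Φ S y (v + v') = velOp d Φ S y v + velOp d Φ S y v' := by
  refine IsVel.velOp_eq ⟨?_, fun V f h0 => ?_⟩
  · exact (hΦ.isVel hS hy v).hasOrd.add (hΦ.isVel hS hy v').hasOrd
  · rw [dPS_add_dir, ← (hΦ.isVel hS hy v).apply_expand V f h0,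
      ← (hΦ.isVel hS hy v').apply_expand V f h0]
    rfl

theorem SmoothFamily.velOp_sub (hΦ : SmoothFamily d Φ S) (hS : UniqueDiffOn ℝ S) (hy : y ∈ S)
    (v v' : E) : velOp d Φ S y (v - v') = velOp d Φ S y v - velOp d Φ S y v' := by
  refine IsVel.velOp_eq ⟨?_, fun V f h0 => ?_⟩
  · exact (hΦ.isVel hS hy v).hasOrd.sub (hΦ.isVel hS hy v').hasOrd
  · rw [dPS_sub_dir, ← (hΦ.isVel hS hy v).apply_expand V f h0,
      ← (hΦ.isVel hS hy v').apply_expand V f h0]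
    rfl

theorem SmoothFamily.velOp_zero (hΦ : SmoothFamily d Φ S) (hS : UniqueDiffOn ℝ S) (hy : y ∈ S) :
    velOp d Φ S y 0 = 0 := by
  have := hΦ.velOp_sub hS hy 0 0
  rw [sub_self] at this
  exact this.trans (sub_self (velOp d Φ S y 0))

theorem SmoothFamily.velOp_sum (hΦ : SmoothFamily d Φ S) (hS : UniqueDiffOn ℝ S) (hy : y ∈ S)
    {ι : Type*} (s : Finset ι) (v : ι → E) :
    velOp d Φ S y (∑ i ∈ s, v i) = ∑ i ∈ s, velOp d Φ S y (v i) := by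
  classical
  induction s using Finset.induction_on with
  | empty => exact hΦ.velOp_zero hS hy
  | insert a s ha ih => rw [Finset.sum_insert ha, Finset.sum_insert ha, hΦ.velOp_add hS hy, ih]

/-- Velocities are determined by derivatives of expansions, and each coefficient obeys the ordinary
chain rule. -/
theorem SmoothFamily.velOp_comp (hΦ : SmoothFamily d Φ S) (hS : UniqueDiffOn ℝ S) {ψ : E' → E}
    {y' : E'} {ψ' : E' →L[ℝ] E} (hψ : HasFDerivWithinAt ψ ψ' S' y') (hmaps : Set.MapsTo ψ S' S)
    (hy' : y' ∈ S') (hu : UniqueDiffWithinAt ℝ S' y') (u : E') :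
    velOp d (fun q => Φ (ψ q)) S' y' u = velOp d Φ S (ψ y') (ψ' u) := by
  refine IsVel.velOp_eq ⟨(hΦ.isVel hS (hmaps hy') _).hasOrd, fun V f h0 => ?_⟩
  rw [(hΦ.isVel hS (hmaps hy') _).apply_expand V f h0]
  ext α
  rw [coeff_dPS, coeff_dPS]
  have h1 := ((hΦ.regPS_expand (hmaps hy') f h0).differentiableWithinAt α).hasFDerivWithinAt
  exact (congrArg (fun L => L u) ((h1.comp y' hψ hmaps).fderivWithin hu)).symm

/-- Equivalent coordinate systems expand sections identically, so all expansions are constant along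
the line. -/
theorem SmoothFamily.velOp_eq_zero (hΦ : SmoothFamily d Φ S) (hSy : S ∈ 𝓝 y)
    (h : ∀ r : ℝ, (Φ y).Equiv d (Φ (y + r • v))) : velOp d Φ S y v = 0 := by
  refine IsVel.velOp_eq ⟨HasOrd.zero 1, fun V f h0 => ?_⟩
  ext α
  rw [coeff_dPS, fderivWithin_of_mem_nhds hSy]
  have h1 : DifferentiableAt ℝ (fun q => coeff α ((Φ q).expand f.1)) (y + (0 : ℝ) • v) := by
    rw [zero_smul, add_zero]
    exact ((hΦ.regPS_expand (mem_of_mem_nhds hSy) f h0).differentiableWithinAt α).differentiableAt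
      hSy
  have h2 : HasDerivAt (fun r : ℝ => y + r • v) v 0 := by
    simpa using ((hasDerivAt_id (0 : ℝ)).smul_const v).const_add y
  have h3 := h1.hasFDerivAt.comp_hasDerivAt 0 h2
  have h4 : HasDerivAt (fun r : ℝ => coeff α ((Φ (y + r • v)).expand f.1)) 0 0 := by
    have : (fun r : ℝ => coeff α ((Φ (y + r • v)).expand f.1)) =
        fun _ => coeff α ((Φ y).expand f.1) := by
      funext r
      rw [(h r).expand_eq h0 f.2]
    rw [this]
    exact hasDerivAt_const _ _
  have h5 := h3.unique h4
  rw [zero_smul, add_zero] at h5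
  rw [h5]
  simp

end VelocityRules

/-! ### Families that depend holomorphically on a parameter -/

section HolFamily

open MvPowerSeries

variable {n : ℕ} {d : ℤ} {Y : Type} [NormedAddCommGroup Y] [NormedSpace ℝ Y] {Ω : Set Y}
  {Φ : ℂ × Y → Frame n}

/-- The derivative in a real parameter of a function that is holomorphic in `w` is again
holomorphic in `w`. -/
theorem analyticAt_fderiv_param {W : Set (ℂ × Y)} (hW : IsOpen W) {g : ℂ × Y → ℂ}
    (hg : ContDiffOn ℝ ∞ g W)
    (hol : ∀ y, DifferentiableOn ℂ (fun w => g (w, y)) {w | (w, y) ∈ W}) {w₀ : ℂ} {y : Y}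
    (h0 : (w₀, y) ∈ W) (v : Y) :
    AnalyticAt ℂ (fun w => fderiv ℝ (fun y' => g (w, y')) y v) w₀ := by
  have hU : IsOpen {w : ℂ | (w, y) ∈ W} := hW.preimage (by fun_prop)
  have hc : ∀ q ∈ W, ContDiffAt ℝ ∞ g q := fun q hq => hg.contDiffAt (hW.mem_nhds hq)
  have hdiff : ∀ q ∈ W, DifferentiableAt ℝ g q := fun q hq =>
    (hc q hq).differentiableAt (by simp)
  have hdiff2 : ∀ q ∈ W, DifferentiableAt ℝ (fderiv ℝ g) q := fun q hq =>
    ((hc q hq).fderiv_right (m := 1)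
      (by simpa [one_add_one_eq_two] using two_le_infty)).differentiableAt (by simp)
  have hpart : ∀ w, (w, y) ∈ W → fderiv ℝ (fun y' => g (w, y')) y v =
      fderiv ℝ g (w, y) (0, v) := fun w hw => by
    have h1 : HasFDerivAt (fun y' : Y => (w, y')) (ContinuousLinearMap.inr ℝ ℂ Y) y :=
      hasFDerivAt_prodMk_right w y
    have h2 := ((hdiff _ hw).hasFDerivAt.comp y h1).fderiv
    exact congrArg (fun L => L v) h2
  -- The Cauchy–Riemann equation in `w`, valid on the open set `W`; differentiating it in the
  -- direction `v` and interchanging derivatives gives the same equation for the parameter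
  -- derivative.
  have hCR : ∀ q ∈ W, fderiv ℝ g q (Complex.I, 0) = Complex.I * fderiv ℝ g q (1, 0) := by
    rintro ⟨w, y'⟩ hq
    have hUy : IsOpen {w : ℂ | (w, y') ∈ W} := hW.preimage (by fun_prop)
    have h1 : HasFDerivAt (fun w : ℂ => (w, y')) (ContinuousLinearMap.inl ℝ ℂ Y) w :=
      hasFDerivAt_prodMk_left w y'
    have h2 := ((hdiff _ hq).hasFDerivAt.comp w h1).fderiv
    have h3 := (differentiableAt_complex_iff_differentiableAt_real.1
      ((hol y' w hq).differentiableAt (hUy.mem_nhds hq))).2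
    have h4 : ∀ z : ℂ, fderiv ℝ (fun w => g (w, y')) w z = fderiv ℝ g (w, y') (z, 0) := fun z =>
      congrArg (fun L => L z) h2
    rw [h4, h4, smul_eq_mul] at h3
    exact h3
  refine DifferentiableOn.analyticAt (s := {w : ℂ | (w, y) ∈ W}) (fun w hw => ?_)
    (hU.mem_nhds h0)
  have hw' : (w, y) ∈ W := hw
  refine DifferentiableAt.differentiableWithinAt ?_
  have heq : (fun w => fderiv ℝ (fun y' => g (w, y')) y v) =ᶠ[𝓝 w]
      fun w => fderiv ℝ g (w, y) (0, v) := by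
    filter_upwards [hU.mem_nhds hw] with w' hw' using hpart w' hw'
  refine DifferentiableAt.congr_of_eventuallyEq ?_ heq
  have h1 : HasFDerivAt (fun w : ℂ => (w, y)) (ContinuousLinearMap.inl ℝ ℂ Y) w :=
    hasFDerivAt_prodMk_left w y
  have h2 : HasFDerivAt (fun w : ℂ => fderiv ℝ g (w, y)) _ w :=
    (hdiff2 _ hw').hasFDerivAt.comp w h1
  have h3 := h2.clm_apply (hasFDerivAt_const ((0 : ℂ), v) w)
  rw [differentiableAt_complex_iff_differentiableAt_real]
  refine ⟨h3.differentiableAt, ?_⟩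
  have h4 : ∀ z : ℂ, fderiv ℝ (fun w => fderiv ℝ g (w, y) (0, v)) w z =
      fderiv ℝ (fderiv ℝ g) (w, y) (z, 0) (0, v) := fun z => by
    rw [h3.fderiv]
    simp
  have hs : IsSymmSndFDerivAt ℝ g (w, y) :=
    (hc _ hw').isSymmSndFDerivAt (by simpa using two_le_infty)
  have h5 : ∀ z : ℂ, HasFDerivAt (fun q => fderiv ℝ g q (z, 0))
      ((fderiv ℝ (fderiv ℝ g) (w, y)).flip (z, 0)) (w, y) := fun z => by
    have := (hdiff2 _ hw').hasFDerivAt.clm_apply (hasFDerivAt_const (z, (0 : Y)) (w, y))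
    simpa using this
  have h6 : (fun q => fderiv ℝ g q (Complex.I, 0)) =ᶠ[𝓝 (w, y)]
      fun q => Complex.I * fderiv ℝ g q (1, 0) := by
    filter_upwards [hW.mem_nhds hw'] with q hq using hCR q hq
  have h7 := (((h5 1).const_mul Complex.I).congr_of_eventuallyEq h6).unique (h5 Complex.I)
  have h8 := congrArg (fun L => L (0, v)) h7
  rw [h4, h4, hs.eq, hs.eq (1, 0), smul_eq_mul]
  simpa using h8.symm

/-- Families of coordinate systems that are jointly smooth, and holomorphic in the first
parameter. -/
def HolFamily (d : ℤ) (Φ : ℂ × Y → Frame n) (Ω : Set Y) : Prop :=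
  ∀ w : ℂ, ∀ y ∈ Ω, ∃ W, IsOpen W ∧ (w, y) ∈ W ∧ ∃ G : ℂ × Y → Frame n,
    (∀ q ∈ W, (Φ q).Equiv d (G q)) ∧ ∀ α,
      (∀ j, ContDiffOn ℝ ∞ (fun q => coeff α ((G q).liftPS j)) W ∧
        ∀ y, DifferentiableOn ℂ (fun w => coeff α ((G (w, y)).liftPS j)) {w | (w, y) ∈ W}) ∧
      (ContDiffOn ℝ ∞ (fun q => coeff α (G q).trivPS) W ∧
        ∀ y, DifferentiableOn ℂ (fun w => coeff α (G (w, y)).trivPS) {w | (w, y) ∈ W})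

theorem HolFamily.smoothFamily (hΦ : HolFamily d Φ Ω) (w : ℂ) :
    SmoothFamily d (fun y => Φ (w, y)) Ω := by
  intro y hy
  obtain ⟨W, hW, h0, G, hE, hG⟩ := hΦ w y hy
  refine ⟨{y | (w, y) ∈ W}, hW.preimage (by fun_prop), h0, fun y => G (w, y),
    fun q hq => hE _ hq.1, fun α => ⟨fun j => ?_, ?_⟩⟩
  · exact ((hG α).1 j).1.comp (by fun_prop) fun q hq => hq.1
  · exact (hG α).2.1.comp (by fun_prop) fun q hq => hq.1

variable {y v : Y}

/-- `localVel` involves derivatives of Taylor coefficients in the real parameter, so holomorphy in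
`w` is needed for these as well as for the coefficients. -/
theorem HolFamily.exists_local (hΦ : HolFamily d Φ Ω) (hΩ : IsOpen Ω) (w₀ : ℂ) (hy : y ∈ Ω) :
    ∃ G : ℂ × Y → Frame n, RegFrame (holClass w₀) (fun w => G (w, y)) ∧
      (∀ j v, RegPS (holClass w₀) fun w => dPS Ω y v fun y' => (G (w, y')).liftPS j) ∧
      (∀ v, RegPS (holClass w₀) fun w => dPS Ω y v fun y' => (G (w, y')).trivPS) ∧
      ∀ᶠ w in 𝓝 w₀, (∀ᶠ y' in 𝓝[Ω] y, (Φ (w, y')).Equiv d (G (w, y'))) ∧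
        RegFrame (smoothClass Ω hy) fun y' => G (w, y') := by
  obtain ⟨W, hW, h0, G, hE, hG⟩ := hΦ w₀ y hy
  have hU : ∀ y, IsOpen {w : ℂ | (w, y) ∈ W} := fun y => hW.preimage (by fun_prop)
  have hUy : ∀ w, IsOpen {y : Y | (w, y) ∈ W} := fun w => hW.preimage (by fun_prop)
  refine ⟨G, ⟨fun j α => ?_, fun α => ?_⟩, fun j v α => ?_, fun v α => ?_, ?_⟩
  · exact (((hG α).1 j).2 y).analyticAt ((hU y).mem_nhds h0)
  · exact ((hG α).2.2 y).analyticAt ((hU y).mem_nhds h0)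
  · simp only [coeff_dPS, fderivWithin_of_isOpen hΩ hy]
    exact analyticAt_fderiv_param hW ((hG α).1 j).1 ((hG α).1 j).2 h0 v
  · simp only [coeff_dPS, fderivWithin_of_isOpen hΩ hy]
    exact analyticAt_fderiv_param hW (hG α).2.1 (hG α).2.2 h0 v
  · filter_upwards [(hU y).mem_nhds h0] with w hw
    have hmem : {y : Y | (w, y) ∈ W} ∈ 𝓝 y := (hUy w).mem_nhds hw
    refine ⟨mem_nhdsWithin_of_mem_nhds (Filter.mem_of_superset hmem fun q hq => hE _ hq),
      ⟨fun j α => ?_, fun α => ?_⟩⟩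
    · have h1 : ContDiffOn ℝ ∞ (fun y' => coeff α ((G (w, y')).liftPS j)) {y : Y | (w, y) ∈ W} :=
        ((hG α).1 j).1.comp (by fun_prop) fun q hq => hq
      exact (h1.contDiffAt hmem).contDiffWithinAt
    · have h1 : ContDiffOn ℝ ∞ (fun y' => coeff α (G (w, y')).trivPS) {y : Y | (w, y) ∈ W} :=
        (hG α).2.1.comp (by fun_prop) fun q hq => hq
      exact (h1.contDiffAt hmem).contDiffWithinAt

theorem HolFamily.analyticAt_velOp (hΦ : HolFamily d Φ Ω) (hΩ : IsOpen Ω) (w₀ : ℂ) (hy : y ∈ Ω)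
    (v : Y) (α β : Fin n →₀ ℕ) :
    AnalyticAt ℂ (fun w => entry (velOp d (fun y' => Φ (w, y')) Ω y v).1 α β) w₀ := by
  obtain ⟨G, hG, hl, ht, hev⟩ := hΦ.exists_local hΩ w₀ hy
  have h1 : RegOp (holClass w₀) fun w => (localVel d (fun y' => G (w, y')) Ω y v).1 := by
    refine (hG.vectorOp d fun j => hl j v).add (RegOp.mulLeft ?_)
    exact (ht v).mul (hG.triv.inv (G (w₀, y)).constantCoeff_trivPS)
  refine RegOp.entry (c := holClass w₀) (h1.congr ?_) α β
  have h2 : ∀ᶠ w in 𝓝 w₀, localVel d (fun y' => G (w, y')) Ω y v =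
      velOp d (fun y' => Φ (w, y')) Ω y v := by
    filter_upwards [hev] with w hw
    exact (isVel_localVel hw.2 hw.1 (hΩ.uniqueDiffWithinAt hy)).velOp_eq.symm
  exact h2.mono fun q hq => congrArg Subtype.val hq

theorem HolFamily.analyticAt_exprOp (hΦ : HolFamily d Φ Ω) (hΩ : IsOpen Ω) (w₀ : ℂ) (hy : y ∈ Ω)
    (D : DifProj n d) (α β : Fin n →₀ ℕ) :
    AnalyticAt ℂ (fun w => entry ((Φ (w, y)).exprOp D).1 α β) w₀ := by
  obtain ⟨G, hG, -, -, hev⟩ := hΦ.exists_local hΩ w₀ hy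
  refine RegOp.entry (c := holClass w₀) ((hG.exprOp D).congr ?_) α β
  have h2 : ∀ᶠ w in 𝓝 w₀, (G (w, y)).exprOp D = (Φ (w, y)).exprOp D := by
    filter_upwards [hev] with w hw
    exact ((hw.1.self_of_nhdsWithin hy).exprOp_eq D).symm
  exact h2.mono fun q hq => congrArg Subtype.val hq

end HolFamily

/-! ### Reduction of continuous cochains to finitely many Taylor coefficients -/

section Jets

variable {n : ℕ}

/-- Positions of matrix entries, together with indices of entries of operators. -/
abbrev JetIndex (n : ℕ) : Type := (ℕ × ℕ) × (Fin n →₀ ℕ) × (Fin n →₀ ℕ)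

/-- Finitely many Taylor coefficients of a matrix of operators. -/
def jet (s : Finset (JetIndex n)) : glFin (Dif n) →ₗ[ℂ] (s → ℂ) where
  toFun M c := entry (M.1 c.1.1.1 c.1.1.2).1 c.1.2.1 c.1.2.2
  map_add' M M' := by
    ext c
    simp [entry]
  map_smul' b M := by
    ext c
    simp [entry]

theorem jet_apply (s : Finset (JetIndex n)) (M : glFin (Dif n)) (c : s) :
    jet s M c = entry (M.1 c.1.1.1 c.1.1.2).1 c.1.2.1 c.1.2.2 := rfl

/-- The subspace of matrices of bounded size and order. -/
def level (n N k : ℕ) : Submodule ℂ (glFin (Dif n)) where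
  carrier := {M | InLevel N k M}
  zero_mem' := ⟨fun _ _ _ => rfl, fun _ _ => OrderLE.zero k⟩
  add_mem' := by
    rintro M M' ⟨h1, h2⟩ ⟨h1', h2'⟩
    refine ⟨fun i j hij => ?_, fun i j => (h2 i j).add (h2' i j)⟩
    rw [Submodule.coe_add, Matrix.add_apply, h1 i j hij, h1' i j hij, add_zero]
  smul_mem' := by
    rintro b M ⟨h1, h2⟩
    refine ⟨fun i j hij => ?_, fun i j => (h2 i j).smul b⟩
    rw [Submodule.coe_smul, Matrix.smul_apply, h1 i j hij, smul_zero]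

theorem InLevel.mono {N N' k k' : ℕ} (hN : N ≤ N') (hk : k ≤ k') {M : glFin (Dif n)}
    (h : InLevel N k M) : InLevel N' k' M :=
  ⟨fun i j hij => h.1 i j (by omega), fun i j => (h.2 i j).mono hk⟩

theorem InLevel.lie {N k l : ℕ} {M M' : glFin (Dif n)} (h : InLevel N k M) (h' : InLevel N l M') :
    InLevel N (k + l) ⁅M, M'⁆ := by
  have key : ∀ {k l : ℕ} {M M' : glFin (Dif n)}, InLevel N k M → InLevel N l M' →
      InLevel N (k + l) (M * M') := by
    intro k l M M' h h'
    refine ⟨fun i j hij => ?_, fun i j => ?_⟩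
    · rw [glFin_mul_apply i j h.1]
      refine Finset.sum_eq_zero fun r _ => ?_
      rcases hij with hi | hj
      · rw [h.1 i r (Or.inl hi), zero_mul]
      · rw [h'.1 r j (Or.inr hj), mul_zero]
    · rw [glFin_mul_apply i j h.1, AddSubmonoidClass.coe_finsetSum]
      refine Finset.sum_induction _ (OrderLE (k + l)) (fun _ _ => OrderLE.add) (OrderLE.zero _) ?_
      intro r _
      exact (h.2 i r).mul (h'.2 r j)
  rw [Ring.lie_def]
  have hswap : InLevel N (k + l) (M' * M) := by
    rw [add_comm]
    exact key h' h
  exact (level n N (k + l)).sub_mem (key h h') hswap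

/-- The Taylor coefficients that determine the values modulo terms of degree `J` on matrices of
size `N` and order `k`. -/
def jetSet (n N k J : ℕ) : Finset (JetIndex n) :=
  (Finset.range N ×ˢ Finset.range N) ×ˢ (degLE n J ×ˢ degLE n k)

/-- An operator of order at most `k` is controlled to any precision by the images of monomials of
degree at most `k` (`vanTo_of_entries`), so finitely many entries suffice. -/
theorem vanishesTo_of_jet {N k J : ℕ} {M : glFin (Dif n)} (hM : InLevel N k M)
    (h : jet (jetSet n N k J) M = 0) : VanishesTo J M := by
  intro i j f α hα
  by_cases hij : N ≤ i ∨ N ≤ j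
  · rw [hM.1 i j hij]
    simp
  obtain ⟨c, hc⟩ := Dif.exists_hasOrd (M.1 i j)
  refine vanTo_of_entries (hM.2 i j) hc.contOrd (fun β γ hβ hγ => ?_) f α hα
  have hmem : ((i, j), γ, β) ∈ jetSet n N k J := by
    simp only [jetSet, Finset.mem_product, Finset.mem_range, mem_degLE]
    omega
  exact congrFun h ⟨_, hmem⟩

theorem exists_quasiInverse {V W : Type*} [AddCommGroup V] [Module ℂ V] [AddCommGroup W]
    [Module ℂ W] (f : V →ₗ[ℂ] W) : ∃ g : W →ₗ[ℂ] V, ∀ x, f (g (f x)) = f x := by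
  obtain ⟨g, hg⟩ := f.rangeRestrict.exists_rightInverse_of_surjective f.range_rangeRestrict
  obtain ⟨g', hg'⟩ := g.exists_extend
  refine ⟨g', fun x => ?_⟩
  have h1 : g' (f x) = g (f.rangeRestrict x) := by
    rw [← hg']
    rfl
  rw [h1]
  exact congrArg Subtype.val (congrArg (fun L => L (f.rangeRestrict x)) hg)

/-- On a fixed level `η` depends only on the jets. A linear section of the jet map on its range then
turns it into an alternating form on a finite-dimensional space, where differentiability is
automatic. -/
theorem IsContinuousCochain.exists_jet {q : ℕ} {η : glFin (Dif n) [⋀^Fin q]→ₗ[ℂ] ℂ}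
    (hη : IsContinuousCochain η) (N k : ℕ) :
    ∃ (s : Finset (JetIndex n)) (κ : (s → ℂ) [⋀^Fin q]→ₗ[ℂ] ℂ),
      ∀ M : Fin q → glFin (Dif n), (∀ i, InLevel N k (M i)) → η M = κ fun i => jet s (M i) := by
  obtain ⟨J, hJ⟩ := hη N k
  set s := jetSet n N k J with hs
  obtain ⟨g, hg⟩ := exists_quasiInverse ((jet s).comp (level n N k).subtype)
  refine ⟨s, η.compLinearMap ((level n N k).subtype.comp g), fun M hM => ?_⟩
  set M' : Fin q → glFin (Dif n) := fun i => (g (jet s (M i))).1 with hM'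
  have hlev : ∀ i, InLevel N k (M' i) := fun i => (g (jet s (M i))).2
  have hdiff : ∀ i, VanishesTo J (M i - M' i) := fun i => by
    refine vanishesTo_of_jet (N := N) (k := k) ((level n N k).sub_mem (hM i) (hlev i)) ?_
    rw [map_sub, sub_eq_zero]
    exact (hg ⟨M i, hM i⟩).symm
  -- The arguments are exchanged one at a time; each exchange changes `η` by a value with one
  -- argument vanishing to order `J`.
  have key : ∀ t : Finset (Fin q), η (t.piecewise M' M) = η M := by
    intro t
    induction t using Finset.induction_on with
    | empty => simp
    | insert a t ha ih =>
      rw [← ih, Finset.piecewise_insert, ← sub_eq_zero]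
      conv_lhs => enter [2, 2]; rw [← Function.update_eq_self a (t.piecewise M' M)]
      rw [← AlternatingMap.map_update_sub]
      refine hJ _ (fun i => ?_) ⟨a, ?_⟩
      · rcases eq_or_ne i a with rfl | hi
        · rw [Function.update_self]
          refine (level n N k).sub_mem (hlev i) ?_
          rw [Finset.piecewise_eq_of_notMem _ _ _ ha]
          exact hM i
        · rw [Function.update_of_ne hi]
          by_cases hit : i ∈ t
          · rw [Finset.piecewise_eq_of_mem _ _ _ hit]; exact hlev i
          · rw [Finset.piecewise_eq_of_notMem _ _ _ hit]; exact hM i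
      · rw [Function.update_self, Finset.piecewise_eq_of_notMem _ _ _ ha]
        intro i j f α hα
        have := hdiff a i j f α hα
        have h2 : M' a - M a = -(M a - M' a) := by abel
        rw [h2]
        have h3 : ((-(M a - M' a)).1 i j : Module.End ℂ (PS n)) f =
          -(((M a - M' a).1 i j : Module.End ℂ (PS n)) f) := rfl
        rw [h3, map_neg, this, neg_zero]
  rw [← key Finset.univ, Finset.piecewise_univ]
  rfl

end Jets

/-! ### Alternating forms on finite-dimensional spaces -/

section FiniteDimensional

variable {ι : Type*} [Fintype ι] {q : ℕ}

theorem continuous_alternatingMap (κ : (ι → ℂ) [⋀^Fin q]→ₗ[ℂ] ℂ) :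
    Continuous (fun w : Fin q → ι → ℂ => κ w) := by
  classical
  have h : ∀ w : Fin q → ι → ℂ, κ w = ∑ r : Fin q → ι, (∏ i, w i (r i)) *
      κ fun i => Pi.single (r i) 1 := fun w => by
    have h1 : w = fun i => ∑ j, w i j • (Pi.single j (1 : ℂ) : ι → ℂ) := by
      funext i
      exact pi_eq_sum_univ' (w i)
    have h2 := κ.toMultilinearMap.map_sum (fun i j => w i j • (Pi.single j (1 : ℂ) : ι → ℂ))
    conv_lhs => rw [h1]
    refine h2.trans (Finset.sum_congr rfl fun r _ => ?_)
    exact κ.toMultilinearMap.map_smul_univ (fun i => w i (r i)) (fun i => Pi.single (r i) 1)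
  exact (continuous_congr h).2 (by fun_prop)

/-- An alternating form on a finite-dimensional space as a continuous multilinear map. -/
def contForm (κ : (ι → ℂ) [⋀^Fin q]→ₗ[ℂ] ℂ) :
    ContinuousMultilinearMap ℂ (fun _ : Fin q => ι → ℂ) ℂ where
  toMultilinearMap := κ.toMultilinearMap
  cont := continuous_alternatingMap κ

theorem contForm_apply (κ : (ι → ℂ) [⋀^Fin q]→ₗ[ℂ] ℂ) (w : Fin q → ι → ℂ) :
    contForm κ w = κ w := rfl

variable {E : Type*} [NormedAddCommGroup E] [NormedSpace ℝ E] {S : Set E} {y : E}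

theorem contDiffWithinAt_form (κ : (ι → ℂ) [⋀^Fin q]→ₗ[ℂ] ℂ) {g : Fin q → E → ι → ℂ}
    (hg : ∀ i, ContDiffWithinAt ℝ ∞ (g i) S y) :
    ContDiffWithinAt ℝ ∞ (fun x => κ fun i => g i x) S y := by
  have h1 : ContDiff ℝ ∞ fun w : Fin q → ι → ℂ => (contForm κ).restrictScalars ℝ w :=
    ((contForm κ).restrictScalars ℝ).contDiff
  exact h1.contDiffAt.comp_contDiffWithinAt y (contDiffWithinAt_pi.2 hg)

theorem fderivWithin_form (κ : (ι → ℂ) [⋀^Fin q]→ₗ[ℂ] ℂ) {g : Fin q → E → ι → ℂ}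
    (hg : ∀ i, DifferentiableWithinAt ℝ (g i) S y) (hu : UniqueDiffWithinAt ℝ S y) (v : E) :
    fderivWithin ℝ (fun x => κ fun i => g i x) S y v =
      ∑ i, κ (Function.update (fun j => g j y) i (fderivWithin ℝ (g i) S y v)) := by
  have h := HasFDerivWithinAt.multilinear_comp (f := (contForm κ).restrictScalars ℝ)
    (fun i => (hg i).hasFDerivWithinAt)
  have h2 := h.fderivWithin hu
  refine (congrArg (fun L => L v) h2).trans ?_
  simp [contForm_apply]

theorem differentiable_form (κ : (ι → ℂ) [⋀^Fin q]→ₗ[ℂ] ℂ) {g : Fin q → ℂ → ι → ℂ}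
    (hg : ∀ i, Differentiable ℂ (g i)) : Differentiable ℂ (fun x => κ fun i => g i x) := fun x =>
  (HasFDerivAt.multilinear_comp (f := contForm κ)
    (fun i => (hg i x).hasFDerivAt)).differentiableAt

end FiniteDimensional

/-! ### Alternating sums -/

section AlternatingSums

variable {V : Type*} [AddCommGroup V] [Module ℂ V] {q : ℕ}

/-- Put `u` in both positions: deleting one copy or the other gives lists that differ by a cyclic
permutation, whose sign is determined by the positions. -/
theorem map_update_succAbove_swap (κ : V [⋀^Fin q]→ₗ[ℂ] ℂ) (x : Fin (q + 1) → V)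
    {i j : Fin (q + 1)} (hij : i ≠ j) (u : V) :
    (-1) ^ (i : ℕ) * κ (fun r => Function.update x j u (i.succAbove r)) =
      -((-1) ^ (j : ℕ) * κ (fun r => Function.update x i u (j.succAbove r))) := by
  set y := Function.update (Function.update x i u) j u with hy
  have h := κ.neg_one_pow_smul_map_removeNth_add_eq_zero_of_eq (v := y) (i := i) (j := j)
    (by rw [hy, Function.update_self, Function.update_of_ne hij, Function.update_self]) hij
  have h1 : i.removeNth y = fun r => Function.update x j u (i.succAbove r) := by
    funext r
    rw [Fin.removeNth, hy, Function.update_comm hij]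
    exact Function.update_of_ne (Fin.succAbove_ne i r) _ _
  have h2 : j.removeNth y = fun r => Function.update x i u (j.succAbove r) := by
    funext r
    rw [Fin.removeNth, hy]
    exact Function.update_of_ne (Fin.succAbove_ne j r) _ _
  rw [h1, h2] at h
  simpa using eq_neg_of_add_eq_zero_left h

/-- The algebraic part of the formula for the exterior derivative of a family of forms. -/
theorem alternating_sum_derivative (κ : V [⋀^Fin q]→ₗ[ℂ] ℂ) (x : Fin (q + 1) → V)
    (D : Fin (q + 1) → Fin (q + 1) → V) :
    ∑ i : Fin (q + 1), (-1) ^ (i : ℕ) * ∑ r, κ (Function.update (fun l => x (i.succAbove l)) r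
        (D i (i.succAbove r))) =
      -∑ j : Fin (q + 1), ∑ i ∈ Finset.Iio j, (-1) ^ (j : ℕ) *
        κ (fun r => Function.update x i (D i j - D j i) (j.succAbove r)) := by
  -- `T i l` is the term in which direction `i` differentiates argument `l`. The terms for `(i, l)`
  -- and `(l, i)` combine, with opposite signs, into the antisymmetrized derivative.
  set T : Fin (q + 1) → Fin (q + 1) → ℂ := fun i l =>
    if l = i then 0 else
      (-1) ^ (i : ℕ) * κ (fun r => Function.update x l (D i l) (i.succAbove r)) with hT
  have h1 : ∀ i : Fin (q + 1), (-1) ^ (i : ℕ) * ∑ r, κ (Function.update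
      (fun l => x (i.succAbove l)) r (D i (i.succAbove r))) = ∑ l, T i l := fun i => by
    rw [Fin.sum_univ_succAbove _ i, Finset.mul_sum]
    simp only [hT, if_true, zero_add]
    refine Finset.sum_congr rfl fun r _ => ?_
    rw [if_neg (Fin.succAbove_ne i r)]
    congr 2
    funext l
    by_cases hl : l = r
    · subst hl
      simp
    · rw [Function.update_of_ne hl, Function.update_of_ne]
      exact fun h => hl (Fin.succAbove_right_injective h)
  simp only [h1]
  have h2 : ∀ i j : Fin (q + 1), i < j → T i j + T j i = -((-1) ^ (j : ℕ) *
      κ (fun r => Function.update x i (D i j - D j i) (j.succAbove r))) := fun i j hij => by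
    simp only [hT]
    rw [if_neg hij.ne', if_neg hij.ne, map_update_succAbove_swap κ x hij.ne]
    obtain ⟨a, ha⟩ := Fin.exists_succAbove_eq hij.ne
    have h3 : ∀ u : V, (fun r => Function.update x i u (j.succAbove r)) =
        Function.update (fun r => x (j.succAbove r)) a u := fun u => by
      funext l
      by_cases hl : l = a
      · subst hl
        rw [ha]
        simp
      · rw [Function.update_of_ne hl, Function.update_of_ne]
        rw [← ha]
        exact fun h => hl (Fin.succAbove_right_injective h)
    rw [h3, h3, h3, AlternatingMap.map_update_sub]
    ring
  have h4 : ∑ i, ∑ l, T i l = ∑ j, ∑ i ∈ Finset.Iio j, (T i j + T j i) := by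
    have hz : ∀ i, T i i = 0 := fun i => by simp [hT]
    have h5 : ∀ i, ∑ l, T i l = ∑ l ∈ Finset.Iio i, T i l + ∑ l ∈ Finset.Ioi i, T i l := fun i => by
      rw [← Finset.sum_union, ← Finset.sum_erase_add _ _ (Finset.mem_univ i), hz, add_zero]
      · congr 1
        ext l
        simp
      · rw [Finset.disjoint_left]
        intro l h h'
        exact absurd (Finset.mem_Iio.1 h) (not_lt.2 (Finset.mem_Ioi.1 h').le)
    simp only [h5, Finset.sum_add_distrib]
    rw [add_comm]
    congr 1
    exact Finset.sum_comm' (by simp)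
  rw [h4, ← Finset.sum_neg_distrib]
  refine Finset.sum_congr rfl fun j _ => ?_
  rw [← Finset.sum_neg_distrib]
  exact Finset.sum_congr rfl fun i hi => h2 i j (Finset.mem_Iio.1 hi)

/-- A column operation: each change produces a term with `x i₀` in two positions. -/
theorem map_add_smul_const (κ : V [⋀^Fin q]→ₗ[ℂ] ℂ) (x : Fin q → V) (i₀ : Fin q)
    (c : Fin q → ℂ) (hc : c i₀ = 0) : κ (fun i => x i + c i • x i₀) = κ x := by
  classical
  have key : ∀ t : Finset (Fin q), κ (fun i => if i ∈ t then x i + c i • x i₀ else x i) = κ x := by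
    intro t
    induction t using Finset.induction_on with
    | empty => simp
    | insert a t ha ih =>
      rcases eq_or_ne a i₀ with rfl | hne
      · rw [← ih]
        congr 1
        funext i
        by_cases hi : i = a
        · subst hi
          simp [hc]
        · simp [hi]
      set y : Fin q → V := fun i => if i ∈ t then x i + c i • x i₀ else x i with hy
      have h1 : (fun i => if i ∈ insert a t then x i + c i • x i₀ else x i) =
          Function.update y a (x a + c a • x i₀) := by
        funext i
        by_cases hi : i = a
        · subst hi
          simp
        · simp [hy, hi]
      have hya : y a = x a := by simp [hy, ha]
      have hyi : y i₀ = x i₀ := by simp [hy, hc]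
      rw [h1, AlternatingMap.map_update_add, AlternatingMap.map_update_smul, ← hya,
        Function.update_eq_self, ih, ← hyi, AlternatingMap.map_update_self _ _ hne, smul_zero,
        add_zero]
  simpa using key Finset.univ

/-- The alternating sum of the faces of a simplex of vectors. -/
theorem sum_removeNth_eq (κ : V [⋀^Fin q]→ₗ[ℂ] ℂ) (x : Fin (q + 1) → V) (i₀ : Fin (q + 1))
    (c : Fin (q + 1) → ℂ) (hc : c i₀ = 1) :
    ∑ i : Fin (q + 1), (-1) ^ (i : ℕ) * (c i * κ fun r => x (i.succAbove r)) =
      (-1) ^ (i₀ : ℕ) * κ fun r => x (i₀.succAbove r) - c (i₀.succAbove r) • x i₀ := by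
  -- The alternating sum is the wedge product of the linear form `c` with `κ`, made alternating on
  -- `V × ℂ`. Subtracting multiples of the vector `i₀` kills `c` on all the other vectors and leaves
  -- one summand.
  let f : (V × ℂ) →ₗ[ℂ] (V × ℂ) [⋀^Fin q]→ₗ[ℂ] ℂ :=
    (LinearMap.toSpanSingleton ℂ _ (κ.compLinearMap (LinearMap.fst ℂ V ℂ))).comp
      (LinearMap.snd ℂ V ℂ)
  have hf : ∀ X : Fin (q + 1) → V × ℂ, AlternatingMap.alternatizeUncurryFin f X =
      ∑ i : Fin (q + 1), (-1) ^ (i : ℕ) * ((X i).2 * κ fun r => (X (i.succAbove r)).1) := by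
    intro X
    rw [AlternatingMap.alternatizeUncurryFin_apply]
    refine Finset.sum_congr rfl fun i _ => ?_
    simp only [f, LinearMap.comp_apply, LinearMap.snd_apply, LinearMap.toSpanSingleton_apply,
      AlternatingMap.smul_apply, smul_eq_mul]
    rw [← Int.cast_smul_eq_zsmul ℂ, smul_eq_mul]
    push_cast
    rfl
  have h1 := map_add_smul_const (AlternatingMap.alternatizeUncurryFin f)
    (fun i => (x i, c i)) i₀ (fun i => if i = i₀ then 0 else -c i) (by simp)
  rw [hf, hf] at h1
  rw [← h1, Finset.sum_eq_single i₀]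
  · simp [hc, sub_eq_add_neg]
  · intro i _ hi
    simp [hi, hc]
  · simp

end AlternatingSums

/-! ### Matrices of operators along a family of coordinate systems -/

section Matrices

variable {n : ℕ} {d : ℤ}

theorem glFin_ext {R : Type*} [Ring R] [Algebra ℂ R] {M M' : glFin R}
    (h : ∀ i j, M.1 i j = M'.1 i j) : M = M' :=
  Subtype.ext (Matrix.ext h)

theorem glFin_sub_apply {R : Type*} [Ring R] [Algebra ℂ R] (M M' : glFin R) (i j : ℕ) :
    (M - M').1 i j = M.1 i j - M'.1 i j := rfl

/-- A matrix of global operators written in a coordinate system. -/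
def exprMat (F : Frame n) (d : ℤ) : glFin (DifProj n d) →ₗ[ℂ] glFin (Dif n) where
  toFun A := ⟨fun i j => F.exprOp (A.1 i j), by
    obtain ⟨N, hN⟩ := A.2
    exact ⟨N, fun i j hij => (congrArg F.exprOp (hN i j hij)).trans F.exprOp_zero⟩⟩
  map_add' A B := glFin_ext fun i j => F.exprOp_add _ _
  map_smul' c A := glFin_ext fun i j => F.exprOp_smul _ _

theorem exprMat_apply (F : Frame n) (A : glFin (DifProj n d)) (i j : ℕ) :
    (exprMat F d A).1 i j = F.exprOp (A.1 i j) := rfl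

theorem exprMat_mul (F : Frame n) (A B : glFin (DifProj n d)) :
    exprMat F d (A * B) = exprMat F d A * exprMat F d B := by
  obtain ⟨N, hN⟩ := A.2
  refine glFin_ext fun i j => ?_
  rw [exprMat_apply, glFin_mul_apply i j hN, glFin_mul_apply (N := N) i j]
  · have := map_sum (F.exprLin d) (fun k => A.1 i k * B.1 k j) (Finset.range N)
    refine this.trans (Finset.sum_congr rfl fun k _ => ?_)
    exact F.exprOp_mul _ _
  · intro i j hij
    rw [exprMat_apply, hN i j hij, F.exprOp_zero]

theorem exprMat_lie (F : Frame n) (A B : glFin (DifProj n d)) :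
    exprMat F d ⁅A, B⁆ = ⁅exprMat F d A, exprMat F d B⁆ := by
  rw [Ring.lie_def, Ring.lie_def, map_sub, exprMat_mul, exprMat_mul]

/-- Only finitely many entries are nonzero, and each has an order bound independent of the
coordinate system. -/
theorem exists_inLevel_exprMat (A : glFin (DifProj n d)) :
    ∃ N k, ∀ F : Frame n, InLevel N k (exprMat F d A) := by
  obtain ⟨N, hN⟩ := A.2
  choose k hk using fun i j => exists_hasOrd_exprOp (A.1 i j)
  refine ⟨N, (Finset.range N ×ˢ Finset.range N).sup fun p => k p.1 p.2,
    fun F => ⟨fun i j hij => ?_, fun i j => ?_⟩⟩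
  · rw [exprMat_apply, hN i j hij, F.exprOp_zero]
  · rw [exprMat_apply]
    by_cases hij : N ≤ i ∨ N ≤ j
    · rw [hN i j hij, F.exprOp_zero]
      exact OrderLE.zero _
    · refine ((hk i j) F).orderLE.mono ?_
      have : (i, j) ∈ Finset.range N ×ˢ Finset.range N := by
        simp only [Finset.mem_product, Finset.mem_range]
        omega
      exact Finset.le_sup (f := fun p : ℕ × ℕ => k p.1 p.2) this

theorem exists_inLevel_exprMat_family {ι : Type*} [Finite ι] (A : ι → glFin (DifProj n d)) :
    ∃ N k, ∀ (i : ι) (F : Frame n), InLevel N k (exprMat F d (A i)) := by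
  cases nonempty_fintype ι
  choose N k h using fun i => exists_inLevel_exprMat (A i)
  exact ⟨Finset.univ.sup N, Finset.univ.sup k, fun i F =>
    (h i F).mono (Finset.le_sup (Finset.mem_univ i)) (Finset.le_sup (Finset.mem_univ i))⟩

theorem truncScalar_apply {R : Type*} [Ring R] [Algebra ℂ R] (N : ℕ) (a : R) (i j : ℕ) :
    (truncScalar N a).1 i j = if i = j ∧ i < N then a else 0 := rfl

theorem truncScalar_bound {R : Type*} [Ring R] [Algebra ℂ R] (N : ℕ) (a : R) (i j : ℕ)
    (hij : N ≤ i ∨ N ≤ j) : (truncScalar N a).1 i j = 0 :=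
  if_neg (by omega)

theorem truncScalar_mul {R : Type*} [Ring R] [Algebra ℂ R] {N : ℕ} (a : R) {M : glFin R}
    (hM : ∀ i j, (N ≤ i ∨ N ≤ j) → M.1 i j = 0) (i j : ℕ) :
    (truncScalar N a * M).1 i j = a * M.1 i j := by
  rw [glFin_mul_apply i j (truncScalar_bound N a)]
  by_cases hi : i < N
  · rw [Finset.sum_eq_single i]
    · simp [truncScalar_apply, hi]
    · intro k _ hk
      rw [truncScalar_apply, if_neg (fun h => hk h.1.symm), zero_mul]
    · simp [hi]
  · rw [hM i j (Or.inl (not_lt.1 hi)), mul_zero]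
    refine Finset.sum_eq_zero fun k _ => ?_
    rw [truncScalar_apply, if_neg (fun h => hi h.2), zero_mul]

theorem mul_truncScalar {R : Type*} [Ring R] [Algebra ℂ R] {N : ℕ} (a : R) {M : glFin R}
    (hM : ∀ i j, (N ≤ i ∨ N ≤ j) → M.1 i j = 0) (i j : ℕ) :
    (M * truncScalar N a).1 i j = M.1 i j * a := by
  rw [glFin_mul_apply i j hM]
  by_cases hj : j < N
  · rw [Finset.sum_eq_single j]
    · simp [truncScalar_apply, hj]
    · intro k _ hk
      rw [truncScalar_apply, if_neg (fun h => hk h.1), mul_zero]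
    · simp [hj]
  · rw [hM i j (Or.inr (not_lt.1 hj)), zero_mul]
    refine Finset.sum_eq_zero fun k _ => ?_
    rw [truncScalar_apply, if_neg (by omega), mul_zero]

/-- On matrices of size at most `N` the truncation acts like the infinite scalar matrix, so its
bracket is the entrywise commutator. -/
theorem truncScalar_lie_apply {R : Type*} [Ring R] [Algebra ℂ R] {N : ℕ} (a : R) {M : glFin R}
    (hM : ∀ i j, (N ≤ i ∨ N ≤ j) → M.1 i j = 0) (i j : ℕ) :
    (⁅truncScalar N a, M⁆).1 i j = a * M.1 i j - M.1 i j * a := by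
  rw [Ring.lie_def, glFin_sub_apply, truncScalar_mul a hM, mul_truncScalar a hM]

theorem inLevel_truncScalar {N : ℕ} {a : Dif n} (ha : OrderLE 1 a.1) {k : ℕ} (hk : 1 ≤ k) :
    InLevel N k (truncScalar N a) := by
  refine ⟨truncScalar_bound N a, fun i j => ?_⟩
  rw [truncScalar_apply]
  split_ifs
  · exact ha.mono hk
  · exact OrderLE.zero _

theorem truncScalar_add {R : Type*} [Ring R] [Algebra ℂ R] (N : ℕ) (a b : R) :
    truncScalar N (a + b) = truncScalar N a + truncScalar N b := by
  refine glFin_ext fun i j => ?_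
  change _ = (truncScalar N a).1 i j + (truncScalar N b).1 i j
  simp only [truncScalar_apply]
  split_ifs <;> simp

theorem truncScalar_smul {R : Type*} [Ring R] [Algebra ℂ R] (N : ℕ) (c : ℂ) (a : R) :
    truncScalar N (c • a) = c • truncScalar N a := by
  refine glFin_ext fun i j => ?_
  change _ = c • (truncScalar N a).1 i j
  simp only [truncScalar_apply]
  split_ifs <;> simp

/-- `truncScalar` as a linear map. -/
def truncLin (R : Type*) [Ring R] [Algebra ℂ R] (N : ℕ) : R →ₗ[ℂ] glFin R where
  toFun := truncScalar N
  map_add' := truncScalar_add N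
  map_smul' := truncScalar_smul N

end Matrices

/-! ### The arguments of the cochain along a family -/

section Tuples

variable {n : ℕ} {d : ℤ} {E : Type} [NormedAddCommGroup E] [NormedSpace ℝ E] {S : Set E}
  {Φ : E → Frame n} {y : E} {q Q : ℕ}

/-- The first `r` arguments are the velocities of the family in the given directions, the others
are matrices of global operators. -/
def tuple (Φ : E → Frame n) (S : Set E) (N r : ℕ) (u : Fin Q → E)
    (A : Fin Q → glFin (DifProj n d)) (y : E) (i : Fin Q) : glFin (Dif n) :=
  if (i : ℕ) < r then truncScalar N (velOp d Φ S y (u i)) else exprMat (Φ y) d (A i)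

variable {N N' k r : ℕ} {u : Fin Q → E} {A : Fin Q → glFin (DifProj n d)}

theorem inLevel_tuple (hΦ : SmoothFamily d Φ S) (hS : UniqueDiffOn ℝ S) (hy : y ∈ S) (hk : 1 ≤ k)
    (hN : N ≤ N') (hA : ∀ i (F : Frame n), InLevel N' k (exprMat F d (A i))) (i : Fin Q) :
    InLevel N' k (tuple Φ S N r u A y i) := by
  rw [tuple]
  split_ifs
  · exact (inLevel_truncScalar (hΦ.isVel hS hy _).hasOrd.orderLE hk).mono hN le_rfl
  · exact hA _ _

theorem contDiffWithinAt_jet_tuple (hΦ : SmoothFamily d Φ S) (hS : UniqueDiffOn ℝ S) (hy : y ∈ S)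
    (s : Finset (JetIndex n)) (i : Fin Q) :
    ContDiffWithinAt ℝ ∞ (fun y => jet s (tuple Φ S N r u A y i)) S y := by
  refine contDiffWithinAt_pi.2 fun c => ?_
  simp only [jet_apply, tuple]
  split_ifs
  · simp only [truncScalar_apply]
    split_ifs
    · exact RegOp.entry (c := smoothClass S hy) (hΦ.regOp_velOp hS hy _) _ _
    · exact contDiffWithinAt_const
  · exact RegOp.entry (c := smoothClass S hy) (hΦ.regOp_exprOp hy _) _ _

/-- On `S` the cochain is an alternating form in finitely many Taylor coefficients, each smooth
along the family. -/
theorem contDiffOn_cochain_tuple {η : glFin (Dif n) [⋀^Fin q]→ₗ[ℂ] ℂ}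
    (hη : IsContinuousCochain η) (hΦ : SmoothFamily d Φ S) (hS : UniqueDiffOn ℝ S) (hk : 1 ≤ k)
    (hN : N ≤ N') (hA : ∀ i (F : Frame n), InLevel N' k (exprMat F d (A i))) (e : Fin q → Fin Q) :
    ContDiffOn ℝ ∞ (fun y => η fun a => tuple Φ S N r u A y (e a)) S := by
  obtain ⟨s, κ, hκ⟩ := hη.exists_jet N' k
  have h1 : ∀ y ∈ S, (η fun a => tuple Φ S N r u A y (e a)) =
      κ fun a => jet s (tuple Φ S N r u A y (e a)) := fun y hy =>
    hκ _ fun a => inLevel_tuple hΦ hS hy hk hN hA _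
  refine ContDiffOn.congr (fun y hy => ?_) h1
  exact contDiffWithinAt_form κ fun a => contDiffWithinAt_jet_tuple hΦ hS hy s _

/-- Flatness when both arguments are velocities, parallelism when the second is a matrix of global
operators; there is no derivative in the direction of an operator argument. -/
theorem jet_lie_tuple (hΦ : SmoothFamily d Φ S) (hS : UniqueDiffOn ℝ S) (hy : y ∈ S)
    (hSy : S ∈ 𝓝 y) (hk : 1 ≤ k) (hA : ∀ i (F : Frame n), InLevel N k (exprMat F d (A i)))
    (s : Finset (JetIndex n)) {i j : Fin Q} (hi : (i : ℕ) < r) :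
    fderivWithin ℝ (fun y => jet s (tuple Φ S N r u A y j)) S y (u i) -
        (if (j : ℕ) < r then fderivWithin ℝ (fun y => jet s (tuple Φ S N r u A y i)) S y (u j)
          else 0) =
      jet s ⁅tuple Φ S N r u A y i, tuple Φ S N r u A y j⁆ := by
  have hd : ∀ l : Fin Q, ∀ v, ∀ c, fderivWithin ℝ (fun y => jet s (tuple Φ S N r u A y l)) S y v c =
      fderivWithin ℝ (fun y => jet s (tuple Φ S N r u A y l) c) S y v := by
    intro l v c
    have h1 := (contDiffWithinAt_jet_tuple (N := N) (r := r) (u := u) (A := A) hΦ hS hy s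
      l).differentiableWithinAt (by simp)
    have h2 := hasFDerivWithinAt_pi'.1 h1.hasFDerivWithinAt c
    rw [h2.fderivWithin (hS y hy)]
    rfl
  funext c
  have hlev := inLevel_tuple (N := N) (r := r) (u := u) (Q := Q) hΦ hS hy hk le_rfl hA j
  have hxi : tuple Φ S N r u A y i = truncScalar N (velOp d Φ S y (u i)) := by
    rw [tuple, if_pos hi]
  rw [Pi.sub_apply, hd, jet_apply, hxi, truncScalar_lie_apply _ hlev.1]
  by_cases hj : (j : ℕ) < r
  · rw [if_pos hj, hd]
    simp only [jet_apply, tuple, if_pos hi, if_pos hj, truncScalar_apply]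
    split_ifs with h
    · exact hΦ.flat hS hy hSy _ _ _ _
    · simp [entry]
  · rw [if_neg hj]
    simp only [jet_apply, tuple, if_neg hj, exprMat_apply, Pi.zero_apply, sub_zero]
    exact hΦ.parallel hS hy _ _ _ _

/-- The exterior derivative of the form that a cochain defines along a family. -/
theorem sum_fderivWithin_cochain {η : glFin (Dif n) [⋀^Fin q]→ₗ[ℂ] ℂ}
    (hη : IsContinuousCochain η) (hΦ : SmoothFamily d Φ S) (hS : UniqueDiffOn ℝ S) (hy : y ∈ S)
    (hSy : S ∈ 𝓝 y) (hk : 1 ≤ k) {u : Fin (q + 1) → E} {A : Fin (q + 1) → glFin (DifProj n d)}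
    (hA : ∀ i (F : Frame n), InLevel N k (exprMat F d (A i))) :
    ∑ i : Fin (q + 1), (if (i : ℕ) < r then (-1) ^ (i : ℕ) *
        fderivWithin ℝ (fun y => η fun a => tuple Φ S N r u A y (i.succAbove a)) S y (u i) else 0) =
      -∑ j : Fin (q + 1), ∑ i ∈ Finset.Iio j, (if (i : ℕ) < r then (-1) ^ (j : ℕ) *
        η (fun a => Function.update (tuple Φ S N r u A y) i
          ⁅tuple Φ S N r u A y i, tuple Φ S N r u A y j⁆ (j.succAbove a)) else 0) := by
  -- The level must also accommodate brackets of two arguments of order `k`.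
  obtain ⟨s, κ, hκ⟩ := hη.exists_jet N (k + k)
  have hlev : ∀ y ∈ S, ∀ i, InLevel N k (tuple Φ S N r u A y i) := fun y hy i =>
    inLevel_tuple hΦ hS hy hk le_rfl hA i
  have hdiff : ∀ i, DifferentiableWithinAt ℝ (fun y => jet s (tuple Φ S N r u A y i)) S y :=
    fun i => (contDiffWithinAt_jet_tuple hΦ hS hy s i).differentiableWithinAt (by simp)
  set D : Fin (q + 1) → Fin (q + 1) → (s → ℂ) := fun i l => if (i : ℕ) < r then
    fderivWithin ℝ (fun y => jet s (tuple Φ S N r u A y l)) S y (u i) else 0 with hD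
  have key := alternating_sum_derivative κ (fun i => jet s (tuple Φ S N r u A y i)) D
  have h1 : ∀ i : Fin (q + 1), (if (i : ℕ) < r then (-1) ^ (i : ℕ) *
      fderivWithin ℝ (fun y => η fun a => tuple Φ S N r u A y (i.succAbove a)) S y (u i) else 0) =
      (-1) ^ (i : ℕ) * ∑ a, κ (Function.update
        (fun l => jet s (tuple Φ S N r u A y (i.succAbove l))) a (D i (i.succAbove a))) := by
    intro i
    split_ifs with hi
    · have h2 : fderivWithin ℝ (fun y => η fun a => tuple Φ S N r u A y (i.succAbove a)) S y =
          fderivWithin ℝ (fun y => κ fun a => jet s (tuple Φ S N r u A y (i.succAbove a))) S y :=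
        fderivWithin_congr' (fun y hy => hκ _ fun a => (hlev y hy _).mono le_rfl (by omega)) hy
      rw [h2, fderivWithin_form κ (fun a => hdiff _) (hS y hy)]
      simp only [hD, if_pos hi]
    · rw [Finset.sum_eq_zero, mul_zero]
      intro a _
      simp only [hD, if_neg hi]
      exact AlternatingMap.map_coord_zero _ a (Function.update_self _ _ _)
  rw [Finset.sum_congr rfl fun i _ => h1 i, key]
  congr 1
  refine Finset.sum_congr rfl fun j _ => Finset.sum_congr rfl fun i hi => ?_
  have hij : i < j := Finset.mem_Iio.1 hi
  split_ifs with hir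
  · have h3 : D i j - D j i = jet s ⁅tuple Φ S N r u A y i, tuple Φ S N r u A y j⁆ := by
      rw [← jet_lie_tuple hΦ hS hy hSy hk hA s hir]
      simp only [hD, if_pos hir]
    rw [h3, hκ]
    · congr 2
      funext a
      by_cases ha : j.succAbove a = i
      · rw [ha, Function.update_self, Function.update_self]
      · rw [Function.update_of_ne ha, Function.update_of_ne ha]
    · intro a
      by_cases ha : j.succAbove a = i
      · rw [ha, Function.update_self]
        exact (hlev y hy i).lie (hlev y hy j)
      · rw [Function.update_of_ne ha]
        exact (hlev y hy _).mono le_rfl (by omega)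
  -- Brackets of two operator arguments do not occur: neither of their positions carries a direction
  -- of differentiation.
  · have hjr : ¬(j : ℕ) < r := by
      have : (i : ℕ) < j := hij
      omega
    obtain ⟨a, ha⟩ := Fin.exists_succAbove_eq hij.ne
    rw [AlternatingMap.map_coord_zero _ a, mul_zero]
    rw [ha, Function.update_self]
    simp only [hD, if_neg hir, if_neg hjr, sub_zero]

end Tuples

/-! ### Averages over tori -/

section Averages

open MeasureTheory

variable {n : ℕ}

/-- The period box of the torus. -/
def box (n : ℕ) : Set (Fin n → ℝ) := Set.Icc 0 (fun _ => 2 * Real.pi)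

theorem isCompact_box : IsCompact (box n) := isCompact_Icc

theorem measurableSet_box : MeasurableSet (box n) := measurableSet_Icc

/-- The basis of the period lattice. -/
def periodBasis (n : ℕ) : Module.Basis (Fin n) ℝ (Fin n → ℝ) :=
  (Pi.basisFun ℝ (Fin n)).isUnitSMul (w := fun _ => 2 * Real.pi)
    fun _ => (isUnit_iff_ne_zero.2 Real.two_pi_pos.ne')

theorem periodBasis_apply (k : Fin n) : periodBasis n k = Pi.single k (2 * Real.pi) := by
  rw [periodBasis, Module.Basis.isUnitSMul_apply, Pi.basisFun_apply, ← Pi.single_smul, smul_eq_mul,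
    mul_one]

theorem fundamentalDomain_periodBasis :
    ZSpan.fundamentalDomain (periodBasis n) = Set.pi Set.univ fun _ => Set.Ico 0 (2 * Real.pi) := by
  ext θ
  have h : ∀ k, (periodBasis n).repr θ k = (2 * Real.pi)⁻¹ * θ k := fun k => by
    have h1 : θ = ∑ i, ((2 * Real.pi)⁻¹ * θ i) • periodBasis n i := by
      simp only [periodBasis_apply]
      rw [← Finset.univ_sum_single θ]
      refine Finset.sum_congr rfl fun i _ => ?_
      rw [← Pi.single_smul, Finset.univ_sum_single, smul_eq_mul]
      congr 1
      field_simp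
    conv_lhs => rw [h1]
    rw [Module.Basis.repr_sum_self]
  simp only [ZSpan.mem_fundamentalDomain, h, Set.mem_pi, Set.mem_univ, true_imp_iff, Set.mem_Ico]
  refine forall_congr' fun k => ?_
  have hp := Real.two_pi_pos
  rw [inv_mul_lt_iff₀ hp, mul_one, mul_nonneg_iff_of_pos_left (inv_pos.2 hp)]

theorem setIntegral_box (H : (Fin n → ℝ) → ℂ) :
    ∫ θ in box n, H θ = ∫ θ in ZSpan.fundamentalDomain (periodBasis n), H θ := by
  rw [fundamentalDomain_periodBasis]
  refine setIntegral_congr_set ?_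
  exact (Measure.univ_pi_Ico_ae_eq_Icc (f := fun _ => 0) (g := fun _ => 2 * Real.pi)).symm

/-- The box is, up to a null set, a fundamental domain of the period lattice; so is its translate,
and a periodic function has the same integral over both. -/
theorem setIntegral_box_add {H : (Fin n → ℝ) → ℂ}
    (hper : ∀ θ k, H (θ + Pi.single k (2 * Real.pi)) = H θ) (a : Fin n → ℝ) :
    ∫ θ in box n, H (θ + a) = ∫ θ in box n, H θ := by
  have h1 := ZSpan.isAddFundamentalDomain (periodBasis n) (volume : Measure (Fin n → ℝ))
  have h2 := h1.vadd_of_comm a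
  have hinv : ∀ (g : Submodule.span ℤ (Set.range (periodBasis n))) (θ : Fin n → ℝ),
      H (g +ᵥ θ) = H θ := by
    rintro ⟨g, hg⟩ θ
    change H (g + θ) = H θ
    induction hg using Submodule.span_induction generalizing θ with
    | mem x hx =>
      obtain ⟨k, rfl⟩ := hx
      rw [periodBasis_apply, add_comm, hper]
    | zero => rw [zero_add]
    | add x y _ _ hx hy => rw [add_assoc, hx, hy]
    | smul c x _ hx =>
      have h3 : ∀ m : ℕ, ∀ θ, H (m • x + θ) = H θ := by
        intro m
        induction m with
        | zero => simp
        | succ m ih =>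
          intro θ
          rw [add_smul, one_smul, add_assoc, ih, hx]
      obtain ⟨m, rfl | rfl⟩ := c.eq_nat_or_neg
      · rw [natCast_zsmul, h3]
      · rw [neg_smul, natCast_zsmul]
        conv_rhs => rw [← add_neg_cancel_left (m • x) θ, h3]
  have hV : VAddInvariantMeasure (Submodule.span ℤ (Set.range (periodBasis n))) (Fin n → ℝ)
      volume := inferInstanceAs <|
    VAddInvariantMeasure (Submodule.span ℤ (Set.range (periodBasis n))).toAddSubgroup _ volume
  rw [setIntegral_box, setIntegral_box, ← h2.setIntegral_eq h1 hinv]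
  have h4 := (measurePreserving_vadd a (volume : Measure (Fin n → ℝ))).setIntegral_image_emb
    (measurableEmbedding_const_vadd a) H (ZSpan.fundamentalDomain (periodBasis n))
  refine Eq.trans ?_ h4.symm
  simp only [vadd_eq_add, add_comm]

/-- Translation by `ρ • c` does not change the integral over the torus. Averaging over `ρ` and
exchanging the integrals leaves the inner averages, which are zero. -/
theorem setIntegral_box_eq_zero {H : (Fin n → ℝ) → ℂ} (hH : Continuous H)
    (hper : ∀ θ k, H (θ + Pi.single k (2 * Real.pi)) = H θ) (c : Fin n → ℝ)
    (havg : ∀ θ, ∫ ρ in (0 : ℝ)..2 * Real.pi, H (θ + ρ • c) = 0) : ∫ θ in box n, H θ = 0 := by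
  have hp := Real.two_pi_pos
  have h1 : ∫ ρ in Set.Icc (0 : ℝ) (2 * Real.pi), ∫ θ in box n, H (θ + ρ • c) =
      ∫ θ in box n, ∫ ρ in Set.Icc (0 : ℝ) (2 * Real.pi), H (θ + ρ • c) := by
    refine integral_integral_swap ?_
    rw [Measure.prod_restrict]
    refine ContinuousOn.integrableOn_compact (isCompact_Icc.prod isCompact_box) ?_
    exact (hH.comp (by fun_prop)).continuousOn
  have h2 : ∀ θ, ∫ ρ in Set.Icc (0 : ℝ) (2 * Real.pi), H (θ + ρ • c) = 0 := fun θ => by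
    rw [integral_Icc_eq_integral_Ioc, ← intervalIntegral.integral_of_le hp.le, havg]
  simp only [h2, setIntegral_box_add hper] at h1
  simp only [integral_const, smul_zero] at h1
  have h3 : (volume.restrict (Set.Icc (0 : ℝ) (2 * Real.pi))).real Set.univ = 2 * Real.pi := by
    simp [hp.le]
  rw [h3] at h1
  exact (smul_eq_zero.1 h1).resolve_left hp.ne'

end Averages

/-! ### Stokes' formula on the product of a torus and a simplex -/

section Simplex

open MeasureTheory

variable {n : ℕ}

/-- The closed simplex. -/
def simplex (n : ℕ) : Set (Fin n → ℝ) := {s | (∀ k, 0 ≤ s k) ∧ ∑ k, s k ≤ 1}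

/-- The open simplex. -/
def openSimplex (n : ℕ) : Set (Fin n → ℝ) := {s | (∀ k, 0 < s k) ∧ ∑ k, s k < 1}

theorem openSimplex_subset : openSimplex n ⊆ simplex n := fun _ hs =>
  ⟨fun k => (hs.1 k).le, hs.2.le⟩

theorem isOpen_openSimplex : IsOpen (openSimplex n) := by
  have h : openSimplex n = (⋂ k, {s | 0 < s k}) ∩ {s | ∑ k, s k < 1} := by
    ext s
    simp [openSimplex]
  rw [h]
  exact (isOpen_iInter_of_finite fun k => isOpen_lt continuous_const (continuous_apply k)).inter
    (isOpen_lt (by fun_prop) continuous_const)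

theorem isClosed_simplex : IsClosed (simplex n) := by
  have h : simplex n = (⋂ k, {s | 0 ≤ s k}) ∩ {s | ∑ k, s k ≤ 1} := by
    ext s
    simp [simplex]
  rw [h]
  exact (isClosed_iInter fun k => isClosed_le continuous_const (continuous_apply k)).inter
    (isClosed_le (by fun_prop) continuous_const)

theorem isCompact_simplex : IsCompact (simplex n) := by
  refine (isCompact_Icc (a := (0 : Fin n → ℝ)) (b := fun _ => 1)).of_isClosed_subset
    isClosed_simplex fun s hs => ⟨fun k => hs.1 k, fun k => ?_⟩
  exact (Finset.single_le_sum (fun i _ => hs.1 i) (Finset.mem_univ k)).trans hs.2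

theorem convex_simplex : Convex ℝ (simplex n) := by
  rintro s ⟨hs, hs'⟩ t ⟨ht, ht'⟩ a b ha hb hab
  refine ⟨fun k => ?_, ?_⟩
  · have := hs k
    have := ht k
    simp only [Pi.add_apply, Pi.smul_apply, smul_eq_mul]
    positivity
  · simp only [Pi.add_apply, Pi.smul_apply, smul_eq_mul, Finset.sum_add_distrib, ← Finset.mul_sum]
    nlinarith

theorem openSimplex_nonempty : (openSimplex n).Nonempty := by
  refine ⟨fun _ => ((n : ℝ) + 1)⁻¹, fun k => by positivity, ?_⟩
  rw [Finset.sum_const, Finset.card_univ, Fintype.card_fin, nsmul_eq_mul, ← div_eq_mul_inv,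
    div_lt_one (by positivity)]
  exact lt_add_one _

/-- Angles times the closed simplex. -/
def closedDomain (n : ℕ) : Set ((Fin n → ℝ) × (Fin n → ℝ)) := Set.univ ×ˢ simplex n

theorem closedDomain_mem_nhds {θ s : Fin n → ℝ} (hs : s ∈ openSimplex n) :
    closedDomain n ∈ 𝓝 (θ, s) :=
  prod_mem_nhds Filter.univ_mem
    (Filter.mem_of_superset (isOpen_openSimplex.mem_nhds hs) openSimplex_subset)

theorem uniqueDiffOn_closedDomain : UniqueDiffOn ℝ (closedDomain n) := by
  refine uniqueDiffOn_convex (convex_univ.prod convex_simplex) ?_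
  obtain ⟨s, hs⟩ := openSimplex_nonempty (n := n)
  exact ⟨(0, s), mem_interior_iff_mem_nhds.2 (closedDomain_mem_nhds hs)⟩

theorem paramDomain_eq : paramDomain n = box n ×ˢ openSimplex n := rfl

theorem paramDomain_subset : paramDomain n ⊆ box n ×ˢ simplex n :=
  Set.prod_mono le_rfl openSimplex_subset

theorem ContinuousOn.integrableOn_paramDomain {H : (Fin n → ℝ) × (Fin n → ℝ) → ℂ}
    (hH : ContinuousOn H (closedDomain n)) : IntegrableOn H (paramDomain n) :=
  (ContinuousOn.integrableOn_compact (isCompact_box.prod isCompact_simplex)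
    (hH.mono (Set.prod_mono (Set.subset_univ _) le_rfl))).mono_set paramDomain_subset

/-- A function that vanishes precisely on the boundary of the simplex. -/
def bdryFun (s : Fin n → ℝ) : ℝ := (1 - ∑ k, s k) * ∏ k, s k

theorem contDiff_bdryFun : ContDiff ℝ ∞ (bdryFun (n := n)) := by
  unfold bdryFun
  have h1 : ContDiff ℝ ∞ fun s : Fin n → ℝ => ∏ k, s k :=
    contDiff_prod fun k _ => contDiff_apply ℝ ℝ k
  have h2 : ContDiff ℝ ∞ fun s : Fin n → ℝ => ∑ k, s k :=
    ContDiff.sum fun k _ => contDiff_apply ℝ ℝ k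
  exact (contDiff_const.sub h2).mul h1

theorem bdryFun_pos {s : Fin n → ℝ} (hs : s ∈ openSimplex n) : 0 < bdryFun s :=
  mul_pos (sub_pos.2 hs.2) (Finset.prod_pos fun k _ => hs.1 k)

theorem bdryFun_eq_zero {s : Fin n → ℝ} (hs : s ∈ simplex n) (hs' : s ∉ openSimplex n) :
    bdryFun s = 0 := by
  by_cases h : ∃ k, s k = 0
  · obtain ⟨k, hk⟩ := h
    rw [bdryFun, Finset.prod_eq_zero (Finset.mem_univ k) hk, mul_zero]
  · push Not at h
    have h1 : ∑ k, s k = 1 := by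
      by_contra h1
      exact hs' ⟨fun k => lt_of_le_of_ne (hs.1 k) (h k).symm, lt_of_le_of_ne hs.2 h1⟩
    rw [bdryFun, h1, sub_self, zero_mul]

theorem fderiv_bdryFun (s : Fin n → ℝ) (k : Fin n) :
    fderiv ℝ bdryFun s (Pi.single k 1) =
      (1 - ∑ l, s l) * ∏ l ∈ Finset.univ.erase k, s l - ∏ l, s l := by
  have h1 : HasFDerivAt (fun s : Fin n → ℝ => ∏ l, s l) _ s :=
    hasFDerivAt_finsetProd (𝕜 := ℝ)
  have h2 : HasFDerivAt (fun s : Fin n → ℝ => 1 - ∑ l, s l) _ s :=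
    (HasFDerivAt.fun_sum (u := Finset.univ) fun l _ => hasFDerivAt_apply (𝕜 := ℝ) l s).const_sub 1
  have h3 : fderiv ℝ bdryFun s = _ := (h2.mul h1).fderiv
  rw [h3]
  simp [Pi.single_apply]
  ring

/-- Cutoff functions of the simplex. -/
def cutoff (ε : ℝ) (s : Fin n → ℝ) : ℝ := Real.smoothTransition (bdryFun s / ε - 1)

theorem contDiff_cutoff (ε : ℝ) : ContDiff ℝ ∞ (cutoff (n := n) ε) :=
  Real.smoothTransition.contDiff.comp ((contDiff_bdryFun.div_const ε).sub contDiff_const)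

theorem cutoff_eq_zero {ε : ℝ} (hε : 0 < ε) {s : Fin n → ℝ} (h : bdryFun s ≤ ε) :
    cutoff ε s = 0 := by
  refine Real.smoothTransition.zero_of_nonpos ?_
  rw [sub_nonpos, div_le_one hε]
  exact h

theorem cutoff_eq_one {ε : ℝ} (hε : 0 < ε) {s : Fin n → ℝ} (h : 2 * ε ≤ bdryFun s) :
    cutoff ε s = 1 := by
  refine Real.smoothTransition.one_of_one_le ?_
  rw [le_sub_iff_add_le, le_div_iff₀ hε]
  linarith

theorem cutoff_mem (ε : ℝ) (s : Fin n → ℝ) : ‖cutoff ε s‖ ≤ 1 := by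
  rw [Real.norm_eq_abs, abs_le]
  exact ⟨(by norm_num : (-1 : ℝ) ≤ 0).trans (Real.smoothTransition.nonneg _),
    Real.smoothTransition.le_one _⟩

/-- The derivative vanishes unless `x` lies between `1` and `2`. With `x = bdryFun s / ε`, this
bounds the gradient of the cutoff uniformly in `ε`, once a factor `bdryFun s` is available. -/
theorem exists_bound_deriv_transition :
    ∃ C, 0 ≤ C ∧ ∀ x : ℝ, |deriv Real.smoothTransition (x - 1) * x| ≤ C := by
  have hc : Continuous fun x : ℝ => deriv Real.smoothTransition (x - 1) * x :=
    ((Real.smoothTransition.contDiff (n := 1)).continuous_deriv le_rfl).comp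
      (continuous_id.sub continuous_const) |>.mul continuous_id
  obtain ⟨C, hC⟩ := (isCompact_Icc (a := (1 : ℝ)) (b := 2)).exists_bound_of_continuousOn
    hc.continuousOn
  refine ⟨max C 0, le_max_right _ _, fun x => ?_⟩
  by_cases h1 : x < 1
  · have : Real.smoothTransition =ᶠ[𝓝 (x - 1)] fun _ => 0 := by
      filter_upwards [Iio_mem_nhds (show x - 1 < 0 by linarith)] with y hy
      exact Real.smoothTransition.zero_of_nonpos (le_of_lt hy)
    rw [this.deriv_eq]
    simp
  by_cases h2 : 2 < x
  · have : Real.smoothTransition =ᶠ[𝓝 (x - 1)] fun _ => 1 := by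
      filter_upwards [Ioi_mem_nhds (show 1 < x - 1 by linarith)] with y hy
      exact Real.smoothTransition.one_of_one_le (le_of_lt hy)
    rw [this.deriv_eq]
    simp
  · exact (hC x ⟨not_lt.1 h1, not_lt.1 h2⟩).trans (le_max_left _ _)

theorem fderiv_cutoff (ε : ℝ) (s v : Fin n → ℝ) :
    fderiv ℝ (cutoff ε) s v =
      deriv Real.smoothTransition (bdryFun s / ε - 1) * (fderiv ℝ bdryFun s v / ε) := by
  have h1 : HasFDerivAt (fun s : Fin n → ℝ => bdryFun s / ε - 1)
      (ε⁻¹ • fderiv ℝ bdryFun s) s := by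
    have := ((contDiff_bdryFun (n := n)).differentiable (by simp) s).hasFDerivAt.mul_const ε⁻¹
    exact this.sub_const 1
  have h2 : HasDerivAt Real.smoothTransition _ (bdryFun s / ε - 1) :=
    ((Real.smoothTransition.contDiff (n := 1)).differentiable (by simp) _).hasDerivAt
  have h3 : fderiv ℝ (cutoff ε) s = _ := (h2.comp_hasFDerivAt s h1).fderiv
  rw [h3]
  simp only [smul_apply, smul_eq_mul]
  ring

/-- The gradient of the cutoff is harmless on fields that are tangent to the boundary. -/
theorem norm_sum_fderiv_cutoff_le {C L ε : ℝ}
    (hC : ∀ x : ℝ, |deriv Real.smoothTransition (x - 1) * x| ≤ C) (hL : 0 ≤ L) (hε : 0 < ε)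
    {s : Fin n → ℝ} (hs : s ∈ openSimplex n) {Y : Fin n → ℂ} (h1 : ∀ k, ‖Y k‖ ≤ L * s k)
    (h2 : ‖∑ k, Y k‖ ≤ L * (1 - ∑ k, s k)) :
    ‖∑ k, (fderiv ℝ (cutoff ε) s (Pi.single k 1) : ℂ) * Y k‖ ≤ C * ((n + 1) * L) := by
  set D := deriv Real.smoothTransition (bdryFun s / ε - 1) with hD
  have hsum : ∑ k, (fderiv ℝ (cutoff ε) s (Pi.single k 1) : ℂ) * Y k =
      ((D / ε : ℝ) : ℂ) * (∑ k, (((1 - ∑ l, s l) * ∏ l ∈ Finset.univ.erase k, s l : ℝ) : ℂ) * Y k -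
        ((∏ l, s l : ℝ) : ℂ) * ∑ k, Y k) := by
    rw [Finset.mul_sum, ← Finset.sum_sub_distrib, Finset.mul_sum]
    refine Finset.sum_congr rfl fun k _ => ?_
    rw [fderiv_cutoff, fderiv_bdryFun, ← hD]
    push_cast
    ring
  have hb := bdryFun_pos hs
  have ht : 0 < 1 - ∑ l, s l := sub_pos.2 hs.2
  have hprod : ∀ t : Finset (Fin n), 0 < ∏ l ∈ t, s l := fun t =>
    Finset.prod_pos fun l _ => hs.1 l
  -- The linear vanishing of `Y` restores the barycentric factor that differentiation removed from
  -- `bdryFun`: once for each `k`, and once for the zeroth coordinate, hence `n + 1`.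
  have h3 : ‖∑ k, (((1 - ∑ l, s l) * ∏ l ∈ Finset.univ.erase k, s l : ℝ) : ℂ) * Y k -
        ((∏ l, s l : ℝ) : ℂ) * ∑ k, Y k‖ ≤ (n + 1) * L * bdryFun s := by
    refine (norm_sub_le _ _).trans ?_
    have h4 : ‖∑ k, (((1 - ∑ l, s l) * ∏ l ∈ Finset.univ.erase k, s l : ℝ) : ℂ) * Y k‖ ≤
        ∑ k : Fin n, L * bdryFun s := by
      refine (norm_sum_le _ _).trans (Finset.sum_le_sum fun k _ => ?_)
      rw [norm_mul, Complex.norm_real, Real.norm_of_nonneg (mul_pos ht (hprod _)).le]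
      refine (mul_le_mul_of_nonneg_left (h1 k) (mul_pos ht (hprod _)).le).trans (le_of_eq ?_)
      rw [bdryFun, ← Finset.mul_prod_erase _ _ (Finset.mem_univ k)]
      ring
    have h5 : ‖((∏ l, s l : ℝ) : ℂ) * ∑ k, Y k‖ ≤ L * bdryFun s := by
      rw [norm_mul, Complex.norm_real, Real.norm_of_nonneg (hprod _).le]
      refine (mul_le_mul_of_nonneg_left h2 (hprod _).le).trans (le_of_eq ?_)
      rw [bdryFun]
      ring
    rw [Finset.sum_const, Finset.card_univ, Fintype.card_fin, nsmul_eq_mul] at h4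
    linarith
  rw [hsum, norm_mul, Complex.norm_real]
  refine (mul_le_mul_of_nonneg_left h3 (norm_nonneg _)).trans ?_
  have h6 : ‖D / ε‖ * ((n + 1) * L * bdryFun s) = |D * (bdryFun s / ε)| * ((n + 1) * L) := by
    rw [Real.norm_eq_abs, abs_div, abs_mul, abs_div, abs_of_pos hε, abs_of_pos hb]
    ring
  rw [h6]
  exact mul_le_mul_of_nonneg_right (hC _) (by positivity)

theorem integral_fderiv_eq_zero {f : (Fin n → ℝ) → ℂ} (hf : ContDiff ℝ 1 f)
    (hc : HasCompactSupport f) (v : Fin n → ℝ) : ∫ s, fderiv ℝ f s v = 0 := by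
  have h1 : Integrable fun s => fderiv ℝ f s v :=
    ((hf.continuous_fderiv (by simp)).clm_apply continuous_const).integrable_of_hasCompactSupport
      (hc.fderiv_apply ℝ v)
  have h2 : Integrable f := hf.continuous.integrable_of_hasCompactSupport hc
  have := integral_mul_fderiv_eq_neg_fderiv_mul_of_integrable (μ := volume) (𝕜 := ℂ)
    (f := f) (g := fun _ => 1) (v := v) (by simpa using h1) (by simp) (by simpa using h2)
    (fun s _ => hf.differentiable (by simp) s) (fun s _ => differentiableAt_const _)
  simpa using this.symm

/-- Integration by parts against the cutoff. -/
theorem integral_cutoff_mul_fderiv {κ : (Fin n → ℝ) → ℂ} (hκ : ContDiffOn ℝ 1 κ (openSimplex n))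
    {ε : ℝ} (hε : 0 < ε) (v : Fin n → ℝ) :
    ∫ s in openSimplex n, ((cutoff ε s : ℂ) * fderiv ℝ κ s v +
      (fderiv ℝ (cutoff ε) s v : ℂ) * κ s) = 0 := by
  set f : (Fin n → ℝ) → ℂ := (openSimplex n).indicator fun s => (cutoff ε s : ℂ) * κ s with hf
  -- Near a boundary point `bdryFun` is below `ε`, so the cutoff vanishes; the extension by zero is
  -- therefore `C¹` on the whole space and boundary terms never appear.
  have hzero : ∀ s ∉ openSimplex n, f =ᶠ[𝓝 s] fun _ => 0 := by
    intro s hs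
    by_cases hs' : s ∈ simplex n
    · have hb : ∀ᶠ t in 𝓝 s, bdryFun t < ε :=
        (contDiff_bdryFun (n := n)).continuous.continuousAt.eventually_lt continuousAt_const
          (by rw [bdryFun_eq_zero hs' hs]; exact hε)
      filter_upwards [hb] with t ht
      rw [hf, Set.indicator_apply_eq_zero]
      intro _
      rw [cutoff_eq_zero hε ht.le]
      simp
    · filter_upwards [isClosed_simplex.isOpen_compl.mem_nhds hs'] with t ht
      exact Set.indicator_of_notMem (fun h => ht (openSimplex_subset h)) _
  have hone : ∀ s ∈ openSimplex n, f =ᶠ[𝓝 s] fun s => (cutoff ε s : ℂ) * κ s := by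
    intro s hs
    filter_upwards [isOpen_openSimplex.mem_nhds hs] with t ht
    exact Set.indicator_of_mem ht _
  have hcut : ContDiff ℝ 1 fun s : Fin n → ℝ => (cutoff ε s : ℂ) :=
    Complex.ofRealCLM.contDiff.comp ((contDiff_cutoff ε).of_le (by simp))
  have hfC : ContDiff ℝ 1 f := by
    rw [contDiff_iff_contDiffAt]
    intro s
    by_cases hs : s ∈ openSimplex n
    · refine ContDiffAt.congr_of_eventuallyEq ?_ (hone s hs)
      exact hcut.contDiffAt.mul (hκ.contDiffAt (isOpen_openSimplex.mem_nhds hs))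
    · exact contDiffAt_const.congr_of_eventuallyEq (hzero s hs)
  have hcs : HasCompactSupport f := HasCompactSupport.intro isCompact_simplex fun s hs =>
    Set.indicator_of_notMem (fun h => hs (openSimplex_subset h)) _
  rw [← integral_fderiv_eq_zero hfC hcs v, ← integral_indicator isOpen_openSimplex.measurableSet]
  congr 1
  funext s
  by_cases hs : s ∈ openSimplex n
  · rw [Set.indicator_of_mem hs]
    have h1 : HasFDerivAt (fun s : Fin n → ℝ => (cutoff ε s : ℂ))
        (Complex.ofRealCLM ∘L fderiv ℝ (cutoff ε) s) s :=
      Complex.ofRealCLM.hasFDerivAt.comp s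
        ((contDiff_cutoff (n := n) ε).differentiable (by simp) s).hasFDerivAt
    have h2 := ((hκ.contDiffAt (isOpen_openSimplex.mem_nhds hs)).differentiableAt
      (by simp)).hasFDerivAt
    rw [(hone s hs).fderiv_eq, (h1.fun_mul h2).fderiv]
    simp
    ring
  · rw [Set.indicator_of_notMem hs, (hzero s hs).fderiv_eq]
    simp

end Simplex

/-! ### Exact forms on the torus times the simplex -/

section Stokes

open MeasureTheory

variable {n : ℕ}

theorem ContDiffOn.continuousOn_fderivWithin_closedDomain
    {H : (Fin n → ℝ) × (Fin n → ℝ) → ℂ} (hH : ContDiffOn ℝ ∞ H (closedDomain n))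
    (v : (Fin n → ℝ) × (Fin n → ℝ)) :
    ContinuousOn (fun p => fderivWithin ℝ H (closedDomain n) p v) (closedDomain n) :=
  (hH.continuousOn_fderivWithin uniqueDiffOn_closedDomain (by simp)).clm_apply continuousOn_const

theorem hasFDerivAt_closedDomain {H : (Fin n → ℝ) × (Fin n → ℝ) → ℂ}
    (hH : ContDiffOn ℝ ∞ H (closedDomain n)) {θ s : Fin n → ℝ} (hs : s ∈ openSimplex n) :
    HasFDerivAt H (fderivWithin ℝ H (closedDomain n) (θ, s)) (θ, s) := by
  have hmem := closedDomain_mem_nhds (θ := θ) hs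
  rw [fderivWithin_of_mem_nhds hmem]
  exact ((hH.contDiffAt hmem).differentiableAt (by simp)).hasFDerivAt

theorem setIntegral_paramDomain {H : (Fin n → ℝ) × (Fin n → ℝ) → ℂ}
    (hH : IntegrableOn H (paramDomain n)) :
    ∫ p in paramDomain n, H p = ∫ s in openSimplex n, ∫ θ in box n, H (θ, s) := by
  rw [paramDomain_eq, Measure.volume_eq_prod, ← Measure.prod_restrict]
  refine integral_prod_symm H ?_
  rw [Measure.prod_restrict]
  exact hH

theorem setIntegral_paramDomain' {H : (Fin n → ℝ) × (Fin n → ℝ) → ℂ}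
    (hH : IntegrableOn H (paramDomain n)) :
    ∫ p in paramDomain n, H p = ∫ θ in box n, ∫ s in openSimplex n, H (θ, s) := by
  rw [paramDomain_eq, Measure.volume_eq_prod, ← Measure.prod_restrict]
  refine integral_prod H ?_
  rw [Measure.prod_restrict]
  exact hH

/-- Derivatives in the directions of the torus integrate to zero. -/
theorem integral_fderivWithin_angle {G : (Fin n → ℝ) × (Fin n → ℝ) → ℂ}
    (hG : ContDiffOn ℝ ∞ G (closedDomain n))
    (hper : ∀ θ s l, s ∈ simplex n → G (θ + Pi.single l (2 * Real.pi), s) = G (θ, s)) (k : Fin n) :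
    ∫ p in paramDomain n, fderivWithin ℝ G (closedDomain n) p (Pi.single k 1, 0) = 0 := by
  have hc := ContDiffOn.continuousOn_fderivWithin_closedDomain hG (Pi.single k 1, 0)
  rw [setIntegral_paramDomain (ContinuousOn.integrableOn_paramDomain hc)]
  refine (setIntegral_congr_fun isOpen_openSimplex.measurableSet fun s hs => ?_).trans
    (integral_zero _ _)
  have hcont : Continuous fun θ => fderivWithin ℝ G (closedDomain n) (θ, s) (Pi.single k 1, 0) := by
    rw [← continuousOn_univ]
    exact hc.comp (by fun_prop) fun θ _ => ⟨trivial, openSimplex_subset hs⟩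
  refine setIntegral_box_eq_zero hcont (fun θ l => ?_) (Pi.single k 1) fun θ => ?_
  · have h1 := hasFDerivAt_closedDomain hG (θ := θ + Pi.single l (2 * Real.pi)) hs
    have h2 : HasFDerivAt (fun p : (Fin n → ℝ) × (Fin n → ℝ) =>
        p + (Pi.single l (2 * Real.pi), 0)) (ContinuousLinearMap.id ℝ _) (θ, s) :=
      (hasFDerivAt_id _).add_const _
    have h3 : HasFDerivAt (fun p => G (p + (Pi.single l (2 * Real.pi), 0)))
        (fderivWithin ℝ G (closedDomain n) (θ + Pi.single l (2 * Real.pi), s)) (θ, s) := by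
      have h4 : HasFDerivAt G (fderivWithin ℝ G (closedDomain n)
          (θ + Pi.single l (2 * Real.pi), s)) ((θ, s) + (Pi.single l (2 * Real.pi), 0)) := by
        simpa using h1
      exact h4.comp (θ, s) h2
    have h5 : (fun p => G (p + (Pi.single l (2 * Real.pi), 0))) =ᶠ[𝓝 (θ, s)] G := by
      filter_upwards [closedDomain_mem_nhds (θ := θ) hs] with p hp
      rw [← hper p.1 p.2 l hp.2]
      congr 1
      simp [Prod.ext_iff]
    rw [(h3.congr_of_eventuallyEq h5.symm).unique (hasFDerivAt_closedDomain hG hs)]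
  · have h1 : ∀ ρ : ℝ, HasDerivAt (fun ρ : ℝ => G (θ + ρ • Pi.single k 1, s))
        (fderivWithin ℝ G (closedDomain n) (θ + ρ • Pi.single k 1, s) (Pi.single k 1, 0)) ρ := by
      intro ρ
      have h2 : HasDerivAt (fun ρ : ℝ => (θ + ρ • (Pi.single k 1 : Fin n → ℝ), s))
          (Pi.single k 1, 0) ρ := by
        refine HasDerivAt.prodMk ?_ (hasDerivAt_const _ _)
        simpa using ((hasDerivAt_id ρ).smul_const (Pi.single k 1 : Fin n → ℝ)).const_add θ
      exact (hasFDerivAt_closedDomain hG hs).comp_hasDerivAt ρ h2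
    rw [intervalIntegral.integral_eq_sub_of_hasDerivAt (fun ρ _ => h1 ρ)]
    · rw [← Pi.single_smul, smul_eq_mul, mul_one, hper θ s k (openSimplex_subset hs), zero_smul,
        add_zero, sub_self]
    · exact (hcont.comp (by fun_prop)).intervalIntegrable _ _

theorem continuous_slice {K : (Fin n → ℝ) × (Fin n → ℝ) → ℂ}
    (hK : ContinuousOn K (closedDomain n)) {s : Fin n → ℝ} (hs : s ∈ simplex n) :
    Continuous fun θ => K (θ, s) := by
  rw [← continuousOn_univ]
  exact hK.comp (by fun_prop) fun θ _ => ⟨trivial, hs⟩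

theorem integrableOn_slice {K : (Fin n → ℝ) × (Fin n → ℝ) → ℂ}
    (hK : ContinuousOn K (closedDomain n)) {s : Fin n → ℝ} (hs : s ∈ simplex n) :
    IntegrableOn (fun θ => K (θ, s)) (box n) :=
  (continuous_slice hK hs).continuousOn.integrableOn_compact isCompact_box

/-- Torus integrals depend in a Lipschitz way on the point of the simplex. -/
theorem exists_lipschitz_torus_integral {K : (Fin n → ℝ) × (Fin n → ℝ) → ℂ}
    (hK : ContDiffOn ℝ ∞ K (closedDomain n)) :
    ∃ L, 0 ≤ L ∧ ∀ s ∈ simplex n, ∀ s' ∈ simplex n,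
      ‖(∫ θ in box n, K (θ, s)) - ∫ θ in box n, K (θ, s')‖ ≤ L * ‖s - s'‖ := by
  have hsub : box n ×ˢ simplex n ⊆ closedDomain n := Set.prod_mono (Set.subset_univ _) le_rfl
  obtain ⟨C, hC⟩ := (isCompact_box.prod isCompact_simplex).exists_bound_of_continuousOn
    ((hK.continuousOn_fderivWithin uniqueDiffOn_closedDomain (by simp)).mono hsub)
  have hconv : Convex ℝ (box n ×ˢ simplex n) := (convex_Icc _ _).prod convex_simplex
  refine ⟨max C 0 * (volume : Measure (Fin n → ℝ)).real (box n), by positivity,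
    fun s hs s' hs' => ?_⟩
  rw [← integral_sub (integrableOn_slice hK.continuousOn hs)
    (integrableOn_slice hK.continuousOn hs')]
  have h1 : ∀ θ ∈ box n, ‖K (θ, s) - K (θ, s')‖ ≤ max C 0 * ‖s - s'‖ := fun θ hθ => by
    have h2 := hconv.norm_image_sub_le_of_norm_hasFDerivWithin_le (f := K)
      (f' := fderivWithin ℝ K (closedDomain n)) (C := max C 0) (fun p hp =>
        (((hK p (hsub hp)).differentiableWithinAt (by simp)).hasFDerivWithinAt).mono hsub)
      (fun p hp => (hC p hp).trans (le_max_left _ _)) (x := (θ, s')) (y := (θ, s))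
      ⟨hθ, hs'⟩ ⟨hθ, hs⟩
    refine h2.trans (le_of_eq ?_)
    congr 1
    simp [Prod.norm_def]
  refine (norm_setIntegral_le_of_norm_le_const isCompact_box.measure_lt_top h1).trans
    (le_of_eq (by ring))

/-- Derivatives in the directions of the simplex integrate to zero, if the fluxes through
the facets vanish. -/
theorem integral_fderivWithin_simplex (hn : 1 ≤ n) {K : Fin n → (Fin n → ℝ) × (Fin n → ℝ) → ℂ}
    (hK : ∀ k, ContDiffOn ℝ ∞ (K k) (closedDomain n))
    (hface : ∀ k s, s k = 0 → (∀ l ≠ k, 0 < s l) → ∑ l, s l < 1 → ∫ θ in box n, K k (θ, s) = 0)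
    (hface' : ∀ s : Fin n → ℝ, (∀ l, 0 < s l) → ∑ l, s l = 1 →
      ∫ θ in box n, ∑ k, K k (θ, s) = 0) :
    ∫ p in paramDomain n, ∑ k, fderivWithin ℝ (K k) (closedDomain n) p (0, Pi.single k 1) = 0 := by
  set Kb : Fin n → (Fin n → ℝ) → ℂ := fun k s => ∫ θ in box n, K k (θ, s) with hKb
  choose L hL0 hL using fun k => exists_lipschitz_torus_integral (hK k)
  set Λ := ∑ k, L k with hΛ
  have hΛ0 : 0 ≤ Λ := Finset.sum_nonneg fun k _ => hL0 k
  have hLΛ : ∀ k, L k ≤ Λ := fun k => Finset.single_le_sum (fun k _ => hL0 k) (Finset.mem_univ k)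
  -- Compare with the point of the facet obtained by setting `s k` to zero, at distance `s k`, where
  -- the torus integral vanishes.
  have hb1 : ∀ s ∈ openSimplex n, ∀ k, ‖Kb k s‖ ≤ Λ * s k := by
    intro s hs k
    set s' := Function.update s k 0 with hs'
    have hk0 : s' k = 0 := Function.update_self _ _ _
    have hl : ∀ l ≠ k, s' l = s l := fun l hl => Function.update_of_ne hl _ _
    have hsum : ∑ l, s' l < 1 := by
      refine lt_of_le_of_lt (Finset.sum_le_sum fun l _ => ?_) hs.2
      rcases eq_or_ne l k with rfl | h
      · rw [hk0]; exact (hs.1 l).le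
      · rw [hl l h]
    have hpos : ∀ l ≠ k, 0 < s' l := fun l h => by rw [hl l h]; exact hs.1 l
    have hmem : s' ∈ simplex n := by
      refine ⟨fun l => ?_, hsum.le⟩
      rcases eq_or_ne l k with rfl | h
      · rw [hk0]
      · exact (hpos l h).le
    have h1 := hL k s (openSimplex_subset hs) s' hmem
    rw [hface k s' hk0 hpos hsum, sub_zero] at h1
    refine h1.trans (mul_le_mul (hLΛ k) ?_ (norm_nonneg _) hΛ0)
    refine (pi_norm_le_iff_of_nonneg (hs.1 k).le).2 fun l => ?_
    rcases eq_or_ne l k with rfl | h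
    · rw [Pi.sub_apply, hk0, sub_zero, Real.norm_of_nonneg (hs.1 l).le]
    · rw [Pi.sub_apply, hl l h, sub_self, norm_zero]
      exact (hs.1 k).le
  have hb2 : ∀ s ∈ openSimplex n, ‖∑ k, Kb k s‖ ≤ Λ * (1 - ∑ k, s k) := by
    intro s hs
    have ht : 0 < 1 - ∑ k, s k := sub_pos.2 hs.2
    have hn0 : (0 : ℝ) < n := by exact_mod_cast hn
    -- The missing mass is shared equally, which reaches the interior of the slanted facet without
    -- leaving the simplex.
    set s' : Fin n → ℝ := fun l => s l + (1 - ∑ k, s k) / n with hs'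
    have hsum : ∑ l, s' l = 1 := by
      rw [hs', Finset.sum_add_distrib, Finset.sum_const, Finset.card_univ, Fintype.card_fin,
        nsmul_eq_mul]
      field_simp
      ring
    have hpos : ∀ l, 0 < s' l := fun l => add_pos (hs.1 l) (div_pos ht hn0)
    have hmem : s' ∈ simplex n := ⟨fun l => (hpos l).le, hsum.le⟩
    have h1 := hface' s' hpos hsum
    rw [integral_finsetSum _ fun k _ => integrableOn_slice (hK k).continuousOn hmem] at h1
    have h2 : ∑ k, Kb k s = ∑ k, (Kb k s - Kb k s') := by
      rw [Finset.sum_sub_distrib, h1, sub_zero]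
    rw [h2, hΛ, Finset.sum_mul]
    refine (norm_sum_le _ _).trans (Finset.sum_le_sum fun k _ => ?_)
    refine (hL k s (openSimplex_subset hs) s' hmem).trans
      (mul_le_mul_of_nonneg_left ?_ (hL0 k))
    refine (pi_norm_le_iff_of_nonneg ht.le).2 fun l => ?_
    rw [Pi.sub_apply, hs', sub_add_cancel_left, norm_neg, Real.norm_of_nonneg (by positivity)]
    exact div_le_self ht.le (by exact_mod_cast hn)
  set dK : (Fin n → ℝ) × (Fin n → ℝ) → ℂ := fun p =>
    ∑ k, fderivWithin ℝ (K k) (closedDomain n) p (0, Pi.single k 1) with hdK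
  have hdKc : ContinuousOn dK (closedDomain n) := continuousOn_finsetSum _ fun k _ =>
    ContDiffOn.continuousOn_fderivWithin_closedDomain (hK k) _
  have hcutc : ∀ ε, Continuous fun s : Fin n → ℝ => (cutoff ε s : ℂ) := fun ε =>
    Complex.continuous_ofReal.comp (contDiff_cutoff ε).continuous
  have hdcutc : ∀ ε k, Continuous fun s : Fin n → ℝ =>
      (fderiv ℝ (cutoff ε) s (Pi.single k 1) : ℂ) := fun ε k =>
    Complex.continuous_ofReal.comp
      (((contDiff_cutoff ε).continuous_fderiv (by simp)).clm_apply continuous_const)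
  -- Integration by parts moves the derivatives onto the cutoff. That factor is independent of the
  -- angles, so only the torus integrals `Kb` remain.
  have key : ∀ ε, 0 < ε → ∫ p in paramDomain n, (cutoff ε p.2 : ℂ) * dK p =
      -∫ s in openSimplex n, ∑ k, (fderiv ℝ (cutoff ε) s (Pi.single k 1) : ℂ) * Kb k s := by
    intro ε hε
    have hc1 : ContinuousOn (fun p => (cutoff ε p.2 : ℂ) * dK p) (closedDomain n) :=
      ((hcutc ε).comp continuous_snd).continuousOn.mul hdKc
    have hc2 : ∀ k, ContinuousOn (fun p : (Fin n → ℝ) × (Fin n → ℝ) =>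
        (fderiv ℝ (cutoff ε) p.2 (Pi.single k 1) : ℂ) * K k p) (closedDomain n) := fun k =>
      ((hdcutc ε k).comp continuous_snd).continuousOn.mul (hK k).continuousOn
    have hc3 : ContinuousOn (fun p : (Fin n → ℝ) × (Fin n → ℝ) =>
        ∑ k, (fderiv ℝ (cutoff ε) p.2 (Pi.single k 1) : ℂ) * K k p) (closedDomain n) :=
      continuousOn_finsetSum _ fun k _ => hc2 k
    have h1 : ∫ p in paramDomain n, ((cutoff ε p.2 : ℂ) * dK p +
        ∑ k, (fderiv ℝ (cutoff ε) p.2 (Pi.single k 1) : ℂ) * K k p) = 0 := by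
      have hc4 : ∀ k, ContinuousOn (fun p : (Fin n → ℝ) × (Fin n → ℝ) => (cutoff ε p.2 : ℂ) *
          fderivWithin ℝ (K k) (closedDomain n) p (0, Pi.single k 1) +
          (fderiv ℝ (cutoff ε) p.2 (Pi.single k 1) : ℂ) * K k p) (closedDomain n) := fun k =>
        (((hcutc ε).comp continuous_snd).continuousOn.mul
          (ContDiffOn.continuousOn_fderivWithin_closedDomain (hK k) _)).add (hc2 k)
      simp only [hdK, Finset.mul_sum, ← Finset.sum_add_distrib]
      rw [integral_finsetSum _ fun k _ => ContinuousOn.integrableOn_paramDomain (hc4 k)]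
      refine Finset.sum_eq_zero fun k _ => ?_
      rw [setIntegral_paramDomain' (ContinuousOn.integrableOn_paramDomain (hc4 k))]
      refine (integral_congr_ae (Filter.Eventually.of_forall fun θ => ?_)).trans
        (integral_zero _ _)
      have hκ : ContDiffOn ℝ 1 (fun s => K k (θ, s)) (openSimplex n) :=
        ((hK k).of_le (by simp)).comp (by fun_prop) fun s hs => ⟨trivial, openSimplex_subset hs⟩
      refine Eq.trans (setIntegral_congr_fun isOpen_openSimplex.measurableSet fun s hs => ?_)
        (integral_cutoff_mul_fderiv hκ hε (Pi.single k 1))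
      have h2 : HasFDerivAt (fun s : Fin n → ℝ => (θ, s)) (ContinuousLinearMap.inr ℝ _ _) s :=
        hasFDerivAt_prodMk_right θ s
      have h3 := ((hasFDerivAt_closedDomain (hK k) hs).comp s h2).fderiv
      have h4 := congrArg (fun T => T (Pi.single k 1)) h3
      rw [← show fderiv ℝ (fun s => K k (θ, s)) s (Pi.single k 1) =
        fderivWithin ℝ (K k) (closedDomain n) (θ, s) (0, Pi.single k 1) from h4]
    rw [integral_add (ContinuousOn.integrableOn_paramDomain hc1)
      (ContinuousOn.integrableOn_paramDomain hc3)] at h1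
    rw [eq_neg_of_add_eq_zero_left h1,
      setIntegral_paramDomain (ContinuousOn.integrableOn_paramDomain hc3)]
    congr 1
    refine setIntegral_congr_fun isOpen_openSimplex.measurableSet fun s hs => ?_
    rw [integral_finsetSum _ fun k _ => integrableOn_slice (hc2 k) (openSimplex_subset hs)]
    refine Finset.sum_congr rfl fun k _ => ?_
    exact integral_const_mul (fderiv ℝ (cutoff ε) s (Pi.single k 1) : ℂ) fun θ => K k (θ, s)
  obtain ⟨C, hC0, hC⟩ := exists_bound_deriv_transition
  set ε : ℕ → ℝ := fun N => 1 / ((N : ℝ) + 1) with hε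
  have hεpos : ∀ N, 0 < ε N := fun N => by positivity
  have hεlim : Filter.Tendsto ε Filter.atTop (𝓝 0) := tendsto_one_div_add_atTop_nhds_zero_nat
  have hevent : ∀ s ∈ openSimplex n, ∀ᶠ N in Filter.atTop, 2 * ε N < bdryFun s := by
    intro s hs
    have := (hεlim.const_mul 2).eventually_lt_const (u := bdryFun s)
      (by rw [mul_zero]; exact bdryFun_pos hs)
    exact this
  have hmeasP : MeasurableSet (paramDomain n) :=
    measurableSet_box.prod isOpen_openSimplex.measurableSet
  have hlim1 : Filter.Tendsto (fun N => ∫ p in paramDomain n, (cutoff (ε N) p.2 : ℂ) * dK p)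
      Filter.atTop (𝓝 (∫ p in paramDomain n, dK p)) := by
    have hint := ContinuousOn.integrableOn_paramDomain hdKc
    refine tendsto_integral_of_dominated_convergence (fun p => ‖dK p‖) (fun N => ?_) hint.norm
      (fun N => ?_) ?_
    · exact (ContinuousOn.integrableOn_paramDomain
        (((hcutc (ε N)).comp continuous_snd).continuousOn.mul hdKc)).aestronglyMeasurable
    · refine Filter.Eventually.of_forall fun p => ?_
      rw [norm_mul, Complex.norm_real]
      exact mul_le_of_le_one_left (norm_nonneg _) (cutoff_mem _ _)
    · refine (ae_restrict_iff' hmeasP).2 (Filter.Eventually.of_forall fun p hp => ?_)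
      refine tendsto_const_nhds.congr' ?_
      filter_upwards [hevent p.2 hp.2] with N hN
      rw [cutoff_eq_one (hεpos N) hN.le]
      simp
  -- The gradient of the cutoff is eventually zero at every interior point, and paired with `Kb` it
  -- is bounded uniformly in `ε`: dominated convergence applies.
  have hlim2 : Filter.Tendsto (fun N => ∫ s in openSimplex n,
      ∑ k, (fderiv ℝ (cutoff (ε N)) s (Pi.single k 1) : ℂ) * Kb k s) Filter.atTop (𝓝 0) := by
    have hfin : (volume : Measure (Fin n → ℝ)) (openSimplex n) < ⊤ :=
      (measure_mono openSimplex_subset).trans_lt isCompact_simplex.measure_lt_top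
    have hKbc : ∀ k, ContinuousOn (Kb k) (simplex n) := fun k => by
      have : LipschitzOnWith (L k).toNNReal (Kb k) (simplex n) :=
        LipschitzOnWith.of_dist_le_mul fun s hs s' hs' => by
          rw [dist_eq_norm, dist_eq_norm, Real.coe_toNNReal _ (hL0 k)]
          exact hL k s hs s' hs'
      exact this.continuousOn
    rw [← integral_zero (Fin n → ℝ) ℂ (μ := volume.restrict (openSimplex n))]
    refine tendsto_integral_of_dominated_convergence (fun _ => C * ((n + 1) * Λ)) (fun N => ?_)
      (integrableOn_const hfin.ne) (fun N => ?_) ?_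
    · refine ContinuousOn.aestronglyMeasurable ?_ isOpen_openSimplex.measurableSet
      exact continuousOn_finsetSum _ fun k _ => (hdcutc (ε N) k).continuousOn.mul
        ((hKbc k).mono openSimplex_subset)
    · refine (ae_restrict_iff' isOpen_openSimplex.measurableSet).2
        (Filter.Eventually.of_forall fun s hs => ?_)
      exact norm_sum_fderiv_cutoff_le hC hΛ0 (hεpos N) hs (hb1 s hs) (hb2 s hs)
    · refine (ae_restrict_iff' isOpen_openSimplex.measurableSet).2
        (Filter.Eventually.of_forall fun s hs => ?_)
      refine tendsto_const_nhds.congr' ?_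
      filter_upwards [hevent s hs] with N hN
      have h1 : cutoff (ε N) =ᶠ[𝓝 s] fun _ => (1 : ℝ) := by
        filter_upwards [(contDiff_bdryFun (n := n)).continuous.continuousAt.eventually
          (Ioi_mem_nhds hN)] with t ht
        exact cutoff_eq_one (hεpos N) (le_of_lt ht)
      simp [h1.fderiv_eq]
  have hlim3 := hlim2.neg
  rw [neg_zero] at hlim3
  exact tendsto_nhds_unique hlim1 (hlim3.congr fun N => (key (ε N) (hεpos N)).symm)

end Stokes

/-! ### Translations of families of coordinate systems -/

section Translate

variable {n : ℕ} {d : ℤ} {E : Type} [NormedAddCommGroup E] [NormedSpace ℝ E] {S : Set E}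
  {Φ Φ' : E → Frame n} {y a : E}

theorem Frame.Equiv.refl (F : Frame n) : F.Equiv d F :=
  ⟨fun _ => 1, Filter.Eventually.of_forall fun _ => by simp⟩

/-- A translation has the identity as its derivative, and passing to equivalent coordinate systems
leaves the expansions unchanged. -/
theorem velOp_translate (hΦ : SmoothFamily d Φ S) (hS : UniqueDiffOn ℝ S)
    (ha : ∀ q ∈ S, q + a ∈ S) (hE : ∀ q ∈ S, (Φ (q + a)).Equiv d (Φ' q)) (hy : y ∈ S) (v : E) :
    velOp d Φ' S y v = velOp d Φ S (y + a) v := by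
  have h1 : velOp d (fun q => Φ (q + a)) S y v = velOp d Φ S (y + a) v := by
    have := hΦ.velOp_comp hS (ψ := fun q => q + a) (S' := S) (y' := y)
      (ψ' := ContinuousLinearMap.id ℝ E) ((hasFDerivWithinAt_id y S).add_const a) ha hy (hS y hy) v
    exact this
  have h2 := hΦ.isVel hS (ha y hy) v
  rw [← h1] at h2 ⊢
  have h3 : IsVel d (fun q => Φ (q + a)) S y v (velOp d (fun q => Φ (q + a)) S y v) := by
    refine ⟨h2.hasOrd, fun V f h0 => ?_⟩
    rw [h2.apply_expand V f h0]
    ext α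
    rw [coeff_dPS, coeff_dPS]
    have h4 := ((hΦ.regPS_expand (ha y hy) f h0).differentiableWithinAt α).hasFDerivWithinAt
    have h5 := (h4.comp y ((hasFDerivWithinAt_id y S).add_const a) ha).fderivWithin (hS y hy)
    exact (congrArg (fun L => L v) h5).symm
  refine IsVel.velOp_eq ⟨h3.hasOrd, fun V f h0 => ?_⟩
  have h0' := (hE y hy).lift_mem_iff.2 h0
  have h4 := h3.apply_expand V f h0'
  rw [← (hE y hy).expand_eq h0' f.2, h4]
  refine dPS_congr hy ?_
  have hev : ∀ᶠ q in 𝓝[S] y, (Φ (q + a)).lift 0 ∈ V.carrier := by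
    have h5 : Filter.Tendsto (fun q => q + a) (𝓝[S] y) (𝓝[S] (y + a)) :=
      tendsto_nhdsWithin_of_tendsto_nhds_of_eventually_within _
        ((continuous_id.add continuous_const).continuousAt.mono_left nhdsWithin_le_nhds)
        (eventually_mem_nhdsWithin.mono ha)
    exact h5.eventually (hΦ.eventually_mem (ha y hy) h0')
  filter_upwards [hev, self_mem_nhdsWithin] with q hq hqS
  exact (hE q hqS).expand_eq hq f.2

theorem exprMat_eq_of_equiv {F F' : Frame n} (h : F.Equiv d F') : exprMat F d = exprMat F' d :=
  LinearMap.ext fun A => glFin_ext fun i j => h.exprOp_eq (A.1 i j)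

theorem tuple_translate (hΦ : SmoothFamily d Φ S) (hS : UniqueDiffOn ℝ S)
    (ha : ∀ q ∈ S, q + a ∈ S) (hE : ∀ q ∈ S, (Φ (q + a)).Equiv d (Φ' q)) (hy : y ∈ S) {N r Q : ℕ}
    (u : Fin Q → E) (A : Fin Q → glFin (DifProj n d)) :
    tuple Φ' S N r u A y = tuple Φ S N r u A (y + a) := by
  funext i
  rw [tuple, tuple, velOp_translate hΦ hS ha hE hy, exprMat_eq_of_equiv (hE y hy)]

end Translate

/-! ### The families on the torus times the simplex, and near its facets -/

section Facets

variable {n : ℕ} {d : ℤ} {F : (Fin (n + 1) → ℂ) × (Fin (n + 1) → ℝ) → Frame n}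

/-- Barycentric coordinates. -/
def bary (s : Fin n → ℝ) : Fin (n + 1) → ℝ := Fin.cons (1 - ∑ k, s k) s

/-- The linear part of `bary`. -/
def baryLin (n : ℕ) : (Fin n → ℝ) →L[ℝ] (Fin (n + 1) → ℝ) :=
  ContinuousLinearMap.pi
    (Fin.cons (-∑ k, ContinuousLinearMap.proj k) fun k => ContinuousLinearMap.proj k)

theorem baryLin_zero (s : Fin n → ℝ) : baryLin n s 0 = -∑ k, s k := by
  simp [baryLin]

theorem baryLin_succ (s : Fin n → ℝ) (k : Fin n) : baryLin n s k.succ = s k := by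
  simp [baryLin]

theorem bary_zero (s : Fin n → ℝ) : bary s 0 = 1 - ∑ k, s k := rfl

theorem bary_succ (s : Fin n → ℝ) (k : Fin n) : bary s k.succ = s k := rfl

theorem bary_eq (s : Fin n → ℝ) : bary s = Pi.single 0 1 + baryLin n s := by
  funext k
  refine Fin.cases ?_ (fun k => ?_) k
  · rw [bary_zero, Pi.add_apply, baryLin_zero, Pi.single_eq_same, sub_eq_add_neg]
  · rw [bary_succ, Pi.add_apply, baryLin_succ, Pi.single_eq_of_ne (Fin.succ_ne_zero k), zero_add]

theorem contDiff_bary : ContDiff ℝ ∞ (bary (n := n)) := by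
  have h : bary (n := n) = fun s => Pi.single 0 1 + baryLin n s := funext bary_eq
  rw [h]
  exact contDiff_const.add (baryLin n).contDiff

theorem sum_bary (s : Fin n → ℝ) : ∑ k, bary s k = 1 := by
  rw [Fin.sum_univ_succ]
  simp [bary_zero, bary_succ]

theorem bary_mem_stdSimplex {s : Fin n → ℝ} (hs : ∀ k, 0 ≤ bary s k) :
    bary s ∈ stdSimplex ℝ (Fin (n + 1)) := ⟨hs, sum_bary s⟩

theorem mem_simplex_iff {s : Fin n → ℝ} : s ∈ simplex n ↔ ∀ k, 0 ≤ bary s k := by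
  rw [Fin.forall_fin_succ]
  simp only [bary_zero, bary_succ, simplex, Set.mem_ofPred_eq, sub_nonneg]
  exact and_comm

theorem torusSimplex_eq (p : (Fin n → ℝ) × (Fin n → ℝ)) : torusSimplex p =
    (fun k => Complex.exp (Complex.I * ((Fin.cons 0 p.1 : Fin (n + 1) → ℝ) k : ℝ)), bary p.2) := by
  refine Prod.ext ?_ rfl
  funext k
  refine Fin.cases ?_ (fun k => ?_) k <;> simp [torusSimplex]

theorem contDiff_torusSimplex : ContDiff ℝ ∞ (torusSimplex (n := n)) := by
  refine ContDiff.prodMk ?_ (contDiff_bary.comp contDiff_snd)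
  rw [contDiff_pi]
  intro k
  refine Fin.cases ?_ (fun k => ?_) k
  · exact contDiff_const
  · have h1 : ContDiff ℝ ∞ fun p : (Fin n → ℝ) × (Fin n → ℝ) => ((p.1 k : ℝ) : ℂ) :=
      Complex.ofRealCLM.contDiff.comp ((contDiff_apply ℝ ℝ k).comp contDiff_fst)
    exact (contDiff_const.mul h1).cexp

theorem torusSimplex_mem_piece {p : (Fin n → ℝ) × (Fin n → ℝ)} (hp : p ∈ closedDomain n) :
    torusSimplex p ∈ piece n Finset.univ := by
  refine ⟨fun i _ => ?_, bary_mem_stdSimplex (mem_simplex_iff.1 hp.2), fun i hi => ?_⟩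
  · rw [torusSimplex_eq]
    exact Complex.exp_ne_zero _
  · exact absurd (Finset.mem_univ i) hi

theorem IsAdmissible.smoothFamily (hF : IsAdmissible d F) :
    SmoothFamily d (fun p => F (torusSimplex p)) (closedDomain n) := by
  intro p hp
  obtain ⟨W, hW, h0, G, hE, hG⟩ := hF.smooth Finset.univ _ (torusSimplex_mem_piece hp)
  have hmaps : Set.MapsTo torusSimplex (torusSimplex ⁻¹' W ∩ closedDomain n)
      (W ∩ piece n Finset.univ) := fun q hq => ⟨hq.1, torusSimplex_mem_piece hq.2⟩
  refine ⟨torusSimplex ⁻¹' W, hW.preimage contDiff_torusSimplex.continuous, h0,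
    fun q => G (torusSimplex q), fun q hq => hE _ (hmaps hq), fun α => ⟨fun j => ?_, ?_⟩⟩
  · exact ((hG α).1 j).1.comp contDiff_torusSimplex.contDiffOn hmaps
  · exact (hG α).2.1.comp contDiff_torusSimplex.contDiffOn hmaps

/-- A vector transversal to a facet. -/
def facetNormal (n : ℕ) (j : Fin (n + 1)) : Fin n → ℝ :=
  Fin.cases (motive := fun _ => Fin n → ℝ) (fun _ => -(1 / (n : ℝ))) (fun k => Pi.single k 1) j

/-- This normalization makes `facetProj` land in the hyperplane `t_j = 0`; for `j = 0` it is the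
reason for the entries `-1/n`. -/
theorem baryLin_facetNormal (hn : 1 ≤ n) (j : Fin (n + 1)) :
    baryLin n (facetNormal n j) j = 1 := by
  refine Fin.cases ?_ (fun k => ?_) j
  · have : (n : ℝ) ≠ 0 := by positivity
    rw [baryLin_zero]
    simp [facetNormal, this]
  · rw [baryLin_succ]
    simp [facetNormal]

/-- The projection onto the hyperplane of a facet. -/
def facetProj (j : Fin (n + 1)) (s : Fin n → ℝ) : Fin n → ℝ := s - bary s j • facetNormal n j

/-- The linear part of `facetProj`. -/
def facetProjLin (n : ℕ) (j : Fin (n + 1)) : (Fin n → ℝ) →L[ℝ] (Fin n → ℝ) :=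
  ContinuousLinearMap.id ℝ _ -
    ((ContinuousLinearMap.proj j).comp (baryLin n)).smulRight (facetNormal n j)

theorem hasFDerivAt_facetProj (j : Fin (n + 1)) (s : Fin n → ℝ) :
    HasFDerivAt (facetProj j) (facetProjLin n j) s := by
  have h1 : HasFDerivAt (fun s : Fin n → ℝ => bary s j)
      ((ContinuousLinearMap.proj j).comp (baryLin n)) s := by
    simp only [bary_eq, Pi.add_apply]
    exact ((ContinuousLinearMap.proj (R := ℝ) j).comp (baryLin n)).hasFDerivAt.const_add _
  exact (hasFDerivAt_id s).sub (h1.smul_const _)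

theorem contDiff_facetProj (j : Fin (n + 1)) : ContDiff ℝ ∞ (facetProj (n := n) j) :=
  contDiff_id.sub (((contDiff_apply ℝ ℝ j).comp contDiff_bary).smul contDiff_const)

theorem facetProj_of_bary_eq_zero {j : Fin (n + 1)} {s : Fin n → ℝ} (h : bary s j = 0) :
    facetProj j s = s := by
  rw [facetProj, h, zero_smul, sub_zero]

theorem facetProjLin_of_tangent {j : Fin (n + 1)} {b : Fin n → ℝ} (h : baryLin n b j = 0) :
    facetProjLin n j b = b := by
  simp [facetProjLin, h]

theorem bary_facetProj (hn : 1 ≤ n) (j : Fin (n + 1)) (s : Fin n → ℝ) :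
    bary (facetProj j s) j = 0 := by
  have h := baryLin_facetNormal hn j
  rw [bary_eq, facetProj, map_sub, map_smul]
  simp only [Pi.add_apply, Pi.sub_apply, Pi.smul_apply, smul_eq_mul, h, mul_one]
  rw [bary_eq, Pi.add_apply]
  ring

/-- Parameters near a facet: all the angles, and the simplex. -/
abbrev FacetParam (n : ℕ) : Type := (Fin (n + 1) → ℝ) × (Fin n → ℝ)

/-- Points over the facet `j`, where the homogeneous coordinate `z_j` may take arbitrary values. -/
def facetPt (j : Fin (n + 1)) (q : ℂ × FacetParam n) : (Fin (n + 1) → ℂ) × (Fin (n + 1) → ℝ) :=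
  (fun k => (if k = j then q.1 else 1) * Complex.exp (Complex.I * (q.2.1 k : ℝ)),
    bary (facetProj j q.2.2))

/-- Parameters of the relative interior of the facet. -/
def facetDomain (n : ℕ) (j : Fin (n + 1)) : Set (FacetParam n) :=
  {y | ∀ k ≠ j, 0 < bary (facetProj j y.2) k}

theorem isOpen_facetDomain (j : Fin (n + 1)) : IsOpen (facetDomain n j) := by
  have h : facetDomain n j = ⋂ k, {y : FacetParam n | k ≠ j → 0 < bary (facetProj j y.2) k} := by
    ext y
    simp [facetDomain]
  rw [h]
  refine isOpen_iInter_of_finite fun k => ?_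
  by_cases hk : k = j
  · simp [hk]
  · simp only [ne_eq, hk, not_false_eq_true, true_imp_iff]
    exact isOpen_lt continuous_const (((continuous_apply k).comp contDiff_bary.continuous).comp
      ((contDiff_facetProj j).continuous.comp continuous_snd))

theorem contDiff_facetPt (j : Fin (n + 1)) : ContDiff ℝ ∞ (facetPt (n := n) j) := by
  refine ContDiff.prodMk ?_
    (contDiff_bary.comp ((contDiff_facetProj j).comp (contDiff_snd.comp contDiff_snd)))
  rw [contDiff_pi]
  intro k
  have h1 : ContDiff ℝ ∞ fun q : ℂ × FacetParam n => ((q.2.1 k : ℝ) : ℂ) :=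
    Complex.ofRealCLM.contDiff.comp
      ((contDiff_apply ℝ ℝ k).comp (contDiff_fst.comp contDiff_snd))
  refine ContDiff.mul ?_ (contDiff_const.mul h1).cexp
  split_ifs
  · exact contDiff_fst
  · exact contDiff_const

theorem facetPt_mem_piece (hn : 1 ≤ n) (j : Fin (n + 1)) (w : ℂ) {y : FacetParam n}
    (hy : y ∈ facetDomain n j) : facetPt j (w, y) ∈ piece n (Finset.univ.erase j) := by
  refine ⟨fun i hi => ?_, bary_mem_stdSimplex fun k => ?_, fun i hi => ?_⟩
  · have hij : i ≠ j := Finset.ne_of_mem_erase hi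
    simp [facetPt, hij, Complex.exp_ne_zero]
  · rcases eq_or_ne k j with rfl | hk
    · rw [bary_facetProj hn]
    · exact (hy k hk).le
  · have hij : i = j := by simpa using hi
    subst hij
    exact bary_facetProj hn i _

/-- The piece over the facet opposite to vertex `j` does not require `z_j ≠ 0`, so this coordinate
ranges over all of `ℂ`, and the holomorphy there becomes holomorphy in `w`. -/
theorem IsAdmissible.holFamily (hF : IsAdmissible d F) (hn : 1 ≤ n) (j : Fin (n + 1)) :
    HolFamily d (fun q => F (facetPt j q)) (facetDomain n j) := by
  intro w y hy
  obtain ⟨W, hW, h0, G, hE, hG⟩ := hF.smooth _ _ (facetPt_mem_piece hn j w hy)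
  set W' : Set (ℂ × FacetParam n) := facetPt j ⁻¹' W ∩ (Prod.snd ⁻¹' facetDomain n j) with hW'
  have hmaps : Set.MapsTo (facetPt j) W' (W ∩ piece n (Finset.univ.erase j)) := fun q hq =>
    ⟨hq.1, facetPt_mem_piece hn j q.1 hq.2⟩
  have hw : ∀ y : FacetParam n, Differentiable ℂ fun w => (facetPt j (w, y)).1 := fun y => by
    rw [differentiable_pi]
    intro k
    have h1 : Differentiable ℂ fun w : ℂ => if k = j then w else 1 := by
      split_ifs
      · exact differentiable_id
      · exact differentiable_const _
    exact h1.mul_const (Complex.exp (Complex.I * (y.1 k : ℝ)))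
  refine ⟨W', (hW.preimage (contDiff_facetPt j).continuous).inter
    ((isOpen_facetDomain j).preimage continuous_snd), ⟨h0, hy⟩, fun q => G (facetPt j q),
    fun q hq => hE _ (hmaps hq), fun α => ⟨fun l => ⟨?_, fun y => ?_⟩, ?_, fun y => ?_⟩⟩
  · exact ((hG α).1 l).1.comp (contDiff_facetPt j).contDiffOn hmaps
  · exact (((hG α).1 l).2 (bary (facetProj j y.2))).comp (hw y).differentiableOn
      fun w hw => hmaps (x := (w, y)) hw
  · exact (hG α).2.1.comp (contDiff_facetPt j).contDiffOn hmaps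
  · exact ((hG α).2.2 (bary (facetProj j y.2))).comp (hw y).differentiableOn
      fun w hw => hmaps (x := (w, y)) hw

/-- Along a facet the velocities in tangent directions are those of the family over the facet. -/
theorem IsAdmissible.velOp_facet (hF : IsAdmissible d F) (hn : 1 ≤ n) {j : Fin (n + 1)}
    {θ s : Fin n → ℝ} (hs : bary s j = 0) (hpos : ∀ k ≠ j, 0 < bary s k)
    {u : (Fin n → ℝ) × (Fin n → ℝ)} (hu : baryLin n u.2 j = 0) :
    velOp d (fun p => F (torusSimplex p)) (closedDomain n) (θ, s) u =
      velOp d (fun y => F (facetPt j (1, y))) (facetDomain n j) (Fin.cons 0 θ, s)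
        (Fin.cons 0 u.1, u.2) := by
  let ι : (Fin n → ℝ) →L[ℝ] (Fin (n + 1) → ℝ) :=
    ContinuousLinearMap.pi (Fin.cons 0 fun k => ContinuousLinearMap.proj k)
  have hι : ∀ θ, ι θ = Fin.cons 0 θ := fun θ => by
    funext k
    refine Fin.cases ?_ (fun k => ?_) k <;> simp [ι]
  set Ω' : Set ((Fin n → ℝ) × (Fin n → ℝ)) := (fun p => (ι p.1, p.2)) ⁻¹' facetDomain n j with hΩ'
  have hΩo : IsOpen Ω' := (isOpen_facetDomain j).preimage (by fun_prop)
  have hmem : (θ, s) ∈ Ω' := fun k hk => by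
    rw [facetProj_of_bary_eq_zero hs]
    exact hpos k hk
  -- One map factors both through the torus times the simplex and through the family over the facet.
  -- The chain rule for the two factorizations compares the velocities, since tangent directions are
  -- fixed by the projection.
  have hfun : (fun p : (Fin n → ℝ) × (Fin n → ℝ) => F (torusSimplex (p.1, facetProj j p.2))) =
      fun p => F (facetPt j (1, (ι p.1, p.2))) := by
    funext p
    rw [torusSimplex_eq, facetPt, hι]
    simp
  have h1 := (hF.smoothFamily).velOp_comp uniqueDiffOn_closedDomain
    (ψ := fun p : (Fin n → ℝ) × (Fin n → ℝ) => (p.1, facetProj j p.2)) (S' := Ω') (y' := (θ, s))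
    (ψ' := (ContinuousLinearMap.id ℝ _).prodMap (facetProjLin n j))
    (((hasFDerivAt_id θ).prodMap (θ, s) (hasFDerivAt_facetProj j s)).hasFDerivWithinAt)
    (fun p hp => ⟨trivial, mem_simplex_iff.2 fun k => by
      rcases eq_or_ne k j with rfl | hk
      · rw [bary_facetProj hn]
      · exact (hp k hk).le⟩) hmem (hΩo.uniqueDiffWithinAt hmem) u
  have h2 := ((hF.holFamily hn j).smoothFamily 1).velOp_comp
    (isOpen_facetDomain j).uniqueDiffOn (ψ := fun p : (Fin n → ℝ) × (Fin n → ℝ) => (ι p.1, p.2))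
    (S' := Ω') (y' := (θ, s)) (ψ' := ι.prodMap (ContinuousLinearMap.id ℝ _))
    ((ι.prodMap (ContinuousLinearMap.id ℝ (Fin n → ℝ))).hasFDerivAt (x := (θ, s))
      |>.hasFDerivWithinAt)
    (fun p hp => hp) hmem (hΩo.uniqueDiffWithinAt hmem) u
  rw [hfun, h2] at h1
  have h3 : ((ContinuousLinearMap.id ℝ (Fin n → ℝ)).prodMap (facetProjLin n j)) u = u :=
    Prod.ext rfl (facetProjLin_of_tangent hu)
  rw [h3, facetProj_of_bary_eq_zero hs] at h1
  have h4 : (ι.prodMap (ContinuousLinearMap.id ℝ (Fin n → ℝ))) u = (Fin.cons 0 u.1, u.2) :=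
    Prod.ext (hι _) rfl
  rw [← h1, h4]
  simp only [hι]

end Facets

/-! ### The fluxes through the facets -/

section Flux

open MeasureTheory

variable {n : ℕ} {d : ℤ} {F : (Fin (n + 1) → ℂ) × (Fin (n + 1) → ℝ) → Frame n}

theorem add_mem_facetDomain {j : Fin (n + 1)} (a : Fin (n + 1) → ℝ) :
    ∀ y ∈ facetDomain n j, y + (a, 0) ∈ facetDomain n j := fun y hy => by
  simpa [facetDomain] using hy

/-- Direction in which the torus is averaged for the facet `j`: the angle of `z_j`. -/
def facetShift (n : ℕ) (j : Fin (n + 1)) : Fin n → ℝ :=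
  Fin.cases (motive := fun _ => Fin n → ℝ) (fun _ => -1) (fun k => Pi.single k 1) j

/-- Up to a common factor, the shift multiplies `z_j` by `exp (i ρ)`. -/
theorem exists_facetPt_shift (j : Fin (n + 1)) (ρ : ℝ) : ∃ c : ℂ, c ≠ 0 ∧ ∀ y : FacetParam n,
    facetPt j (Complex.exp (ρ * Complex.I), y) =
      (c • (facetPt j (1, y + (Fin.cons 0 (ρ • facetShift n j), 0))).1,
        (facetPt j (1, y + (Fin.cons 0 (ρ • facetShift n j), 0))).2) := by
  -- The torus is normalized by `z_0 = 1`, so rotating `z_0` means rotating all other coordinates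
  -- backwards and then scaling everything.
  refine ⟨if j = 0 then Complex.exp (ρ * Complex.I) else 1, ?_, fun y => Prod.ext ?_ ?_⟩
  · split_ifs
    · exact Complex.exp_ne_zero _
    · exact one_ne_zero
  · funext k
    refine Fin.cases ?_ (fun k0 => ?_) j
    · refine Fin.cases ?_ (fun k => ?_) k
      · simp [facetPt]
      · simp only [facetPt, Fin.succ_ne_zero, if_false, if_true, Pi.smul_apply, smul_eq_mul,
          Prod.fst_add, Pi.add_apply, Fin.cons_succ, facetShift, Fin.cases_zero, one_mul,
          ← Complex.exp_add]
        congr 1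
        push_cast
        ring
    · refine Fin.cases ?_ (fun k => ?_) k
      · simp [facetPt, (Fin.succ_ne_zero k0).symm]
      · by_cases hk : k = k0
        · subst hk
          simp only [facetPt, if_true, Fin.succ_ne_zero, if_false, Pi.smul_apply, smul_eq_mul,
            Prod.fst_add, Pi.add_apply, Fin.cons_succ, facetShift, Fin.cases_succ, one_mul,
            ← Complex.exp_add, Pi.single_eq_same]
          congr 1
          push_cast
          ring
        · have hk' : k.succ ≠ k0.succ := fun h => hk (Fin.succ_injective _ h)
          simp [facetPt, hk, hk', facetShift]
  · simp [facetPt]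

theorem equiv_of_smul (hF : IsAdmissible d F) {I : Finset (Fin (n + 1))}
    {p p' : (Fin (n + 1) → ℂ) × (Fin (n + 1) → ℝ)} (hp : p ∈ piece n I) {c : ℂ} (hc : c ≠ 0)
    (h : p' = (c • p.1, p.2)) : (F p).Equiv d (F p') := h ▸ hF.wellDefined I p hp c hc

/-- Rotating all the coordinates does not change the point of projective space. -/
theorem velOp_diagonal (hF : IsAdmissible d F) (hn : 1 ≤ n) (j : Fin (n + 1)) (w : ℂ)
    {y : FacetParam n} (hy : y ∈ facetDomain n j) :
    velOp d (fun y => F (facetPt j (w, y))) (facetDomain n j) y ((fun _ => 1), 0) = 0 := by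
  refine ((hF.holFamily hn j).smoothFamily w).velOp_eq_zero
    ((isOpen_facetDomain j).mem_nhds hy) fun r => ?_
  refine equiv_of_smul hF (facetPt_mem_piece hn j w hy) (c := Complex.exp (Complex.I * r))
    (Complex.exp_ne_zero _) (Prod.ext ?_ ?_)
  · funext k
    have h1 : Complex.exp (Complex.I * ((y.1 k + r : ℝ) : ℂ)) =
        Complex.exp (Complex.I * r) * Complex.exp (Complex.I * (y.1 k : ℝ)) := by
      rw [← Complex.exp_add]
      congr 1
      push_cast
      ring
    simp only [facetPt, Prod.fst_add, Prod.smul_fst, Pi.add_apply, Pi.smul_apply, smul_eq_mul,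
      mul_one, h1]
    ring
  · simp [facetPt]

/-- When `z_j = 0` its angle does not affect the point. -/
theorem velOp_degenerate (hF : IsAdmissible d F) (hn : 1 ≤ n) (j : Fin (n + 1))
    {y : FacetParam n} (hy : y ∈ facetDomain n j) :
    velOp d (fun y => F (facetPt j (0, y))) (facetDomain n j) y (Pi.single j 1, 0) = 0 := by
  refine ((hF.holFamily hn j).smoothFamily 0).velOp_eq_zero
    ((isOpen_facetDomain j).mem_nhds hy) fun r => ?_
  have h : facetPt j (0, y + r • (Pi.single j (1 : ℝ), (0 : Fin n → ℝ))) = facetPt j (0, y) := by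
    refine Prod.ext ?_ ?_
    · funext k
      by_cases hk : k = j
      · simp [facetPt, hk]
      · simp [facetPt, hk]
    · simp [facetPt]
  rw [h]
  exact Frame.Equiv.refl _

/-- On the degenerate torus the velocities of the angles are linearly dependent. -/
theorem exists_dependent_velOp (hF : IsAdmissible d F) (hn : 1 ≤ n) (j : Fin (n + 1))
    {y : FacetParam n} (hy : y ∈ facetDomain n j) :
    ∃ c : Fin n → ℂ, c ≠ 0 ∧ ∑ k, c k • velOp d (fun y => F (facetPt j (0, y)))
      (facetDomain n j) y (Pi.single k.succ 1, 0) = 0 := by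
  have hS := (isOpen_facetDomain (n := n) j).uniqueDiffOn (𝕜 := ℝ)
  have hdeg := velOp_degenerate hF hn j hy
  revert hdeg
  refine Fin.cases (motive := fun i => i = j → _ → _) (fun hj hdeg => ?_)
    (fun k hj hdeg => ?_) j rfl
  · refine ⟨fun _ => 1, fun h => one_ne_zero (congrFun h ⟨0, hn⟩), ?_⟩
    have h1 := ((hF.holFamily hn j).smoothFamily 0).velOp_sum hS hy Finset.univ
      fun k : Fin (n + 1) => ((Pi.single k 1 : Fin (n + 1) → ℝ), (0 : Fin n → ℝ))
    have h2 : ∑ k : Fin (n + 1), ((Pi.single k 1 : Fin (n + 1) → ℝ), (0 : Fin n → ℝ)) =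
        ((fun _ => 1), 0) := by
      refine Prod.ext ?_ ?_
      · rw [Prod.fst_sum]
        exact Finset.univ_sum_single (fun _ : Fin (n + 1) => (1 : ℝ))
      · rw [Prod.snd_sum, Finset.sum_const_zero]
    rw [h2, velOp_diagonal hF hn j 0 hy, Fin.sum_univ_succ] at h1
    subst hj
    rw [hdeg, zero_add] at h1
    simpa using h1.symm
  · refine ⟨Pi.single k 1, fun h => one_ne_zero (α := ℂ) ?_, ?_⟩
    · rw [← Pi.single_eq_same (M := fun _ : Fin n => ℂ) k 1, h, Pi.zero_apply]
    rw [Finset.sum_eq_single k]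
    · subst hj
      rw [hdeg, smul_zero]
    · intro l _ hl
      rw [Pi.single_eq_of_ne hl, zero_smul]
    · simp

theorem torusSimplex_add_period (p : (Fin n → ℝ) × (Fin n → ℝ)) (l : Fin n) :
    torusSimplex (p + (Pi.single l (2 * Real.pi), 0)) = torusSimplex p := by
  refine Prod.ext ?_ (by simp [torusSimplex])
  funext i
  refine Fin.cases rfl (fun i => ?_) i
  by_cases hi : i = l
  · subst hi
    simp only [torusSimplex, Fin.cons_succ, Prod.fst_add, Pi.add_apply, Pi.single_eq_same]
    push_cast
    rw [mul_add, mul_comm Complex.I (2 * Real.pi : ℂ), Complex.exp_periodic]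
  · simp [torusSimplex, hi]

theorem tuple_periodic (hF : IsAdmissible d F) {θ s : Fin n → ℝ} (hs : s ∈ simplex n) (l : Fin n)
    {N r Q : ℕ} (u : Fin Q → (Fin n → ℝ) × (Fin n → ℝ)) (A : Fin Q → glFin (DifProj n d)) :
    tuple (fun p => F (torusSimplex p)) (closedDomain n) N r u A
        (θ + Pi.single l (2 * Real.pi), s) =
      tuple (fun p => F (torusSimplex p)) (closedDomain n) N r u A (θ, s) := by
  have h1 := tuple_translate hF.smoothFamily (Φ' := fun p => F (torusSimplex p))
    uniqueDiffOn_closedDomain (a := ((Pi.single l (2 * Real.pi) : Fin n → ℝ), (0 : Fin n → ℝ)))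
    (fun p hp => ⟨trivial, by simpa using hp.2⟩) (fun p _ => by
      rw [torusSimplex_add_period]
      exact Frame.Equiv.refl _) (y := (θ, s)) ⟨trivial, hs⟩ (N := N) (r := r) u A
  rw [h1]
  simp

variable {q N k r : ℕ} {η : glFin (Dif n) [⋀^Fin q]→ₗ[ℂ] ℂ}

/-- The flux form over a facet, as a function of the coordinate `z_j`. -/
def facetForm (F : (Fin (n + 1) → ℂ) × (Fin (n + 1) → ℝ) → Frame n)
    (η : glFin (Dif n) [⋀^Fin q]→ₗ[ℂ] ℂ) (N r : ℕ) (j : Fin (n + 1)) (i₀ : Fin (q + 1))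
    (u : Fin (q + 1) → FacetParam n) (A : Fin (q + 1) → glFin (DifProj n d)) (y : FacetParam n)
    (w : ℂ) : ℂ :=
  η fun a => tuple (fun y => F (facetPt j (w, y))) (facetDomain n j) N r u A y (i₀.succAbove a)

/-- The flux is an alternating form in finitely many Taylor coefficients of velocities and
expressions, all entire in `w`. -/
theorem differentiable_facetForm (hF : IsAdmissible d F) (hn : 1 ≤ n)
    (hη : IsContinuousCochain η) (hk : 1 ≤ k) (j : Fin (n + 1)) (i₀ : Fin (q + 1))
    (u : Fin (q + 1) → FacetParam n) {A : Fin (q + 1) → glFin (DifProj n d)}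
    (hA : ∀ i (F : Frame n), InLevel N k (exprMat F d (A i))) {y : FacetParam n}
    (hy : y ∈ facetDomain n j) : Differentiable ℂ (facetForm F η N r j i₀ u A y) := by
  obtain ⟨s, κ, hκ⟩ := hη.exists_jet N k
  have h1 : facetForm F η N r j i₀ u A y = fun w => κ fun a => jet s (tuple
      (fun y => F (facetPt j (w, y))) (facetDomain n j) N r u A y (i₀.succAbove a)) := by
    funext w
    exact hκ _ fun a => inLevel_tuple ((hF.holFamily hn j).smoothFamily w)
      (isOpen_facetDomain j).uniqueDiffOn hy hk le_rfl hA _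
  rw [h1]
  refine differentiable_form κ fun a => differentiable_pi.2 fun c => ?_
  simp only [jet_apply, tuple]
  split_ifs
  · simp only [truncScalar_apply]
    split_ifs
    · exact fun w => ((hF.holFamily hn j).analyticAt_velOp (isOpen_facetDomain j) w hy _ _
        _).differentiableAt
    · exact differentiable_const _
  · exact fun w => ((hF.holFamily hn j).analyticAt_exprOp (isOpen_facetDomain j) w hy _ _
      _).differentiableAt

/-- Since the omitted position `i₀` is not an angular one, all `n` angular velocities occur among
the arguments; over the degenerate torus they satisfy a linear relation. -/
theorem facetForm_zero (hF : IsAdmissible d F) (hn : 1 ≤ n) (hr : n ≤ r) (j : Fin (n + 1))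
    {i₀ : Fin (q + 1)} (hi₀ : n ≤ (i₀ : ℕ)) {u : Fin (q + 1) → FacetParam n}
    (hu : ∀ (k : Fin n) (h : (k : ℕ) < q + 1), u ⟨k, h⟩ = (Pi.single k.succ 1, 0))
    (A : Fin (q + 1) → glFin (DifProj n d)) {y : FacetParam n} (hy : y ∈ facetDomain n j) :
    facetForm F η N r j i₀ u A y 0 = 0 := by
  obtain ⟨c, hc, hsum⟩ := exists_dependent_velOp hF hn j hy
  have hlt : ∀ k : Fin n, (k : ℕ) < q + 1 := fun k => by omega
  have hne : ∀ k : Fin n, (⟨k, hlt k⟩ : Fin (q + 1)) ≠ i₀ := fun k h => by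
    have := congrArg Fin.val h
    simp only at this
    omega
  choose e he using fun k : Fin n => Fin.exists_succAbove_eq (hne k)
  have hinj : Function.Injective e := fun k l h => by
    have := (he k).symm.trans ((congrArg i₀.succAbove h).trans (he l))
    exact Fin.ext (Fin.mk.inj this)
  refine AlternatingMap.map_linearDependent _ _ fun hli => hc ?_
  have h1 := Fintype.linearIndependent_iff.1 (hli.comp e hinj) c ?_
  · exact funext h1
  · have h2 : ∀ k : Fin n, ((fun a => tuple (fun y => F (facetPt j (0, y))) (facetDomain n j) N r u
        A y (i₀.succAbove a)) ∘ e) k = truncLin (Dif n) N (velOp d (fun y => F (facetPt j (0, y)))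
          (facetDomain n j) y (Pi.single k.succ 1, 0)) := fun k => by
      simp only [Function.comp_apply, he]
      rw [tuple, if_pos (show (k : ℕ) < r by omega), hu]
      rfl
    simp only [h2, ← map_smul, ← map_sum, hsum, map_zero]

/-- The torus integrals of the flux through a facet vanish. -/
theorem integral_flux_eq_zero (hF : IsAdmissible d F) (hn : 1 ≤ n) (hη : IsContinuousCochain η)
    (hk : 1 ≤ k) (hr : n ≤ r) {A : Fin (q + 1) → glFin (DifProj n d)}
    (hA : ∀ i (F : Frame n), InLevel N k (exprMat F d (A i))) (j : Fin (n + 1))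
    {i₀ : Fin (q + 1)} (hi₀ : n ≤ (i₀ : ℕ)) {u : Fin (q + 1) → (Fin n → ℝ) × (Fin n → ℝ)}
    (hu : ∀ (k : Fin n) (h : (k : ℕ) < q + 1), u ⟨k, h⟩ = (Pi.single k 1, 0))
    (htan : ∀ i ≠ i₀, (i : ℕ) < r → baryLin n (u i).2 j = 0) {s : Fin n → ℝ}
    (hs : bary s j = 0) (hpos : ∀ k ≠ j, 0 < bary s k) :
    ∫ θ in box n, η (fun a => tuple (fun p => F (torusSimplex p)) (closedDomain n) N r u A (θ, s)
      (i₀.succAbove a)) = 0 := by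
  have hsm : s ∈ simplex n := mem_simplex_iff.2 fun k => by
    rcases eq_or_ne k j with rfl | hk
    · rw [hs]
    · exact (hpos k hk).le
  have hΦ := hF.smoothFamily
  have hmem : ∀ φ : Fin (n + 1) → ℝ, (φ, s) ∈ facetDomain n j := fun φ k hk => by
    rw [facetProj_of_bary_eq_zero hs]
    exact hpos k hk
  set U : Fin (q + 1) → FacetParam n := fun i => (Fin.cons 0 (u i).1, (u i).2) with hU
  have hUk : ∀ (k : Fin n) (h : (k : ℕ) < q + 1), U ⟨k, h⟩ = (Pi.single k.succ 1, 0) :=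
    fun k h => by
      simp only [hU, hu]
      refine Prod.ext ?_ rfl
      funext l
      refine Fin.cases ?_ (fun l => ?_) l
      · simp
      · by_cases hl : l = k
        · subst hl
          simp
        · have hl' : l.succ ≠ k.succ := fun h => hl (Fin.succ_injective _ h)
          simp [hl, hl']
  have hform : ∀ θ, (η fun a => tuple (fun p => F (torusSimplex p)) (closedDomain n) N r u A
      (θ, s) (i₀.succAbove a)) = facetForm F η N r j i₀ U A (Fin.cons 0 θ, s) 1 := fun θ => by
    unfold facetForm
    congr 1
    funext a
    rw [tuple, tuple]
    split_ifs with ha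
    · rw [hF.velOp_facet hn hs hpos (htan _ (Fin.succAbove_ne i₀ a) ha)]
    · congr 2
      rw [torusSimplex_eq, facetPt, facetProj_of_bary_eq_zero hs]
      simp
  -- Rotation along the torus in the shift direction is, projectively, rotation of `w` around the
  -- unit circle.
  have hshift : ∀ θ (ρ : ℝ), facetForm F η N r j i₀ U A
      (Fin.cons 0 (θ + ρ • facetShift n j), s) 1 =
        facetForm F η N r j i₀ U A (Fin.cons 0 θ, s) (Complex.exp (ρ * Complex.I)) := by
    intro θ ρ
    obtain ⟨c, hc, hpt⟩ := exists_facetPt_shift j ρ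
    have h1 := tuple_translate ((hF.holFamily hn j).smoothFamily 1)
      (Φ' := fun y => F (facetPt j (Complex.exp (ρ * Complex.I), y)))
      (isOpen_facetDomain j).uniqueDiffOn
      (a := ((Fin.cons 0 (ρ • facetShift n j) : Fin (n + 1) → ℝ), (0 : Fin n → ℝ)))
      (add_mem_facetDomain _) (fun y hy => equiv_of_smul hF
        (facetPt_mem_piece hn j 1 (add_mem_facetDomain _ y hy)) hc (hpt y))
      (hmem (Fin.cons 0 θ)) (N := N) (r := r) U A
    unfold facetForm
    rw [h1]
    have h2 : ((Fin.cons 0 (θ + ρ • facetShift n j) : Fin (n + 1) → ℝ), s) =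
        ((Fin.cons 0 θ : Fin (n + 1) → ℝ), s) +
          ((Fin.cons 0 (ρ • facetShift n j) : Fin (n + 1) → ℝ), (0 : Fin n → ℝ)) := by
      refine Prod.ext ?_ (add_zero s).symm
      funext l
      refine Fin.cases ?_ (fun l => ?_) l <;> simp
    rw [h2]
  refine setIntegral_box_eq_zero ?_ (fun θ l => ?_) (facetShift n j) fun θ => ?_
  · exact continuous_slice (contDiffOn_cochain_tuple hη hΦ uniqueDiffOn_closedDomain hk le_rfl
      hA _).continuousOn hsm
  · rw [tuple_periodic hF hsm]
  · simp only [hform, hshift]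
    have hd := differentiable_facetForm (r := r) hF hn hη hk j i₀ U hA (hmem (Fin.cons 0 θ))
    -- The mean value property turns the average over the unit circle into the value at `w = 0`,
    -- which is zero.
    have havg := hd.diffContOnCl.circleAverage (c := 0) (R := 1)
    rw [facetForm_zero hF hn hr j hi₀ hUk A (hmem (Fin.cons 0 θ)), Real.circleAverage_def] at havg
    have h3 := (smul_eq_zero.1 havg).resolve_left (inv_ne_zero Real.two_pi_pos.ne')
    simpa [circleMap] using h3

end Flux

/-! ### Integration of exact forms -/

section Exact

open MeasureTheory

variable {n : ℕ} {d : ℤ} {F : (Fin (n + 1) → ℂ) × (Fin (n + 1) → ℝ) → Frame n}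

theorem sum_ite_lt {Q r : ℕ} (h : r ≤ Q) (f : Fin Q → ℂ) :
    ∑ i : Fin Q, (if (i : ℕ) < r then f i else 0) = ∑ a : Fin r, f (Fin.castLE h a) := by
  obtain ⟨t, rfl⟩ := Nat.exists_eq_add_of_le h
  rw [Fin.sum_univ_add]
  simp only [Fin.val_castAdd, Fin.is_lt, if_true, Fin.val_natAdd, Nat.not_lt_of_le (Nat.le_add_right _ _),
    if_false, Finset.sum_const_zero, add_zero]
  rfl

variable {q : ℕ}

/-- Position of the `k`-th angle among the arguments. -/
def angleIdx (hq : n + n ≤ q + 1) (k : Fin n) : Fin (q + 1) := ⟨k, by omega⟩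

/-- Position of the `k`-th coordinate of the simplex among the arguments. -/
def simplexIdx (hq : n + n ≤ q + 1) (k : Fin n) : Fin (q + 1) := ⟨n + k, by omega⟩

theorem sum_ite_lt_double (hq : n + n ≤ q + 1) (f : Fin (q + 1) → ℂ) :
    ∑ i : Fin (q + 1), (if (i : ℕ) < n + n then f i else 0) =
      ∑ k, f (angleIdx hq k) + ∑ k, f (simplexIdx hq k) := by
  rw [sum_ite_lt hq, Fin.sum_univ_add]
  rfl

/-- The coordinate directions, extended by zero. -/
def coordDirs (n Q : ℕ) (i : Fin Q) : (Fin n → ℝ) × (Fin n → ℝ) :=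
  if h : (i : ℕ) < n + n then coordDir n ⟨i, h⟩ else 0

theorem coordDirs_angle {Q : ℕ} (k : Fin n) (h : (k : ℕ) < Q) :
    coordDirs n Q ⟨k, h⟩ = (Pi.single k 1, 0) := by
  rw [coordDirs, dif_pos (show (k : ℕ) < n + n by omega), coordDir]
  exact Fin.append_left _ _ k

theorem coordDirs_simplex {Q : ℕ} (k : Fin n) (h : n + (k : ℕ) < Q) :
    coordDirs n Q ⟨n + k, h⟩ = (0, Pi.single k 1) := by
  rw [coordDirs, dif_pos (show n + (k : ℕ) < n + n by omega), coordDir]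
  exact Fin.append_right _ _ k

theorem tuple_sub {E : Type} [NormedAddCommGroup E] [NormedSpace ℝ E] {S : Set E}
    {Φ : E → Frame n} {y : E} (hΦ : SmoothFamily d Φ S) (hS : UniqueDiffOn ℝ S) (hy : y ∈ S)
    {N r Q : ℕ} {u u' : Fin Q → E} {A : Fin Q → glFin (DifProj n d)} {i i₀ : Fin Q}
    (hi : (i : ℕ) < r) (hi₀ : (i₀ : ℕ) < r) (h : u' i = u i - u i₀) :
    tuple Φ S N r u' A y i = tuple Φ S N r u A y i - tuple Φ S N r u A y i₀ := by
  rw [tuple, tuple, tuple, if_pos hi, if_pos hi, if_pos hi₀, h, hΦ.velOp_sub hS hy]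
  refine glFin_ext fun i j => ?_
  rw [glFin_sub_apply]
  simp only [truncScalar_apply]
  split_ifs
  · rfl
  · exact (sub_self (0 : Dif n)).symm

variable {N k : ℕ} {η : glFin (Dif n) [⋀^Fin q]→ₗ[ℂ] ℂ} {A : Fin (q + 1) → glFin (DifProj n d)}

/-- The flux through the facet opposite to the vertex that is not a coordinate. -/
theorem integral_flux_sum_eq_zero (hF : IsAdmissible d F) (hn : 1 ≤ n)
    (hη : IsContinuousCochain η) (hk : 1 ≤ k) (hq : n + n ≤ q + 1)
    (hA : ∀ i (F : Frame n), InLevel N k (exprMat F d (A i))) {s : Fin n → ℝ}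
    (hpos : ∀ l, 0 < s l) (hs : ∑ l, s l = 1) :
    ∫ θ in box n, ∑ l : Fin n, (-1) ^ (n + (l : ℕ)) * η (fun a => tuple
      (fun p => F (torusSimplex p)) (closedDomain n) N (n + n) (coordDirs n (q + 1)) A (θ, s)
      ((simplexIdx hq l).succAbove a)) = 0 := by
  set i₀ : Fin (q + 1) := simplexIdx hq ⟨0, hn⟩ with hi₀
  have hi₀v : (i₀ : ℕ) = n := rfl
  have hdir₀ : coordDirs n (q + 1) i₀ = (0, Pi.single ⟨0, hn⟩ 1) := coordDirs_simplex _ _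
  have hsm : s ∈ simplex n := ⟨fun l => (hpos l).le, hs.le⟩
  -- The coordinate directions of the simplex are transversal to this facet; their differences with
  -- the first one are tangent to it.
  set u' : Fin (q + 1) → (Fin n → ℝ) × (Fin n → ℝ) := fun i =>
    if n ≤ (i : ℕ) ∧ (i : ℕ) < n + n then coordDirs n (q + 1) i - coordDirs n (q + 1) i₀
      else coordDirs n (q + 1) i with hu'
  have hcoord : ∀ (i : Fin (q + 1)), n ≤ (i : ℕ) → (i : ℕ) < n + n →
      ∃ l : Fin n, i = simplexIdx hq l := fun i h1 h2 =>
    ⟨⟨i - n, by omega⟩, Fin.ext (by simp only [simplexIdx]; omega)⟩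
  have hflux := integral_flux_eq_zero (r := n + n) hF hn hη hk (by omega) hA 0 (i₀ := i₀)
    (by rw [hi₀v]) (u := u') (fun l hl => by
      simp only [hu']
      rw [if_neg (by omega), coordDirs_angle])
    (fun i hi hir => by
      rw [baryLin_zero]
      by_cases hin : n ≤ (i : ℕ)
      · obtain ⟨l, rfl⟩ := hcoord i hin hir
        simp only [hu']
        rw [if_pos ⟨hin, hir⟩, hdir₀]
        simp only [simplexIdx]
        rw [coordDirs_simplex]
        simp
      · have : i = ⟨(⟨i, by omega⟩ : Fin n), i.2⟩ := rfl
        simp only [hu']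
        rw [if_neg (by omega), this, coordDirs_angle]
        simp)
    (s := s) (by rw [bary_zero, hs, sub_self]) (fun l hl => by
      obtain ⟨l, rfl⟩ := Fin.exists_succ_eq.2 hl
      exact hpos l)
  -- The signed sum of the `n` fluxes is one flux evaluated on tangent directions
  -- (`sum_removeNth_eq`), to which `integral_flux_eq_zero` applies.
  have key : ∀ θ, ∑ l : Fin n, (-1) ^ (n + (l : ℕ)) * η (fun a => tuple
      (fun p => F (torusSimplex p)) (closedDomain n) N (n + n) (coordDirs n (q + 1)) A (θ, s)
      ((simplexIdx hq l).succAbove a)) = (-1) ^ n * η (fun a => tuple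
        (fun p => F (torusSimplex p)) (closedDomain n) N (n + n) u' A (θ, s)
        (i₀.succAbove a)) := by
    intro θ
    set x := tuple (fun p => F (torusSimplex p)) (closedDomain n) N (n + n) (coordDirs n (q + 1))
      A (θ, s) with hx
    have h1 := sum_removeNth_eq η x i₀
      (fun i => if n ≤ (i : ℕ) ∧ (i : ℕ) < n + n then 1 else 0) (by rw [if_pos (by omega)])
    have h2 : ∑ i : Fin (q + 1), (-1) ^ (i : ℕ) *
        ((if n ≤ (i : ℕ) ∧ (i : ℕ) < n + n then (1 : ℂ) else 0) * η fun r => x (i.succAbove r)) =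
        ∑ i : Fin (q + 1), (if (i : ℕ) < n + n then (if n ≤ (i : ℕ) then (-1) ^ (i : ℕ) *
          η fun r => x (i.succAbove r) else 0) else 0) := by
      refine Finset.sum_congr rfl fun i _ => ?_
      by_cases ha : (i : ℕ) < n + n <;> by_cases hb : n ≤ (i : ℕ) <;> simp [ha, hb]
    have h3 : ∑ i : Fin (q + 1), (if (i : ℕ) < n + n then (if n ≤ (i : ℕ) then (-1) ^ (i : ℕ) *
          η fun r => x (i.succAbove r) else 0) else 0) =
        ∑ l : Fin n, (-1) ^ (n + (l : ℕ)) * η fun a => x ((simplexIdx hq l).succAbove a) := by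
      rw [sum_ite_lt_double hq]
      have h4 : ∀ l : Fin n, ¬n ≤ (angleIdx hq l : ℕ) := fun l => not_le.2 l.2
      have h5 : ∀ l : Fin n, n ≤ (simplexIdx hq l : ℕ) := fun l => Nat.le_add_right _ _
      simp only [h4, h5, if_false, if_true, Finset.sum_const_zero, zero_add]
      rfl
    rw [← h3, ← h2, h1, hi₀v]
    congr 2
    funext a
    by_cases ha : n ≤ ((i₀.succAbove a : Fin (q + 1)) : ℕ) ∧
        ((i₀.succAbove a : Fin (q + 1)) : ℕ) < n + n
    · rw [if_pos ha, one_smul, tuple_sub hF.smoothFamily uniqueDiffOn_closedDomain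
        (y := (θ, s)) ⟨trivial, hsm⟩ ha.2 (i₀ := i₀) (u := coordDirs n (q + 1))
        (by rw [hi₀v]; omega) (by simp only [hu']; rw [if_pos ha])]
    · rw [if_neg ha, zero_smul, sub_zero, hx, tuple, tuple]
      simp only [hu']
      rw [if_neg ha]
  simp only [key]
  rw [integral_const_mul, hflux, mul_zero]

/-- The part of the differential of a cochain that involves the velocities is exact, and its
integral vanishes. -/
theorem integral_ceDiff_velocity_eq_zero (hF : IsAdmissible d F) (hn : 1 ≤ n)
    (hη : IsContinuousCochain η) (hk : 1 ≤ k) (hq : n + n ≤ q + 1)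
    (hA : ∀ i (F : Frame n), InLevel N k (exprMat F d (A i)))
    {x : (Fin n → ℝ) × (Fin n → ℝ) → Fin (q + 1) → glFin (Dif n)}
    (hx : ∀ p, x p = tuple (fun p => F (torusSimplex p)) (closedDomain n) N (n + n)
      (coordDirs n (q + 1)) A p) :
    ∫ p in paramDomain n, ∑ j : Fin (q + 1), ∑ i ∈ Finset.Iio j,
      (if (i : ℕ) < n + n then (-1) ^ (j : ℕ) *
        η (fun a => Function.update (x p) i ⁅x p i, x p j⁆ (j.succAbove a)) else 0) = 0 := by
  have hΦ := hF.smoothFamily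
  set H : Fin (q + 1) → (Fin n → ℝ) × (Fin n → ℝ) → ℂ := fun i p =>
    η fun a => tuple (fun p => F (torusSimplex p)) (closedDomain n) N (n + n)
      (coordDirs n (q + 1)) A p (i.succAbove a) with hH
  have hHC : ∀ i, ContDiffOn ℝ ∞ (H i) (closedDomain n) := fun i =>
    contDiffOn_cochain_tuple hη hΦ uniqueDiffOn_closedDomain hk le_rfl hA _
  set G : Fin n → (Fin n → ℝ) × (Fin n → ℝ) → ℂ := fun l p =>
    (-1) ^ (l : ℕ) * H (angleIdx hq l) p with hG
  set K : Fin n → (Fin n → ℝ) × (Fin n → ℝ) → ℂ := fun l p =>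
    (-1) ^ (n + (l : ℕ)) * H (simplexIdx hq l) p with hK
  have hGC : ∀ l, ContDiffOn ℝ ∞ (G l) (closedDomain n) := fun l => contDiffOn_const.mul (hHC _)
  have hKC : ∀ l, ContDiffOn ℝ ∞ (K l) (closedDomain n) := fun l => contDiffOn_const.mul (hHC _)
  have hdiff : ∀ (c : ℂ) i p v, p ∈ closedDomain n →
      fderivWithin ℝ (fun p => c * H i p) (closedDomain n) p v =
        c * fderivWithin ℝ (H i) (closedDomain n) p v := fun c i p v hp => by
    have h1 := ((hHC i) p hp).differentiableWithinAt (by simp)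
    rw [fderivWithin_const_mul (uniqueDiffOn_closedDomain p hp) h1]
    rfl
  -- The integrand is minus a divergence, with angular components `G` and simplicial components `K`.
  have hpt : ∀ p ∈ paramDomain n, ∑ j : Fin (q + 1), ∑ i ∈ Finset.Iio j,
      (if (i : ℕ) < n + n then (-1) ^ (j : ℕ) *
        η (fun a => Function.update (x p) i ⁅x p i, x p j⁆ (j.succAbove a)) else 0) =
      -(∑ l, fderivWithin ℝ (G l) (closedDomain n) p (Pi.single l 1, 0) +
        ∑ l, fderivWithin ℝ (K l) (closedDomain n) p (0, Pi.single l 1)) := by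
    rintro ⟨θ, s⟩ hp
    have hmem : (θ, s) ∈ closedDomain n := ⟨trivial, openSimplex_subset hp.2⟩
    have h1 := sum_fderivWithin_cochain (r := n + n) (u := coordDirs n (q + 1)) hη hΦ
      uniqueDiffOn_closedDomain hmem (closedDomain_mem_nhds hp.2) hk hA
    rw [hx, eq_neg_iff_add_eq_zero, add_comm, ← eq_neg_iff_add_eq_zero, ← h1,
      sum_ite_lt_double hq]
    congr 1
    · refine Finset.sum_congr rfl fun l _ => ?_
      simp only [hG]
      rw [hdiff _ _ _ _ hmem, ← coordDirs_angle (Q := q + 1) l (by omega)]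
      rfl
    · refine Finset.sum_congr rfl fun l _ => ?_
      simp only [hK]
      rw [hdiff _ _ _ _ hmem, ← coordDirs_simplex (Q := q + 1) l (by omega)]
      rfl
  have hmeasP : MeasurableSet (paramDomain n) :=
    measurableSet_box.prod isOpen_openSimplex.measurableSet
  have hi1 : ∀ l, IntegrableOn (fun p => fderivWithin ℝ (G l) (closedDomain n) p
      (Pi.single l 1, 0)) (paramDomain n) := fun l => ContinuousOn.integrableOn_paramDomain
    (ContDiffOn.continuousOn_fderivWithin_closedDomain (hGC l) _)
  have hi2 : ∀ l, IntegrableOn (fun p => fderivWithin ℝ (K l) (closedDomain n) p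
      (0, Pi.single l 1)) (paramDomain n) := fun l => ContinuousOn.integrableOn_paramDomain
    (ContDiffOn.continuousOn_fderivWithin_closedDomain (hKC l) _)
  rw [setIntegral_congr_fun hmeasP hpt, integral_neg, integral_add
    (integrable_finsetSum _ fun l _ => hi1 l) (integrable_finsetSum _ fun l _ => hi2 l),
    integral_finsetSum _ fun l _ => hi1 l, Finset.sum_eq_zero, zero_add, neg_eq_zero]
  · refine integral_fderivWithin_simplex hn hKC (fun l s hs hpos hsum => ?_)
      fun s hpos hsum => integral_flux_sum_eq_zero hF hn hη hk hq hA hpos hsum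
    simp only [hK]
    rw [integral_const_mul]
    have hflux := integral_flux_eq_zero (r := n + n) hF hn hη hk (by omega) hA l.succ
      (i₀ := simplexIdx hq l) (Nat.le_add_right _ _) (u := coordDirs n (q + 1))
      (fun l h => coordDirs_angle l h) (fun i hi hir => by
        rw [baryLin_succ]
        by_cases hin : n ≤ (i : ℕ)
        · have : i = ⟨n + (⟨i - n, by omega⟩ : Fin n), by simp only; omega⟩ :=
            Fin.ext (by simp only; omega)
          rw [this, coordDirs_simplex]
          refine Pi.single_eq_of_ne (fun h => hi (Fin.ext ?_)) _
          have h2 := congrArg Fin.val h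
          simp only at h2
          simp only [simplexIdx]
          omega
        · have : i = ⟨(⟨i, by omega⟩ : Fin n), i.2⟩ := rfl
          rw [this, coordDirs_angle]
          rfl) (s := s) hs (fun i hi => by
        revert hi
        refine Fin.cases (fun _ => ?_) (fun i hi => ?_) i
        · rw [bary_zero]
          linarith
        · exact hpos i fun h => hi (congrArg Fin.succ h))
    rw [hflux, mul_zero]
  · intro l _
    refine integral_fderivWithin_angle (hGC l) (fun θ s i hs => ?_) l
    simp only [hG, hH]
    rw [tuple_periodic hF hs]

end Exact

/-! ### Cochains with some arguments fixed -/

section Algebra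

variable {L : Type*} [LieRing L] [LieAlgebra ℂ L] {r m : ℕ}

theorem append_update {α : Type*} (t : Fin r → α) (B : Fin m → α) (i : Fin m) (x : α) :
    Fin.append t (Function.update B i x) =
      Function.update (Fin.append t B) (Fin.natAdd r i) x := by
  funext a
  refine Fin.addCases (fun a => ?_) (fun a => ?_) a
  · rw [Fin.append_left, Function.update_of_ne, Fin.append_left]
    intro h
    have := congrArg Fin.val h
    simp only [Fin.val_castAdd, Fin.val_natAdd] at this
    omega
  · rw [Fin.append_right]
    by_cases ha : a = i
    · subst ha
      simp
    · rw [Function.update_of_ne ha, Function.update_of_ne, Fin.append_right]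
      exact fun h => ha (Fin.natAdd_injective _ _ h)

/-- The cochain obtained by fixing the first `r` arguments. -/
def fixArgs (ξ : L [⋀^Fin (r + m)]→ₗ[ℂ] ℂ) (t : Fin r → L) : L [⋀^Fin m]→ₗ[ℂ] ℂ where
  toFun B := ξ (Fin.append t B)
  map_update_add' {inst} B i x y := by
    rw [Subsingleton.elim inst (instDecidableEqFin m), append_update, append_update,
      append_update, AlternatingMap.map_update_add]
  map_update_smul' {inst} B i c x := by
    rw [Subsingleton.elim inst (instDecidableEqFin m), append_update, append_update,
      AlternatingMap.map_update_smul]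
  map_eq_zero_of_eq' B i j h hij := by
    refine ξ.map_eq_zero_of_eq _ (i := Fin.natAdd r i) (j := Fin.natAdd r j) ?_
      fun h => hij (Fin.natAdd_injective _ _ h)
    rw [Fin.append_right, Fin.append_right, h]

theorem fixArgs_apply (ξ : L [⋀^Fin (r + m)]→ₗ[ℂ] ℂ) (t : Fin r → L) (B : Fin m → L) :
    fixArgs ξ t B = ξ (Fin.append t B) := rfl

theorem natAdd_succAbove_castAdd (j : Fin (m + 1)) (a : Fin r) :
    (Fin.natAdd r j : Fin (r + m + 1)).succAbove (Fin.castAdd m a) = Fin.castAdd (m + 1) a := by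
  rw [Fin.succAbove_of_castSucc_lt]
  · rfl
  · rw [Fin.lt_def]
    simp only [Fin.val_castSucc, Fin.val_castAdd, Fin.val_natAdd]
    omega

theorem natAdd_succAbove_natAdd (j : Fin (m + 1)) (a : Fin m) :
    (Fin.natAdd r j : Fin (r + m + 1)).succAbove (Fin.natAdd r a) =
      Fin.natAdd r (j.succAbove a) := by
  rcases lt_or_ge a.castSucc j with h | h
  · rw [Fin.succAbove_of_castSucc_lt _ _ h, Fin.succAbove_of_castSucc_lt]
    · rfl
    · rw [Fin.lt_def] at h ⊢
      simp only [Fin.val_castSucc, Fin.val_natAdd] at h ⊢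
      omega
  · rw [Fin.succAbove_of_le_castSucc _ _ h, Fin.succAbove_of_le_castSucc]
    · rfl
    · rw [Fin.le_def] at h ⊢
      simp only [Fin.val_castSucc, Fin.val_natAdd] at h ⊢
      omega

theorem append_succAbove {α : Type*} (t : Fin r → α) (B : Fin (m + 1) → α) (j : Fin (m + 1)) :
    (fun a => (Fin.append t B : Fin (r + (m + 1)) → α)
      ((Fin.natAdd r j : Fin (r + m + 1)).succAbove a)) =
      Fin.append t fun a => B (j.succAbove a) := by
  funext a
  refine Fin.addCases (fun a => ?_) (fun a => ?_) a
  · rw [natAdd_succAbove_castAdd, Fin.append_left]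
    exact (Fin.append_left _ _ _).symm
  · rw [natAdd_succAbove_natAdd, Fin.append_right]
    exact (Fin.append_right t (fun a => B (j.succAbove a)) a).symm

/-- The part of the differential that does not involve the first `r` arguments. -/
theorem sum_ceDiff_append (η : L [⋀^Fin (r + m)]→ₗ[ℂ] ℂ) (t : Fin r → L) (B : Fin (m + 1) → L)
    {x : Fin (r + m + 1) → L} (hx : x = Fin.append t B) :
    ∑ j : Fin (r + m + 1), ∑ i ∈ Finset.Iio j, (if (i : ℕ) < r then 0 else
      (-1) ^ (j : ℕ) * η (fun a => Function.update x i ⁅x i, x j⁆ (j.succAbove a))) =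
      (-1) ^ r * ceDiff (fixArgs η t) B := by
  have hIio : ∀ {Q : ℕ} (j : Fin Q) (f : Fin Q → ℂ), ∑ i ∈ Finset.Iio j, f i =
      ∑ i, if i < j then f i else 0 := fun j f => by
    rw [← Finset.sum_filter]
    congr 1
    ext i
    simp
  have hsplit : ∀ f : Fin (r + m + 1) → ℂ, ∑ j, f j =
      ∑ a : Fin r, f (Fin.castAdd (m + 1) a) + ∑ b : Fin (m + 1), f (Fin.natAdd r b) := fun f =>
    Fin.sum_univ_add (a := r) (b := m + 1) f
  rw [hsplit, Finset.sum_eq_zero, zero_add, ceDiff, Finset.mul_sum]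
  · refine Finset.sum_congr rfl fun j _ => ?_
    refine (hIio (Q := r + m + 1) (Fin.natAdd r j) _).trans ?_
    rw [hsplit, Finset.sum_eq_zero, zero_add, hIio, Finset.mul_sum]
    · refine Finset.sum_congr rfl fun i _ => ?_
      have h1 : (Fin.natAdd r i < Fin.natAdd r j) ↔ i < j := by
        rw [Fin.lt_def, Fin.lt_def]
        simp
      simp only [h1]
      split_ifs with hij hir
      · exact absurd hir (Nat.not_lt.2 (Nat.le_add_right r (i : ℕ)))
      · have hi : x (Fin.natAdd r i) = B i := by rw [hx]; exact Fin.append_right _ _ _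
        have hj : x (Fin.natAdd r j) = B j := by rw [hx]; exact Fin.append_right _ _ _
        rw [hi, hj, fixArgs_apply, ← append_succAbove, append_update, hx, Fin.val_natAdd, pow_add,
          mul_assoc]
        rfl
      · rw [mul_zero]
    · intro a _
      rw [if_pos (show ((Fin.castAdd (m + 1) a : Fin (r + (m + 1))) : ℕ) < r from a.2), ite_self]
  · intro a _
    refine Finset.sum_eq_zero fun i hi => if_pos ?_
    have h1 := Finset.mem_Iio.1 hi
    rw [Fin.lt_def] at h1
    exact h1.trans a.2

theorem ceDiff_compLinearMap {L' : Type*} [LieRing L'] [LieAlgebra ℂ L']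
    (η : L [⋀^Fin m]→ₗ[ℂ] ℂ) (f : L' →ₗ[ℂ] L) (hf : ∀ a b, f ⁅a, b⁆ = ⁅f a, f b⁆)
    (A : Fin (m + 1) → L') : ceDiff (η.compLinearMap f) A = ceDiff η fun i => f (A i) := by
  refine Finset.sum_congr rfl fun j _ => Finset.sum_congr rfl fun i _ => ?_
  rw [AlternatingMap.compLinearMap_apply]
  congr 2
  funext a
  rw [← hf]
  exact Function.apply_update (fun _ => f) A i _ _

/-- Each linear or alternating identity involves finitely many argument lists, so one large `N`
verifies it, although the threshold is not uniform in `A`. -/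
theorem exists_eventual_alternatingMap (f : ℕ → L [⋀^Fin m]→ₗ[ℂ] ℂ)
    (h : ∀ A, ∃ c, ∀ᶠ N in Filter.atTop, f N A = c) :
    ∃ g : L [⋀^Fin m]→ₗ[ℂ] ℂ, ∀ A, ∀ᶠ N in Filter.atTop, f N A = g A := by
  choose c hc using h
  refine ⟨
    { toFun := c
      map_update_add' := ?_
      map_update_smul' := ?_
      map_eq_zero_of_eq' := ?_ }, hc⟩
  · intro inst A i x y
    obtain ⟨N, h1, h2, h3⟩ := ((hc (Function.update A i (x + y))).and
      ((hc (Function.update A i x)).and (hc (Function.update A i y)))).exists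
    rw [← h1, ← h2, ← h3, AlternatingMap.map_update_add]
  · intro inst A i b x
    obtain ⟨N, h1, h2⟩ := ((hc (Function.update A i (b • x))).and
      (hc (Function.update A i x))).exists
    rw [← h1, ← h2, AlternatingMap.map_update_smul]
  · intro A i j hA hij
    obtain ⟨N, h1⟩ := (hc A).exists
    rw [← h1, AlternatingMap.map_eq_zero_of_eq _ _ hA hij]

/-- A cochain is a coboundary if on each argument it agrees with almost all members of a sequence
of coboundaries. -/
theorem isCoboundary_of_eventually (Ξ : L [⋀^Fin (m + 1)]→ₗ[ℂ] ℂ)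
    (Y : ℕ → L [⋀^Fin m]→ₗ[ℂ] ℂ)
    (h : ∀ A, ∀ᶠ N in Filter.atTop, Ξ A = ceDiff (Y N) A) : IsCoboundary Ξ := by
  -- The Chevalley–Eilenberg boundary in the exterior power, so that a differential is the
  -- composition of a linear functional with `bd`.
  let bd : (Fin (m + 1) → L) → ⋀[ℂ]^m L := fun A =>
    ∑ j : Fin (m + 1), ∑ i ∈ Finset.Iio j, (-1 : ℂ) ^ (j : ℕ) •
      exteriorPower.ιMulti ℂ m fun a => Function.update A i ⁅A i, A j⁆ (j.succAbove a)
  have hbd : ∀ (g : ⋀[ℂ]^m L →ₗ[ℂ] ℂ) (A : Fin (m + 1) → L),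
      ceDiff (g.compAlternatingMap (exteriorPower.ιMulti ℂ m)) A = g (bd A) := fun g A => by
    simp only [bd, ceDiff, map_sum, map_smul, smul_eq_mul, LinearMap.compAlternatingMap_apply]
  have hY : ∀ N, (exteriorPower.alternatingMapLinearEquiv (Y N)).compAlternatingMap
      (exteriorPower.ιMulti ℂ m) = Y N := fun N =>
    AlternatingMap.ext fun A => exteriorPower.alternatingMapLinearEquiv_apply_ιMulti _ _
  let D := Finsupp.linearCombination ℂ bd
  let X := Finsupp.linearCombination ℂ fun A => Ξ A
  -- A relation between boundaries involves finitely many lists `A`, so a single `Y N` shows that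
  -- the values of `Ξ` satisfy it too. A functional that kills the kernel of `D` factors through
  -- `D`, and the factor is the primitive.
  have hX : X ∈ (LinearMap.ker D).dualAnnihilator := by
    rw [Submodule.mem_dualAnnihilator]
    intro c hc
    obtain ⟨N, hN⟩ := ((Filter.eventually_all_finset c.support).2 fun A _ => h A).exists
    have h1 : X c = exteriorPower.alternatingMapLinearEquiv (Y N) (D c) := by
      simp only [X, D, Finsupp.linearCombination_apply, Finsupp.sum, map_sum, map_smul]
      refine Finset.sum_congr rfl fun A hA => ?_
      rw [hN A hA, ← hbd, hY]
    rw [h1, LinearMap.mem_ker.1 hc, map_zero]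
  rw [← LinearMap.range_dualMap_eq_dualAnnihilator_ker] at hX
  obtain ⟨g, hg⟩ := hX
  refine ⟨g.compAlternatingMap (exteriorPower.ιMulti ℂ m), trivial, fun A => ?_⟩
  rw [hbd]
  have h2 := congrArg (fun T => T (Finsupp.single A 1)) hg
  simpa [D, X] using h2.symm

theorem IsCoboundaryOf.exists_primitive {P : ∀ k : ℕ, (L [⋀^Fin k]→ₗ[ℂ] ℂ) → Prop} {k : ℕ}
    (hk : k ≠ 0) {ξ : L [⋀^Fin k]→ₗ[ℂ] ℂ} (h : IsCoboundaryOf P ξ) :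
    ∃ (q : ℕ) (hq : k = q + 1) (η : L [⋀^Fin q]→ₗ[ℂ] ℂ), P q η ∧
      ∀ x : Fin (q + 1) → L, ξ (fun i => x (Fin.cast hq i)) = ceDiff η x := by
  cases k with
  | zero => exact absurd rfl hk
  | succ q =>
    obtain ⟨η, hη, hx⟩ := h
    exact ⟨q, rfl, η, hη, hx⟩

end Algebra

/-! ### The canonical form and its integral -/

section Canonical

open MeasureTheory MvPowerSeries

variable {n m : ℕ} {d : ℤ} {F : (Fin (n + 1) → ℂ) × (Fin (n + 1) → ℝ) → Frame n}

theorem mem_closedDomain_of_mem {p : (Fin n → ℝ) × (Fin n → ℝ)} (hp : p ∈ paramDomain n) :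
    p ∈ closedDomain n := ⟨trivial, openSimplex_subset hp.2⟩

theorem measurableSet_paramDomain : MeasurableSet (paramDomain n) :=
  measurableSet_box.prod isOpen_openSimplex.measurableSet

theorem IsAdmissible.isVelocity_velOp (hF : IsAdmissible d F) {p : (Fin n → ℝ) × (Fin n → ℝ)}
    (hp : p ∈ paramDomain n) (v : (Fin n → ℝ) × (Fin n → ℝ)) :
    IsVelocity d F p v (velOp d (fun p => F (torusSimplex p)) (closedDomain n) p v) := by
  have hmem := mem_closedDomain_of_mem hp
  have hvel := hF.smoothFamily.isVel uniqueDiffOn_closedDomain hmem v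
  refine ⟨hvel.hasOrd.orderLE, fun V f h0 α => ?_⟩
  rw [hvel.apply_expand V f h0, coeff_dPS]
  have h1 := ((hF.smoothFamily.regPS_expand hmem f h0).differentiableWithinAt
    α).hasFDerivWithinAt.hasFDerivAt (closedDomain_mem_nhds (θ := p.1) hp.2)
  have h2 : HasDerivAt (fun r : ℝ => p + r • v) v 0 := by
    simpa using ((hasDerivAt_id (0 : ℝ)).smul_const v).const_add p
  refine HasFDerivAt.comp_hasDerivAt (f := fun r : ℝ => p + r • v)
    (l := fun q => coeff α ((F (torusSimplex q)).expand f.1)) 0 ?_ h2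
  simpa using h1

theorem IsVelocity.unique {p v : (Fin n → ℝ) × (Fin n → ℝ)} {τ τ' : Dif n}
    (h : IsVelocity d F p v τ) (h' : IsVelocity d F p v τ') : τ = τ' :=
  (F (torusSimplex p)).eq_of_expand d fun V f h0 => by
    ext α
    exact (h.2 V f h0 α).unique (h'.2 V f h0 α)

/-- The value of the canonical form, computed with truncations of size `N`. -/
def formAt (F : (Fin (n + 1) → ℂ) × (Fin (n + 1) → ℝ) → Frame n) (d : ℤ)
    (ξ : glFin (Dif n) [⋀^Fin (n + n + m)]→ₗ[ℂ] ℂ) (N : ℕ) (p : (Fin n → ℝ) × (Fin n → ℝ)) :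
    glFin (DifProj n d) [⋀^Fin m]→ₗ[ℂ] ℂ :=
  (fixArgs ξ fun a => truncScalar N (velOp d (fun p => F (torusSimplex p)) (closedDomain n) p
    (coordDir n a))).compLinearMap (exprMat (F (torusSimplex p)) d)

theorem formAt_apply (ξ : glFin (Dif n) [⋀^Fin (n + n + m)]→ₗ[ℂ] ℂ) (N : ℕ)
    (p : (Fin n → ℝ) × (Fin n → ℝ)) (A : Fin m → glFin (DifProj n d)) :
    formAt F d ξ N p A = ξ (Fin.append (fun a => truncScalar N (velOp d
      (fun p => F (torusSimplex p)) (closedDomain n) p (coordDir n a)))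
        fun i => exprMat (F (torusSimplex p)) d (A i)) := rfl

/-- The arguments of the canonical form. -/
def canonicalTuple (F : (Fin (n + 1) → ℂ) × (Fin (n + 1) → ℝ) → Frame n) (N : ℕ)
    (A : Fin m → glFin (DifProj n d)) (p : (Fin n → ℝ) × (Fin n → ℝ)) :
    Fin (n + n + m) → glFin (Dif n) :=
  tuple (fun p => F (torusSimplex p)) (closedDomain n) N (n + n) (coordDirs n (n + n + m))
    (Fin.append (fun _ => 0) A) p

theorem canonicalTuple_eq (N : ℕ) (A : Fin m → glFin (DifProj n d))
    (p : (Fin n → ℝ) × (Fin n → ℝ)) : canonicalTuple F N A p =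
      Fin.append (fun a => truncScalar N (velOp d
        (fun p => F (torusSimplex p)) (closedDomain n) p (coordDir n a)))
          fun i => exprMat (F (torusSimplex p)) d (A i) := by
  funext i
  refine Fin.addCases (fun a => ?_) (fun a => ?_) i
  · have ha : ((Fin.castAdd m a : Fin (n + n + m)) : ℕ) < n + n := a.2
    rw [Fin.append_left, canonicalTuple, tuple, if_pos ha, coordDirs, dif_pos ha]
    rfl
  · rw [Fin.append_right, canonicalTuple, tuple, if_neg (by simp), Fin.append_right]

theorem formAt_eq (ξ : glFin (Dif n) [⋀^Fin (n + n + m)]→ₗ[ℂ] ℂ) (N : ℕ)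
    (p : (Fin n → ℝ) × (Fin n → ℝ)) (A : Fin m → glFin (DifProj n d)) :
    formAt F d ξ N p A = ξ (canonicalTuple F N A p) := by
  rw [formAt_apply, canonicalTuple_eq]

/-- The zeros fill the positions of the velocities, which `tuple` does not read; the maximum with
`1` makes room for the order of the velocities. -/
theorem exists_level_append (A : Fin m → glFin (DifProj n d)) :
    ∃ N₀ k, 1 ≤ k ∧ ∀ N ≥ N₀, ∀ i (G : Frame n), InLevel N k
      (exprMat G d ((Fin.append (fun _ => 0) A : Fin (n + n + m) → glFin (DifProj n d)) i)) := by
  obtain ⟨N₀, k, h⟩ := exists_inLevel_exprMat_family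
    (Fin.append (fun _ => 0) A : Fin (n + n + m) → glFin (DifProj n d))
  exact ⟨N₀, max k 1, le_max_right _ _, fun N hN i G => (h i G).mono hN (le_max_left _ _)⟩

theorem integrableOn_formAt (hF : IsAdmissible d F)
    {ξ : glFin (Dif n) [⋀^Fin (n + n + m)]→ₗ[ℂ] ℂ} (hξ : IsContinuousCochain ξ) (N : ℕ)
    (A : Fin m → glFin (DifProj n d)) :
    IntegrableOn (fun p => formAt F d ξ N p A) (paramDomain n) := by
  obtain ⟨N₀, k, hk, hA⟩ := exists_level_append (n := n) A
  simp only [formAt_eq]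
  exact ContinuousOn.integrableOn_paramDomain (contDiffOn_cochain_tuple hξ hF.smoothFamily
    uniqueDiffOn_closedDomain hk (le_max_left N N₀) (hA _ (le_max_right N N₀)) id).continuousOn

theorem exists_alternatingMap_integral {L : Type*} [AddCommGroup L] [Module ℂ L]
    {f : (Fin n → ℝ) × (Fin n → ℝ) → L [⋀^Fin m]→ₗ[ℂ] ℂ}
    (hf : ∀ A, IntegrableOn (fun p => f p A) (paramDomain n)) :
    ∃ g : L [⋀^Fin m]→ₗ[ℂ] ℂ, ∀ A, g A = ∫ p in paramDomain n, f p A := by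
  refine ⟨
    { toFun := fun A => ∫ p in paramDomain n, f p A
      map_update_add' := ?_
      map_update_smul' := ?_
      map_eq_zero_of_eq' := ?_ }, fun A => rfl⟩
  · intro inst A i x y
    rw [← integral_add (hf _) (hf _)]
    simp only [AlternatingMap.map_update_add]
  · intro inst A i c x
    rw [smul_eq_mul, ← integral_const_mul]
    simp only [AlternatingMap.map_update_smul, smul_eq_mul]
  · intro A i j hA hij
    simp only [AlternatingMap.map_eq_zero_of_eq _ _ hA hij, integral_zero]

/-- The matrices of expressions have size and order bounded uniformly over all coordinate systems,
so stability gives one threshold for all `p`. This allows passing to truncations under the integral.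
-/
theorem exists_formAt_stable (hF : IsAdmissible d F)
    {ξ : glFin (Dif n) [⋀^Fin (n + n + m)]→ₗ[ℂ] ℂ} (hstab : IsStable (n + n) m ξ)
    (A : Fin m → glFin (DifProj n d)) :
    ∃ K, ∀ N ≥ K, ∀ p ∈ paramDomain n, formAt F d ξ N p A = formAt F d ξ K p A := by
  obtain ⟨N₀, k, hA⟩ := exists_inLevel_exprMat_family A
  obtain ⟨K, hK⟩ := hstab N₀ k
  exact ⟨K, fun N hN p hp => hK N hN _ (fun a => (hF.isVelocity_velOp hp _).1) _
    fun i => hA i _⟩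

theorem IsAdmissible.exists_canonicalForm (hF : IsAdmissible d F)
    {ξ : glFin (Dif n) [⋀^Fin (n + n + m)]→ₗ[ℂ] ℂ} (hstab : IsStable (n + n) m ξ) :
    ∃ Θ : (Fin n → ℝ) × (Fin n → ℝ) → glFin (DifProj n d) [⋀^Fin m]→ₗ[ℂ] ℂ,
      IsCanonicalForm F ξ Θ := by
  have h : ∀ p, ∃ g : glFin (DifProj n d) [⋀^Fin m]→ₗ[ℂ] ℂ, p ∈ paramDomain n →
      ∀ A, ∀ᶠ N in Filter.atTop, formAt F d ξ N p A = g A := by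
    intro p
    by_cases hp : p ∈ paramDomain n
    · obtain ⟨g, hg⟩ := exists_eventual_alternatingMap (fun N => formAt F d ξ N p) fun A => by
        obtain ⟨K, hK⟩ := exists_formAt_stable hF hstab A
        exact ⟨_, Filter.eventually_atTop.2 ⟨K, fun N hN => hK N hN p hp⟩⟩
      exact ⟨g, fun _ => hg⟩
    · exact ⟨0, fun hp' => absurd hp' hp⟩
  choose Θ hΘ using h
  refine ⟨Θ, fun p hp => ⟨_, fun a => hF.isVelocity_velOp hp _,
    fun A => ⟨fun i => exprMat (F (torusSimplex p)) d (A i), fun i a b => ?_, ?_⟩⟩⟩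
  · exact (F (torusSimplex p)).isExpression_exprOp _
  · filter_upwards [hΘ p hp A] with N hN
    rw [← hN, formAt_apply]

/-- The velocities and expressions chosen in a canonical form are unique, hence equal to those in
`formAt`; stability then frees the truncation size from the point. -/
theorem IsCanonicalForm.eventually_eq (hF : IsAdmissible d F)
    {ξ : glFin (Dif n) [⋀^Fin (n + n + m)]→ₗ[ℂ] ℂ} (hstab : IsStable (n + n) m ξ)
    {Θ : (Fin n → ℝ) × (Fin n → ℝ) → glFin (DifProj n d) [⋀^Fin m]→ₗ[ℂ] ℂ}
    (hΘ : IsCanonicalForm F ξ Θ) (A : Fin m → glFin (DifProj n d)) :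
    ∀ᶠ N in Filter.atTop, ∀ p ∈ paramDomain n, Θ p A = formAt F d ξ N p A := by
  obtain ⟨K, hK⟩ := exists_formAt_stable hF hstab A
  have key : ∀ p ∈ paramDomain n, Θ p A = formAt F d ξ K p A := by
    intro p hp
    obtain ⟨τ, hτ, h⟩ := hΘ p hp
    obtain ⟨B, hB, hev⟩ := h A
    obtain ⟨N, hN, hNK⟩ := (hev.and (Filter.eventually_ge_atTop K)).exists
    rw [hN, ← hK N hNK p hp, formAt_apply]
    have h1 : τ = fun a => velOp d (fun p => F (torusSimplex p)) (closedDomain n) p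
        (coordDir n a) := funext fun a => (hτ a).unique (hF.isVelocity_velOp hp _)
    have h2 : B = fun i => exprMat (F (torusSimplex p)) d (A i) := funext fun i =>
      glFin_ext fun a b => (hB i a b).eq
    rw [h1, h2]
  exact Filter.eventually_atTop.2 ⟨K, fun N hN p hp => (key p hp).trans (hK N hN p hp).symm⟩

/-- Stokes' formula for the canonical forms. -/
theorem eventually_integral_ceDiff (hF : IsAdmissible d F) (hn : 1 ≤ n)
    {η : glFin (Dif n) [⋀^Fin (n + n + m)]→ₗ[ℂ] ℂ} (hη : IsContinuousCochain η)
    {Y : ℕ → glFin (DifProj n d) [⋀^Fin m]→ₗ[ℂ] ℂ}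
    (hY : ∀ N A, Y N A = ∫ p in paramDomain n, formAt F d η N p A)
    (A : Fin (m + 1) → glFin (DifProj n d)) :
    ∀ᶠ N in Filter.atTop, ∀ f : (Fin n → ℝ) × (Fin n → ℝ) → ℂ, IntegrableOn f (paramDomain n) →
      (∀ p ∈ paramDomain n, f p = ceDiff η (canonicalTuple F N A p)) →
        ∫ p in paramDomain n, f p = ceDiff (Y N) A := by
  obtain ⟨N₀, k, hk, hA⟩ := exists_level_append (n := n) A
  refine Filter.eventually_atTop.2 ⟨N₀, fun N hN f hf hfx => ?_⟩
  have h0 := integral_ceDiff_velocity_eq_zero (q := n + n + m) hF hn hη hk (by omega) (hA N hN)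
    (x := fun p => canonicalTuple F N A p) (fun p => rfl)
  have hsum : ∀ p, ceDiff (formAt F d η N p) A = ∑ j : Fin (m + 1), ∑ i ∈ Finset.Iio j,
      (-1) ^ (j : ℕ) * formAt F d η N p
        (fun a => Function.update A i ⁅A i, A j⁆ (j.succAbove a)) := fun p => rfl
  have hint : ∀ (j i : Fin (m + 1)), IntegrableOn (fun p => (-1) ^ (j : ℕ) * formAt F d η N p
      (fun a => Function.update A i ⁅A i, A j⁆ (j.succAbove a))) (paramDomain n) := fun j i =>
    (integrableOn_formAt hF hη N _).const_mul _
  -- The terms of `δη` are separated by whether the bracket contains a velocity. The rest is the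
  -- differential of `formAt`, with sign `(-1) ^ (n + n) = 1`.
  have h1 : ∀ p ∈ paramDomain n, ∑ j : Fin (n + n + m + 1), ∑ i ∈ Finset.Iio j,
      (if (i : ℕ) < n + n then (-1) ^ (j : ℕ) * η (fun a => Function.update
        (canonicalTuple F N A p) i ⁅canonicalTuple F N A p i, canonicalTuple F N A p j⁆
          (j.succAbove a)) else 0) = f p - ceDiff (formAt F d η N p) A := by
    intro p hp
    have h2 := sum_ceDiff_append η _ _ (canonicalTuple_eq (F := F) N A p)
    rw [Even.neg_one_pow ⟨n, rfl⟩, one_mul, ← ceDiff_compLinearMap _ _ (exprMat_lie _)] at h2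
    rw [formAt, ← h2, hfx p hp, ceDiff, eq_sub_iff_add_eq, ← Finset.sum_add_distrib]
    refine Finset.sum_congr rfl fun j _ => ?_
    rw [← Finset.sum_add_distrib]
    refine Finset.sum_congr rfl fun i _ => ?_
    split_ifs <;> simp
  rw [setIntegral_congr_fun measurableSet_paramDomain h1, integral_sub hf, sub_eq_zero] at h0
  · rw [h0, ceDiff]
    simp only [hsum]
    rw [integral_finsetSum _ fun j _ => integrable_finsetSum _ fun i _ => hint j i]
    refine Finset.sum_congr rfl fun j _ => ?_
    rw [integral_finsetSum _ fun i _ => hint j i]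
    refine Finset.sum_congr rfl fun i _ => ?_
    rw [integral_const_mul, hY]
  · simp only [hsum]
    exact integrable_finsetSum _ fun j _ => integrable_finsetSum _ fun i _ => hint j i

theorem eventually_ceDiff_eq {L : Type*} [LieRing L] [LieAlgebra ℂ L]
    {Ξ : L [⋀^Fin m]→ₗ[ℂ] ℂ} {Y : ℕ → L [⋀^Fin m]→ₗ[ℂ] ℂ}
    (h : ∀ A, ∀ᶠ N in Filter.atTop, Ξ A = Y N A) (A : Fin (m + 1) → L) :
    ∀ᶠ N in Filter.atTop, ceDiff Ξ A = ceDiff (Y N) A := by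
  have h1 : ∀ᶠ N in Filter.atTop, ∀ j i : Fin (m + 1),
      Ξ (fun a => Function.update A i ⁅A i, A j⁆ (j.succAbove a)) =
        Y N (fun a => Function.update A i ⁅A i, A j⁆ (j.succAbove a)) :=
    Filter.eventually_all.2 fun j => Filter.eventually_all.2 fun i => h _
  filter_upwards [h1] with N hN
  simp only [ceDiff, hN]

variable {ξ : glFin (Dif n) [⋀^Fin (n + n + m)]→ₗ[ℂ] ℂ}
  {Θ : (Fin n → ℝ) × (Fin n → ℝ) → glFin (DifProj n d) [⋀^Fin m]→ₗ[ℂ] ℂ}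
  {Ξ : glFin (DifProj n d) [⋀^Fin m]→ₗ[ℂ] ℂ}

theorem IsCanonicalForm.integrableOn (hF : IsAdmissible d F) (hcont : IsContinuousCochain ξ)
    (hstab : IsStable (n + n) m ξ) (hΘ : IsCanonicalForm F ξ Θ)
    (A : Fin m → glFin (DifProj n d)) : IntegrableOn (fun p => Θ p A) (paramDomain n) := by
  obtain ⟨N, hN⟩ := (hΘ.eventually_eq hF hstab A).exists
  exact (integrableOn_formAt hF hcont N A).congr_fun (fun p hp => (hN p hp).symm)
    measurableSet_paramDomain

/-- Stokes' formula with `η = ξ`: the integrand `δξ` is zero, so the differential of the truncated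
integral is zero. For a given list of arguments that integral agrees with `Ξ` wherever the
differential evaluates it, once `N` is large. -/
theorem IsCanonicalForm.isCocycle_integral (hF : IsAdmissible d F) (hn : 1 ≤ n)
    (hcont : IsContinuousCochain ξ) (hstab : IsStable (n + n) m ξ) (hξ : IsCocycle ξ)
    (hΘ : IsCanonicalForm F ξ Θ) (hΞ : ∀ A, Ξ A = ∫ p in paramDomain n, Θ p A) :
    IsCocycle Ξ := by
  choose Y hY using fun N => exists_alternatingMap_integral (integrableOn_formAt hF hcont N)
  intro A
  have h1 : ∀ A, ∀ᶠ N in Filter.atTop, Ξ A = Y N A := fun A => by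
    filter_upwards [hΘ.eventually_eq hF hstab A] with N hN
    rw [hΞ, hY, setIntegral_congr_fun measurableSet_paramDomain hN]
  obtain ⟨N, h2, h3⟩ := ((eventually_ceDiff_eq h1 A).and
    (eventually_integral_ceDiff hF hn hcont hY A)).exists
  have h4 := h3 (fun _ => 0) integrableOn_zero fun p _ => (hξ _).symm
  rw [h2, ← h4, integral_zero]

/-- Stokes' formula with `ξ = δη` shows that `Ξ` agrees, on each list of arguments, with the
differential of the integral of `η` for large `N`. -/
theorem IsCanonicalForm.isCoboundary_integral (hF : IsAdmissible d F) (hn : 1 ≤ n)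
    (hcont : IsContinuousCochain ξ) (hstab : IsStable (n + n) m ξ)
    (hΘ : IsCanonicalForm F ξ Θ) (hΞ : ∀ A, Ξ A = ∫ p in paramDomain n, Θ p A)
    (hξ : IsCoboundaryOf (fun _ η => IsContinuousCochain η) ξ) : IsCoboundary Ξ := by
  obtain ⟨q, hq, η, hη, hx⟩ := hξ.exists_primitive (by omega)
  cases m with
  | zero =>
    refine AlternatingMap.ext fun A => ?_
    obtain ⟨N, hN⟩ := (hΘ.eventually_eq hF hstab A).exists
    rw [hΞ]
    -- Without operator arguments every bracket contains a velocity, so all of `δη` is exact; the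
    -- zero matrices are placeholders.
    have h0 := integral_ceDiff_velocity_eq_zero (q := q) (N := N) (k := 1)
      (A := fun _ => (0 : glFin (DifProj n d))) hF hn hη le_rfl (by omega)
      (fun i G => by rw [map_zero]; exact (level n N 1).zero_mem) (fun p => rfl)
    refine (setIntegral_congr_fun measurableSet_paramDomain fun p hp => ?_).trans h0
    rw [hN p hp, formAt_eq]
    have h1 : canonicalTuple F N A p = fun i => tuple (fun p => F (torusSimplex p))
        (closedDomain n) N (n + n) (coordDirs n (q + 1)) (fun _ => (0 : glFin (DifProj n d))) p
        (Fin.cast hq i) := by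
      funext i
      have hi : (i : ℕ) < n + n := i.2
      have hi' : ((Fin.cast hq i : Fin (q + 1)) : ℕ) < n + n := i.2
      rw [canonicalTuple, tuple, tuple, if_pos hi, if_pos hi']
      rfl
    rw [h1, hx, ceDiff]
    refine Finset.sum_congr rfl fun j _ => Finset.sum_congr rfl fun i _ => ?_
    rw [if_pos (by omega)]
  | succ m =>
    obtain rfl : q = n + n + m := by omega
    choose Y hY using fun N => exists_alternatingMap_integral (integrableOn_formAt hF hη N)
    -- The integrals `Y N` of the truncations of `η` need not stabilize in `N`, so no limit of them
    -- is taken.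
    refine isCoboundary_of_eventually Ξ Y fun A => ?_
    filter_upwards [hΘ.eventually_eq hF hstab A, eventually_integral_ceDiff hF hn hη hY A]
      with N h1 h2
    rw [hΞ]
    refine h2 _ (hΘ.integrableOn hF hcont hstab A) fun p hp => ?_
    rw [h1 p hp, formAt_eq]
    exact hx (canonicalTuple F N A p)

end Canonical
end LieIntegral
end

theorem theorem4p2 (n m : ℕ) (hn : 1 ≤ n) (d : ℤ)
    (F : (Fin (n + 1) → ℂ) × (Fin (n + 1) → ℝ) → LieIntegral.Frame n)
    (hF : LieIntegral.IsAdmissible d F)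
    (ξ : LieIntegral.glFin (LieIntegral.Dif n) [⋀^Fin (n + n + m)]→ₗ[ℂ] ℂ)
    (hcont : LieIntegral.IsContinuousCochain ξ)
    (hstab : LieIntegral.IsStable (n + n) m ξ)
    (hξ : LieIntegral.IsCocycle ξ) :
    (∃ Θ : (Fin n → ℝ) × (Fin n → ℝ) →
        LieIntegral.glFin (LieIntegral.DifProj n d) [⋀^Fin m]→ₗ[ℂ] ℂ,
      LieIntegral.IsCanonicalForm F ξ Θ) ∧
    ∀ Θ : (Fin n → ℝ) × (Fin n → ℝ) →
        LieIntegral.glFin (LieIntegral.DifProj n d) [⋀^Fin m]→ₗ[ℂ] ℂ,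
      LieIntegral.IsCanonicalForm F ξ Θ →
      (∀ A, MeasureTheory.IntegrableOn (fun p => Θ p A) (LieIntegral.paramDomain n)) ∧
      ∃ Ξ : LieIntegral.glFin (LieIntegral.DifProj n d) [⋀^Fin m]→ₗ[ℂ] ℂ,
        (∀ A, Ξ A = ∫ p in LieIntegral.paramDomain n, Θ p A) ∧
        LieIntegral.IsCocycle Ξ ∧
        (LieIntegral.IsCoboundaryOf (fun _ η => LieIntegral.IsContinuousCochain η) ξ →
          LieIntegral.IsCoboundary Ξ) := by
  refine ⟨hF.exists_canonicalForm hstab, fun Θ hΘ => ?_⟩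
  have hint := hΘ.integrableOn hF hcont hstab
  obtain ⟨Ξ, hΞ⟩ := LieIntegral.exists_alternatingMap_integral hint
  exact ⟨hint, Ξ, hΞ, hΘ.isCocycle_integral hF hn hcont hstab hξ hΞ,
    hΘ.isCoboundary_integral hF hn hcont hstab hΞ⟩
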